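/- Let $S$ be a compact Polish space and let $(V_t)_{t\ge 0}$ be a càdlàg Feller process on $S$, with respect to a right-continuous filtration and laws $(\mathbb P_x)_{x\in S}$ with $\mathbb P_x(V_0=x)=1$; write $\mathbb P_\mu=\int_S\mathbb P_y\,\mu(\mathrm dy)$. Assume that (i) $(V_t)$ has a unique invariant probability measure $\pi$; (ii) for each $x\in S$ there are, on a common probability space $(\tilde\Omega,\tilde{\mathcal F},\tilde{\mathbb P})$, processes $(V^x_t)$ and $(V^\pi_t)$ with the finite-dimensional distributions of $(V_t)$ under $\mathbb P_x$ and under $\mathbb P_\pi$, respectively; (iii) $T^x=\inf\{t\ge 0: V^x_t=V^\pi_t\}$ is a stopping time and there are constants $C,\delta>0$ with $\tilde{\mathbb P}(T^x\ge t)\le C e^{-\delta t}$ for all $t\ge0$ and all $x\in S$. Let $f:\mathbb R^K\times S\to\mathbb R$ be continuous and $C^2$ in $\theta$, with $\nabla_\theta f$ and the Hessian $H_\theta f$ continuous on $\mathbb R^K\times S$, with $\nabla_\theta f(\cdot,y)$ Lipschitz uniformly in $y\in S$, and with $f(\theta,\cdot)$ and $\nabla_\theta f(\theta,\cdot)$ $\pi$-integrable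 for every $\theta$. Assume strong convexity: there is $\kappa>0$ with $$\langle x_1-x_2,\nabla_\theta f(x_1,y)-\nabla_\theta f(x_2,y)\rangle\ge\kappa\|x_1-x_2\|^2\qquad(x_1,x_2\in\mathbb R^K,\ y\in S).$$ For $\varepsilon>0$ let $\theta^\varepsilon$ be the stochastic gradient process with constant learning rate, i.e. the solution of $\mathrm d\theta^\varepsilon_t=-\nabla_\theta f(\theta^\varepsilon_t,V_{t/\varepsilon})\,\mathrm dt$ with $\theta^\varepsilon_0=\theta_0$. For probability measures on $\mathbb R^K$ let $\mathcal W_d(\nu,\nu')=\inf_\Gamma\int \bigl(1\wedge\|y-y'\|\bigr)\,\Gamma(\mathrm dy,\mathrm dy')$, the infimum being over all couplings $\Gamma$ of $\nu$ and $\nu'$. Then the full target function $\Phi(\theta)=\int_S f(\theta,y)\,\pi(\mathrm dy)$ has a unique minimizer $\theta_*$; for every $\varepsilon\in(0,1)$ the coupled process $(\theta^\varepsilon_t,V_{t/\varepsilon})_{t\ge0}$ has a unique stationary probability measure $\Pi^\varepsilon$ on $\mathbb R^K\times S$; and there is a function $\rho:(0,1)\to[0,1]$ with $\lim_{\varepsilon\to0}\rho(\varepsilon)=0$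 such that $$\mathcal W_d\bigl(\Pi^\varepsilon(\cdot,S),\delta_{\theta_*}\bigr)\le\rho(\varepsilon)\qquad\text{for all }\varepsilon\in(0,1).$$ -/

import Mathlib

open MeasureTheory ProbabilityTheory Filter Topology Set
open scoped NNReal ENNReal

universe u v w

namespace SGP

/-- A path is càdlàg: right continuous with left limits. -/
def IsCadlag {S : Type*} [TopologicalSpace S] (v : ℝ≥0 → S) : Prop :=
  ∀ t, ContinuousWithinAt v (Ici t) t ∧ ∃ l, Tendsto v (𝓝[<] t) (𝓝 l)

/-- `V` is a (càdlàg, time-homogeneous) Feller process on the compact space `S`, with respect to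
the right-continuous filtration `ℱ` and the family of laws `P x`, `x : S`. -/
structure IsFellerProcess {S Ω : Type*} [TopologicalSpace S] [MeasurableSpace S]
    {mΩ : MeasurableSpace Ω} (ℱ : Filtration ℝ≥0 mΩ) (P : Kernel S Ω) (V : ℝ≥0 → Ω → S) :
    Prop where
  rightCont : ℱ.IsRightContinuous
  adapted : Adapted ℱ V
  cadlag : ∀ ω, IsCadlag (fun t => V t ω)
  /-- `P x (V 0 = x) = 1`. -/
  start : ∀ x, ∀ᵐ ω ∂(P x), V 0 ω = x
  /-- Markov property: `E_x[h(V_{t+s}) | ℱ_t] = E_{V_t}[h(V_s)]`. -/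
  markov : ∀ (x : S) (s t : ℝ≥0) (h : C(S, ℝ)),
    (P x)[fun ω => h (V (t + s) ω) | ℱ t] =ᵐ[P x] fun ω => ∫ ω', h (V s ω') ∂(P (V t ω))
  /-- The semigroup maps continuous functions to continuous functions. -/
  feller : ∀ (t : ℝ≥0) (h : C(S, ℝ)), Continuous fun x => ∫ ω, h (V t ω) ∂(P x)
  /-- The semigroup is continuous at time `0`. -/
  continuous_zero : ∀ (h : C(S, ℝ)) (x : S),
    Tendsto (fun t : ℝ≥0 => ∫ ω, h (V t ω) ∂(P x)) (𝓝 0) (𝓝 (h x))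

/-- `μ` is an invariant probability measure of the Markov family `(P, V)`. -/
def IsInvariantLaw {S Ω : Type*} [MeasurableSpace S] [MeasurableSpace Ω]
    (P : Kernel S Ω) (V : ℝ≥0 → Ω → S) (μ : Measure S) : Prop :=
  IsProbabilityMeasure μ ∧ ∀ t, Kernel.Invariant (P.map (V t)) μ

/-- The processes `X` under `μ` and `Y` under `ν` have the same finite-dimensional
distributions. -/
def SameFDD {S Ω₁ Ω₂ : Type*} [MeasurableSpace S] [MeasurableSpace Ω₁] [MeasurableSpace Ω₂]
    (μ : Measure Ω₁) (X : ℝ≥0 → Ω₁ → S) (ν : Measure Ω₂) (Y : ℝ≥0 → Ω₂ → S) : Prop :=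
  ∀ (n : ℕ) (t : Fin n → ℝ≥0), StrictMono t → ∀ A : Fin n → Set S, (∀ i, MeasurableSet (A i)) →
    μ {ω | ∀ i, X (t i) ω ∈ A i} = ν {ω | ∀ i, Y (t i) ω ∈ A i}

/-- The first meeting time `inf {t ≥ 0 | X_t = Y_t}` (with value `⊤` if there is no meeting). -/
noncomputable def meetingTime {S Ω : Type*} (X Y : ℝ≥0 → Ω → S) : Ω → WithTop ℝ≥0 :=
  hittingAfter (fun t ω => (X t ω, Y t ω)) (diagonal S) 0

/-- On some probability space there are a version `Vx` of `V` started at `x` and a stationary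
version `Vpi` of `V` whose first meeting time is a stopping time with tail at most
`C exp (-δ t)`. -/
def HasCoupling {S : Type u} {Ω : Type v} [MeasurableSpace S] [MeasurableSpace Ω]
    (P : Kernel S Ω) (V : ℝ≥0 → Ω → S) (π : Measure S) (C δ : ℝ) (x : S) : Prop :=
  ∃ (Ω' : Type w) (mΩ' : MeasurableSpace Ω') (P' : Measure Ω') (𝒢 : Filtration ℝ≥0 mΩ')
    (Vx Vpi : ℝ≥0 → Ω' → S),
    IsProbabilityMeasure P' ∧ Adapted 𝒢 Vx ∧ Adapted 𝒢 Vpi ∧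
    SameFDD P' Vx (P x) V ∧ SameFDD P' Vpi (π.bind P) V ∧
    IsStoppingTime 𝒢 (meetingTime Vx Vpi) ∧
    ∀ t : ℝ≥0, P' {ω | (t : WithTop ℝ≥0) ≤ meetingTime Vx Vpi ω} ≤
      ENNReal.ofReal (C * Real.exp (-δ * t))

/-- Standing assumption on the index process: `π` is its unique invariant probability measure and
versions started at points can be coupled to a stationary version so that they meet exponentially
fast, uniformly in the starting point. -/
structure IndexAssumption {S : Type u} {Ω : Type v} [MeasurableSpace S]
    [MeasurableSpace Ω] (P : Kernel S Ω) (V : ℝ≥0 → Ω → S) (π : Measure S) : Prop where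
  invariant : IsInvariantLaw P V π
  unique : ∀ μ, IsInvariantLaw P V μ → μ = π
  coupling : ∃ C δ : ℝ, 0 < C ∧ 0 < δ ∧ ∀ x, HasCoupling.{u, v, w} P V π C δ x

section Target

variable {K : ℕ} {S : Type*}

/-- The gradient `∇_θ f(θ, y)`. -/
noncomputable def gradθ (f : EuclideanSpace ℝ (Fin K) → S → ℝ) (θ : EuclideanSpace ℝ (Fin K))
    (y : S) : EuclideanSpace ℝ (Fin K) :=
  gradient (fun x => f x y) θ

/-- Regularity of the subsampled target function: `f`, `∇_θ f` and the Hessian `H_θ f` are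
continuous on `ℝ^K × S`, `∇_θ f(·, y)` is Lipschitz uniformly in `y`, and `f(θ, ·)`,
`∇_θ f(θ, ·)` are `π`-integrable. -/
structure TargetAssumption [TopologicalSpace S] [MeasurableSpace S] (π : Measure S)
    (f : EuclideanSpace ℝ (Fin K) → S → ℝ) : Prop where
  contDiff : ∀ y, ContDiff ℝ 2 (fun θ => f θ y)
  continuous : Continuous fun p : EuclideanSpace ℝ (Fin K) × S => f p.1 p.2
  continuous_grad : Continuous fun p : EuclideanSpace ℝ (Fin K) × S => gradθ f p.1 p.2
  continuous_hess : Continuous fun p : EuclideanSpace ℝ (Fin K) × S =>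
    fderiv ℝ (fun θ => gradθ f θ p.2) p.1
  lipschitz : ∃ L : ℝ≥0, ∀ y, LipschitzWith L (fun θ => gradθ f θ y)
  integrable : ∀ θ, Integrable (f θ) π
  integrable_grad : ∀ θ, Integrable (gradθ f θ) π

/-- Strong convexity of `f(·, y)`, with a parameter that does not depend on `y`. -/
def StrongConvexity (f : EuclideanSpace ℝ (Fin K) → S → ℝ) : Prop :=
  ∃ κ : ℝ, 0 < κ ∧ ∀ y x₁ x₂, κ * ‖x₁ - x₂‖ ^ 2 ≤ inner ℝ (x₁ - x₂) (gradθ f x₁ y - gradθ f x₂ y)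

/-- The full target function `Φ(θ) = ∫ f(θ, y) π(dy)`. -/
noncomputable def fullTarget [MeasurableSpace S] (π : Measure S)
    (f : EuclideanSpace ℝ (Fin K) → S → ℝ) (θ : EuclideanSpace ℝ (Fin K)) : ℝ :=
  ∫ y, f θ y ∂π

/-- `θ` is the unique minimizer of `Φ`. -/
def IsUniqueMinimizer (Φ : EuclideanSpace ℝ (Fin K) → ℝ) (θ : EuclideanSpace ℝ (Fin K)) : Prop :=
  (∀ x, Φ θ ≤ Φ x) ∧ ∀ θ', (∀ x, Φ θ' ≤ Φ x) → θ' = θ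

/-- `θ` solves `dθ_t = -∇_θ f(θ_t, v_{t/ε}) dt`, `θ_0 = m`, in integrated form, along the
index path `v`. -/
def IsSGPCPath (f : EuclideanSpace ℝ (Fin K) → S → ℝ) (v : ℝ≥0 → S) (ε : ℝ≥0)
    (m : EuclideanSpace ℝ (Fin K)) (θ : ℝ≥0 → EuclideanSpace ℝ (Fin K)) : Prop :=
  Continuous θ ∧
    ∀ t : ℝ≥0, θ t = m - ∫ s in (0 : ℝ)..t, gradθ f (θ s.toNNReal) (v (s.toNNReal / ε))

/-- The stochastic gradient path with constant learning rate along the index path `v`: the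
solution of the equation above (which exists and is unique for càdlàg `v` and `f` as in
`TargetAssumption`). -/
noncomputable def sgpcPath (f : EuclideanSpace ℝ (Fin K) → S → ℝ) (v : ℝ≥0 → S) (ε : ℝ≥0)
    (m : EuclideanSpace ℝ (Fin K)) : ℝ≥0 → EuclideanSpace ℝ (Fin K) :=
  Classical.epsilon (IsSGPCPath f v ε m)

/-- The law of `(θ^ε_t, V_{t/ε})` under `P a` with `θ^ε_0 = m`. -/
noncomputable def coupledLaw {Ω : Type*} [MeasurableSpace S] [MeasurableSpace Ω]
    (P : Kernel S Ω) (V : ℝ≥0 → Ω → S) (f : EuclideanSpace ℝ (Fin K) → S → ℝ) (ε t : ℝ≥0)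
    (m : EuclideanSpace ℝ (Fin K)) (a : S) : Measure (EuclideanSpace ℝ (Fin K) × S) :=
  (P a).map fun ω => (sgpcPath f (fun s => V s ω) ε m t, V (t / ε) ω)

/-- `Q` is a stationary probability measure of the coupled process `(θ^ε_t, V_{t/ε})`. -/
def IsStationary {Ω : Type*} [MeasurableSpace S] [MeasurableSpace Ω]
    (P : Kernel S Ω) (V : ℝ≥0 → Ω → S) (f : EuclideanSpace ℝ (Fin K) → S → ℝ) (ε : ℝ≥0)
    (Q : Measure (EuclideanSpace ℝ (Fin K) × S)) : Prop :=
  IsProbabilityMeasure Q ∧ ∀ (t : ℝ≥0) (B : Set (EuclideanSpace ℝ (Fin K) × S)),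
    MeasurableSet B → ∫⁻ p, coupledLaw P V f ε t p.1 p.2 B ∂Q = Q B

/-- The Wasserstein distance for the bounded metric `d(y, y') = 1 ∧ ‖y - y'‖`: the infimum of
`∫ d dΓ` over all couplings `Γ` of `ν` and `ν'`. -/
noncomputable def wassersteinD (ν ν' : Measure (EuclideanSpace ℝ (Fin K))) : ℝ≥0∞ :=
  ⨅ Γ ∈ {Γ : Measure (EuclideanSpace ℝ (Fin K) × EuclideanSpace ℝ (Fin K)) |
    Γ.map Prod.fst = ν ∧ Γ.map Prod.snd = ν'},
    ∫⁻ p, ENNReal.ofReal (min 1 ‖p.1 - p.2‖) ∂Γ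

end Target

end SGP

/-! Strong convexity makes the gradient flow forget its starting position: two solutions along the
same index path approach each other at rate `exp (-κ t)` (`IsFlowPath.norm_sub_le`), and the ball of
radius `B / κ` is never left, where `B` bounds the gradient at `θ = 0` (`IsFlowPath.norm_le`).

The coupled process is Markov (`IsMarkovFamily.coupledKernel_add`). The flow depends on the whole
index path, while the Markov hypothesis speaks of one future time. The Euler scheme bridges the gap:
it reads the index at finitely many times, so the hypothesis can be iterated, and the scheme
converges to the flow along every path.

A stationary law of the pair has an invariant law of the index as second marginal, hence has
marginal `π`. Two initial laws with marginal `π` can be compared by starting both flows along the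
same index path, and the contraction erases the difference; this gives uniqueness
(`IsMarkovFamily.stationary_unique`). For existence, start from `θ = 0` and index law `π`: the laws
at integer times live on a compact set, and any limit point is stationary because an initial run of
length `s` is forgotten (`IsMarkovFamily.exists_stationary`). No time averaging is needed there.

For the concentration let `θ_*` be the zero of the `π`-averaged gradient. By stationarity the
coupled process may be run for a time `T`, and the starting position may be replaced by `θ_*` at
cost `exp (-κ T)` times a constant. From `θ_*` the displacement is controlled in mean square by the
integrals of `∇f(θ_*, V_{s/ε})` over `[0, t]`, `t ≤ T` (`IsMonotoneDrift.norm_flow_sub_sq_le`).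
Their integrand has `π`-mean zero, so a mean square law of large numbers bounds the second moments
by `T (ε C + η T)`, with `η` arbitrarily small and `C` depending on `η`. That law follows from
uniqueness of `π` by a Krylov–Bogoliubov argument
(`IsMarkovFamily.exists_abs_integral_semigroup_le`). Choosing `T`, then `η`, then `ε` finishes the
proof; `ρ ε` is the stationary mean of `1 ∧ ‖θ - θ_*‖`. -/

namespace SGP

set_option linter.unusedSectionVars false

/-! ### Measurability of right continuous processes. -/

section RightContinuous

variable {S Ω : Type*} [TopologicalSpace S]

/-- The grid point strictly to the right of `s`, for the grid of mesh `δ`. -/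
noncomputable def nextGrid (δ s : ℝ≥0) : ℝ≥0 := (⌊s / δ⌋₊ + 1 : ℕ) * δ

lemma le_nextGrid {δ : ℝ≥0} (hδ : 0 < δ) (s : ℝ≥0) : s ≤ nextGrid δ s := by
  have h := (Nat.lt_floor_add_one (s / δ)).le
  rw [div_le_iff₀ hδ] at h
  simpa [nextGrid] using h

lemma nextGrid_le {δ : ℝ≥0} (hδ : 0 < δ) (s : ℝ≥0) : nextGrid δ s ≤ s + δ := by
  have h := Nat.floor_le (zero_le (a := s / δ))
  rw [le_div_iff₀ hδ] at h
  simp only [nextGrid, Nat.cast_add, Nat.cast_one, add_mul, one_mul]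
  gcongr

lemma tendsto_nextGrid {δ : ℕ → ℝ≥0} (hδ : ∀ n, 0 < δ n) (h0 : Tendsto δ atTop (𝓝 0)) (s : ℝ≥0) :
    Tendsto (fun n => nextGrid (δ n) s) atTop (𝓝[≥] s) := by
  refine tendsto_nhdsWithin_iff.2 ⟨?_, Eventually.of_forall fun n => le_nextGrid (hδ n) s⟩
  refine tendsto_of_tendsto_of_tendsto_of_le_of_le tendsto_const_nhds ?_
    (fun n => le_nextGrid (hδ n) s) (fun n => nextGrid_le (hδ n) s)
  simpa using h0.const_add s

/-- By right continuity the process is the pointwise limit of its values at the next grid point, and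
each of these discretizations takes only countably many times. -/
lemma measurable_uncurry_of_rightContinuous [TopologicalSpace.PseudoMetrizableSpace S]
    [MeasurableSpace S] [BorelSpace S] [MeasurableSpace Ω] {U : ℝ≥0 → Ω → S}
    (hU : ∀ t, Measurable (U t)) (hc : ∀ ω t, ContinuousWithinAt (fun s => U s ω) (Ici t) t) :
    Measurable (Function.uncurry U) := by
  have hδ : ∀ n : ℕ, (0 : ℝ≥0) < 1 / ((n : ℝ≥0) + 1) := fun n => by positivity
  refine measurable_of_tendsto_metrizable
    (f := fun (n : ℕ) (p : ℝ≥0 × Ω) => U (nextGrid (1 / ((n : ℝ≥0) + 1)) p.1) p.2) (fun n => ?_) ?_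
  · have h1 : Measurable fun q : ℕ × Ω => U ((q.1 + 1 : ℕ) * (1 / ((n : ℝ≥0) + 1))) q.2 :=
      measurable_from_prod_countable_right fun k => hU ((k + 1 : ℕ) * (1 / ((n : ℝ≥0) + 1)))
    exact h1.comp (f := fun p : ℝ≥0 × Ω => (⌊p.1 / (1 / ((n : ℝ≥0) + 1))⌋₊, p.2))
      ((Nat.measurable_floor.comp (measurable_fst.div_const _)).prodMk measurable_snd)
  · refine tendsto_pi_nhds.2 fun p => ?_
    exact (hc p.2 p.1).tendsto.comp
      (tendsto_nextGrid hδ tendsto_one_div_add_atTop_nhds_zero_nat p.1)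

lemma measurable_of_rightContinuous [TopologicalSpace.PseudoMetrizableSpace S]
    [MeasurableSpace S] [BorelSpace S] {w : ℝ≥0 → S}
    (hw : ∀ t, ContinuousWithinAt w (Ici t) t) : Measurable w :=
  (measurable_uncurry_of_rightContinuous (U := fun t (_ : Unit) => w t)
    (fun _ => measurable_const) (fun _ => hw)).comp
    (f := fun t : ℝ≥0 => (t, ())) (measurable_id.prodMk measurable_const)

end RightContinuous

/-! ### Monotone drifts: global existence of the flow. -/

/-- A drift `g(θ, y)` that is jointly continuous, bounded at `θ = 0`, Lipschitz and strongly
monotone in `θ`, uniformly in `y`. -/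
structure IsMonotoneDrift {E S : Type*} [NormedAddCommGroup E] [InnerProductSpace ℝ E]
    [TopologicalSpace S] (g : E → S → E) (L : ℝ≥0) (κ B : ℝ) : Prop where
  cont : Continuous fun p : E × S => g p.1 p.2
  lip : ∀ y, LipschitzWith L fun x => g x y
  bound : ∀ y, ‖g 0 y‖ ≤ B
  pos : 0 < κ
  mono : ∀ y x₁ x₂, κ * ‖x₁ - x₂‖ ^ 2 ≤ inner ℝ (x₁ - x₂) (g x₁ y - g x₂ y)

/-- `θ` solves `dθ_t = -g(θ_t, w_t) dt`, `θ_0 = m`, in integrated form. -/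
def IsFlowPath {E S : Type*} [NormedAddCommGroup E] [NormedSpace ℝ E] (g : E → S → E)
    (w : ℝ≥0 → S) (m : E) (θ : ℝ≥0 → E) : Prop :=
  Continuous θ ∧ ∀ t : ℝ≥0, θ t = m - ∫ s in (0 : ℝ)..t, g (θ s.toNNReal) (w s.toNNReal)

section Flow

variable {E S : Type*} [NormedAddCommGroup E] [InnerProductSpace ℝ E] [CompleteSpace E]
  [SecondCountableTopology E] [MeasurableSpace E] [BorelSpace E]
  [TopologicalSpace S] [PolishSpace S] [MeasurableSpace S] [BorelSpace S]
  {g : E → S → E} {L : ℝ≥0} {κ B : ℝ} {w : ℝ≥0 → S} {m : E} {θ : ℝ≥0 → E}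

lemma IsMonotoneDrift.norm_apply_sub_le (hg : IsMonotoneDrift g L κ B) (x₁ x₂ : E) (y : S) :
    ‖g x₁ y - g x₂ y‖ ≤ L * ‖x₁ - x₂‖ := by
  simpa [dist_eq_norm] using (hg.lip y).dist_le_mul x₁ x₂

lemma IsMonotoneDrift.norm_le (hg : IsMonotoneDrift g L κ B) (x : E) (y : S) :
    ‖g x y‖ ≤ B + L * ‖x‖ := by
  have h1 := hg.norm_apply_sub_le x 0 y
  have h2 := norm_add_le (g 0 y) (g x y - g 0 y)
  rw [sub_zero] at h1
  rw [add_sub_cancel] at h2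
  linarith [hg.bound y]

lemma IsMonotoneDrift.measurable (hg : IsMonotoneDrift g L κ B) :
    Measurable fun p : E × S => g p.1 p.2 := hg.cont.measurable

lemma IsMonotoneDrift.measurable_comp (hg : IsMonotoneDrift g L κ B)
    (hw : ∀ t, ContinuousWithinAt w (Ici t) t) {u : ℝ → E} (hu : Measurable u) :
    Measurable fun s : ℝ => g (u s) (w s.toNNReal) :=
  hg.measurable.comp (hu.prodMk ((measurable_of_rightContinuous hw).comp measurable_real_toNNReal))

lemma IsMonotoneDrift.intervalIntegrable (hg : IsMonotoneDrift g L κ B)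
    (hw : ∀ t, ContinuousWithinAt w (Ici t) t) {u : ℝ → E} (hu : Continuous u) (a b : ℝ) :
    IntervalIntegrable (fun s : ℝ => g (u s) (w s.toNNReal)) volume a b := by
  have h : Continuous fun s => B + L * ‖u s‖ := by fun_prop
  refine (h.intervalIntegrable a b).mono_fun
    (hg.measurable_comp hw hu.measurable).aestronglyMeasurable (ae_of_all _ fun s => ?_)
  exact (hg.norm_le _ _).trans (le_abs_self _)

lemma integral_exp_mul_le {l : ℝ} (hl : 0 < l) (t : ℝ) :
    ∫ s in (0 : ℝ)..t, Real.exp (l * s) ≤ Real.exp (l * t) / l := by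
  rw [intervalIntegral.integral_comp_mul_left _ hl.ne', integral_exp]
  simp only [mul_zero, Real.exp_zero, smul_eq_mul]
  rw [div_eq_inv_mul]
  gcongr
  linarith

/-- The Picard map on exponentially weighted paths. -/
noncomputable def picard (g : E → S → E) (w : ℝ≥0 → S) (m : E) (l : ℝ) (u : ℝ≥0 → E) (t : ℝ≥0) :
    E :=
  Real.exp (-l * t) •
    (m - ∫ s in (0 : ℝ)..t, g (Real.exp (l * s) • u s.toNNReal) (w s.toNNReal))

/-- With `u = exp (-l t) θ`, the Lipschitz error grows at most like `L D exp (l s)`, whose integral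
is at most `L D exp (l t) / l`; the outer weight cancels the exponential. The estimate is uniform on
the whole half line, so no gluing of local solutions is needed. -/
lemma IsMonotoneDrift.norm_picard_sub_le (hg : IsMonotoneDrift g L κ B)
    (hw : ∀ t, ContinuousWithinAt w (Ici t) t) {l : ℝ} (hl : 0 < l) {u u' : ℝ≥0 → E}
    (hu : Continuous u) (hu' : Continuous u') {D : ℝ} (hD : ∀ t, ‖u t - u' t‖ ≤ D) (t : ℝ≥0) :
    ‖picard g w m l u t - picard g w m l u' t‖ ≤ L / l * D := by
  have hD0 : 0 ≤ D := (norm_nonneg _).trans (hD 0)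
  have hi : ∀ {u : ℝ≥0 → E}, Continuous u → IntervalIntegrable
      (fun s : ℝ => g (Real.exp (l * s) • u s.toNNReal) (w s.toNNReal)) volume 0 t :=
    fun hu => hg.intervalIntegrable (u := fun s : ℝ => Real.exp (l * s) • _) hw
      ((by fun_prop : Continuous fun s : ℝ => Real.exp (l * s)).smul
        (hu.comp continuous_real_toNNReal)) 0 t
  have hc : Continuous fun s : ℝ => (L * D) * Real.exp (l * s) := by fun_prop
  have h1 : ‖∫ s in (0 : ℝ)..t, (g (Real.exp (l * s) • u' s.toNNReal) (w s.toNNReal)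
      - g (Real.exp (l * s) • u s.toNNReal) (w s.toNNReal))‖
      ≤ ∫ s in (0 : ℝ)..t, (L * D) * Real.exp (l * s) := by
    refine intervalIntegral.norm_integral_le_of_norm_le t.coe_nonneg (ae_of_all _ fun s _ => ?_)
      (hc.intervalIntegrable _ _)
    refine (hg.norm_apply_sub_le _ _ _).trans ?_
    rw [← smul_sub, norm_smul, Real.norm_of_nonneg (Real.exp_pos _).le, norm_sub_rev, mul_assoc,
      mul_comm D]
    gcongr
    exact hD _
  rw [intervalIntegral.integral_const_mul] at h1
  rw [picard, picard, ← smul_sub, sub_sub_sub_cancel_left,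
    ← intervalIntegral.integral_sub (hi hu') (hi hu), norm_smul,
    Real.norm_of_nonneg (Real.exp_pos _).le]
  calc _ ≤ Real.exp (-l * t) * (L * D * (Real.exp (l * t) / l)) := by
        gcongr
        exact h1.trans (by gcongr; exact integral_exp_mul_le hl _)
    _ = (Real.exp (-l * t) * Real.exp (l * t)) * (L / l * D) := by ring
    _ = L / l * D := by rw [← Real.exp_add]; simp

lemma IsMonotoneDrift.norm_picard_zero_le (hg : IsMonotoneDrift g L κ B) {l : ℝ} (hl : 0 < l)
    (t : ℝ≥0) : ‖picard g w m l 0 t‖ ≤ ‖m‖ + B / l := by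
  have hB : 0 ≤ B := (norm_nonneg _).trans (hg.bound (w 0))
  have hc : Continuous fun s : ℝ => B * Real.exp (l * s) := by fun_prop
  have h1 : ‖∫ s in (0 : ℝ)..t, g (Real.exp (l * s) • (0 : ℝ≥0 → E) s.toNNReal) (w s.toNNReal)‖
      ≤ ∫ s in (0 : ℝ)..t, B * Real.exp (l * s) := by
    refine intervalIntegral.norm_integral_le_of_norm_le t.coe_nonneg (ae_of_all _ fun s hs => ?_)
      (hc.intervalIntegrable _ _)
    simp only [Pi.zero_apply, smul_zero]
    exact (hg.bound _).trans (le_mul_of_one_le_right hB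
      (Real.one_le_exp (mul_nonneg hl.le hs.1.le)))
  rw [intervalIntegral.integral_const_mul] at h1
  have he : Real.exp (-l * t) ≤ 1 := Real.exp_le_one_iff.2 (by have := t.coe_nonneg; simp; positivity)
  rw [picard, norm_smul, Real.norm_of_nonneg (Real.exp_pos _).le]
  calc _ ≤ Real.exp (-l * t) * (‖m‖ + B * (Real.exp (l * t) / l)) := by
        gcongr
        exact (norm_sub_le _ _).trans
          (by gcongr; exact h1.trans (by gcongr; exact integral_exp_mul_le hl _))
    _ = Real.exp (-l * t) * ‖m‖ + (Real.exp (-l * t) * Real.exp (l * t)) * (B / l) := by ring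
    _ = Real.exp (-l * t) * ‖m‖ + B / l := by rw [← Real.exp_add]; simp
    _ ≤ _ := by gcongr; exact mul_le_of_le_one_left (norm_nonneg _) he

lemma IsMonotoneDrift.continuous_picard (hg : IsMonotoneDrift g L κ B)
    (hw : ∀ t, ContinuousWithinAt w (Ici t) t) (l : ℝ) {u : ℝ≥0 → E} (hu : Continuous u) :
    Continuous (picard g w m l u) := by
  have hi : ∀ a b, IntervalIntegrable
      (fun s : ℝ => g (Real.exp (l * s) • u s.toNNReal) (w s.toNNReal)) volume a b :=
    hg.intervalIntegrable (u := fun s : ℝ => Real.exp (l * s) • _) hw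
      ((by fun_prop : Continuous fun s : ℝ => Real.exp (l * s)).smul
        (hu.comp continuous_real_toNNReal))
  exact (by fun_prop : Continuous fun t : ℝ≥0 => Real.exp (-l * t)).smul
    (continuous_const.sub ((intervalIntegral.continuous_primitive hi 0).comp NNReal.continuous_coe))

lemma IsMonotoneDrift.exists_isFlowPath (hg : IsMonotoneDrift g L κ B)
    (hw : ∀ t, ContinuousWithinAt w (Ici t) t) (m : E) : ∃ θ, IsFlowPath g w m θ := by
  -- Any weight larger than `L` makes the Picard map a contraction.
  set l : ℝ := L + 1 with hl_def
  have hl : 0 < l := by positivity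
  have hbd : ∀ (u : BoundedContinuousFunction ℝ≥0 E) (t : ℝ≥0),
      ‖picard g w m l u t‖ ≤ L / l * ‖u‖ + (‖m‖ + B / l) := fun u t => by
    have h1 := hg.norm_picard_sub_le (m := m) hw hl u.continuous (u' := 0) continuous_zero
      (D := ‖u‖) (fun t => by simpa using u.norm_coe_le_norm t) t
    have h2 := norm_add_le (picard g w m l u t - picard g w m l 0 t) (picard g w m l 0 t)
    rw [sub_add_cancel] at h2
    exact h2.trans (add_le_add h1 (hg.norm_picard_zero_le hl t))
  let Ψ : BoundedContinuousFunction ℝ≥0 E → BoundedContinuousFunction ℝ≥0 E := fun u =>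
    BoundedContinuousFunction.ofNormedAddCommGroup (picard g w m l u)
      (hg.continuous_picard hw l u.continuous) _ (hbd u)
  have hΨ : ContractingWith (L / (L + 1)) Ψ := by
    refine ⟨by rw [div_lt_one (by positivity)]; exact lt_add_one L, ?_⟩
    refine LipschitzWith.of_dist_le_mul fun u u' => ?_
    refine (BoundedContinuousFunction.dist_le (by positivity)).2 fun t => ?_
    rw [dist_eq_norm]
    exact hg.norm_picard_sub_le hw hl u.continuous u'.continuous
      (fun s => by rw [← dist_eq_norm]; exact BoundedContinuousFunction.dist_coe_le_dist s) t
  obtain ⟨u, hu⟩ : ∃ u, Ψ u = u := ⟨_, hΨ.fixedPoint_isFixedPt⟩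
  have hfix : ∀ t, picard g w m l u t = u t := fun t => congrArg (fun v => v t) hu
  refine ⟨fun t => Real.exp (l * t) • u t,
    (by fun_prop : Continuous fun t : ℝ≥0 => Real.exp (l * t)).smul u.continuous, fun t => ?_⟩
  beta_reduce
  rw [← hfix t, picard, smul_smul, ← Real.exp_add]
  have h0 : l * t + -l * t = 0 := by ring
  rw [h0, Real.exp_zero, one_smul]
  congr 1
  refine intervalIntegral.integral_congr fun s hs => ?_
  rw [uIcc_of_le t.coe_nonneg] at hs
  simp only [Real.coe_toNNReal s hs.1]

lemma rightContinuous_comp_toNNReal (hw : ∀ t, ContinuousWithinAt w (Ici t) t) (t : ℝ) :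
    ContinuousWithinAt (fun s : ℝ => w s.toNNReal) (Ici t) t :=
  (hw t.toNNReal).comp continuous_real_toNNReal.continuousWithinAt
    fun _ hs => Real.toNNReal_le_toNNReal hs

lemma IsMonotoneDrift.continuousWithinAt_comp (hg : IsMonotoneDrift g L κ B)
    (hw : ∀ t, ContinuousWithinAt w (Ici t) t) {u : ℝ → E} (hu : Continuous u) (t : ℝ) :
    ContinuousWithinAt (fun s : ℝ => g (u s) (w s.toNNReal)) (Ici t) t :=
  hg.cont.continuousAt.comp_continuousWithinAt (f := fun s : ℝ => (u s, w s.toNNReal))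
    (hu.continuousWithinAt.prodMk (rightContinuous_comp_toNNReal hw t))

/-- The index path is only right continuous, so only right derivatives are available. The
differential inequalities for the flow are therefore stated for right derivatives. -/
lemma IsMonotoneDrift.hasDerivWithinAt_integral (hg : IsMonotoneDrift g L κ B)
    (hw : ∀ t, ContinuousWithinAt w (Ici t) t) {u : ℝ → E} (hu : Continuous u) (t : ℝ) :
    HasDerivWithinAt (fun t : ℝ => ∫ s in (0 : ℝ)..t, g (u s) (w s.toNNReal))
      (g (u t) (w t.toNNReal)) (Ici t) t :=
  intervalIntegral.integral_hasDerivWithinAt_right (hg.intervalIntegrable hw hu 0 t)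
    (s := Ici t) (t := Ioi t)
    (hg.measurable_comp hw hu.measurable).stronglyMeasurable.stronglyMeasurableAtFilter
    ((hg.continuousWithinAt_comp hw hu t).mono Ioi_subset_Ici_self)

lemma IsFlowPath.continuous_comp_toNNReal (hθ : IsFlowPath g w m θ) :
    Continuous fun s : ℝ => θ s.toNNReal := hθ.1.comp continuous_real_toNNReal

lemma IsFlowPath.hasDerivWithinAt (hg : IsMonotoneDrift g L κ B)
    (hw : ∀ t, ContinuousWithinAt w (Ici t) t) (hθ : IsFlowPath g w m θ) {t : ℝ} (ht : 0 ≤ t) :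
    HasDerivWithinAt (fun s : ℝ => θ s.toNNReal) (-g (θ t.toNNReal) (w t.toNNReal)) (Ici t) t := by
  refine (((hg.hasDerivWithinAt_integral hw hθ.continuous_comp_toNNReal t).const_sub m)).congr
    (fun s hs => ?_) ?_
  · rw [hθ.2, Real.coe_toNNReal s (ht.trans hs)]
  · rw [hθ.2, Real.coe_toNNReal t ht]

lemma IsFlowPath.zero (hθ : IsFlowPath g w m θ) : θ 0 = m := by
  rw [hθ.2]; simp

end Flow

/-! ### Contraction, absorbing ball and flow property. -/

/-- The solution of `dθ_t = -g(θ_t, w_t) dt`, `θ_0 = m`. -/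
noncomputable def flow {E S : Type*} [NormedAddCommGroup E] [NormedSpace ℝ E] (g : E → S → E)
    (w : ℝ≥0 → S) (m : E) : ℝ≥0 → E :=
  Classical.epsilon (IsFlowPath g w m)

/-- The Euler scheme of step `δ` for `dθ_t = -g(θ_t, w_t) dt`, which evaluates `w` at the right
endpoint of each step. -/
noncomputable def euler {E S : Type*} [NormedAddCommGroup E] [NormedSpace ℝ E] (g : E → S → E)
    (δ : ℝ≥0) (w : ℝ≥0 → S) (m : E) : ℕ → E
  | 0 => m
  | k + 1 => euler g δ w m k - (δ : ℝ) • g (euler g δ w m k) (w ((k + 1 : ℕ) * δ))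

section Flow

variable {E S : Type*} [NormedAddCommGroup E] [InnerProductSpace ℝ E] [CompleteSpace E]
  [SecondCountableTopology E] [MeasurableSpace E] [BorelSpace E]
  [TopologicalSpace S] [PolishSpace S] [MeasurableSpace S] [BorelSpace S]
  {g : E → S → E} {L : ℝ≥0} {κ B : ℝ} {w : ℝ≥0 → S} {m m' : E} {θ θ' : ℝ≥0 → E}

/-- Strong monotonicity bounds the right derivative of the squared distance by `-2 κ` times itself;
then Gronwall. -/
lemma IsFlowPath.norm_sub_le (hg : IsMonotoneDrift g L κ B)
    (hw : ∀ t, ContinuousWithinAt w (Ici t) t) (hθ : IsFlowPath g w m θ)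
    (hθ' : IsFlowPath g w m' θ') (t : ℝ≥0) :
    ‖θ t - θ' t‖ ≤ Real.exp (-κ * t) * ‖m - m'‖ := by
  have h := le_gronwallBound_of_liminf_deriv_right_le (a := 0) (b := t) (K := -2 * κ) (ε := 0)
    (f := fun s : ℝ => ‖θ s.toNNReal - θ' s.toNNReal‖ ^ 2) (δ := ‖m - m'‖ ^ 2)
    (f' := fun s : ℝ => 2 * inner ℝ (θ s.toNNReal - θ' s.toNNReal)
      (-g (θ s.toNNReal) (w s.toNNReal) - -g (θ' s.toNNReal) (w s.toNNReal)))
    ((hθ.continuous_comp_toNNReal.sub hθ'.continuous_comp_toNNReal).norm.pow 2).continuousOn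
    (fun s hs r hr => HasDerivWithinAt.liminf_right_slope_le
      ((hθ.hasDerivWithinAt hg hw hs.1).sub (hθ'.hasDerivWithinAt hg hw hs.1)).norm_sq hr)
    (by simp [hθ.zero, hθ'.zero])
    (fun s _ => by
      have h1 := hg.mono (w s.toNNReal) (θ s.toNNReal) (θ' s.toNNReal)
      rw [neg_sub_neg, ← neg_sub (g (θ s.toNNReal) _), inner_neg_right]
      linarith) t ⟨t.coe_nonneg, le_rfl⟩
  rw [gronwallBound_ε0, sub_zero] at h
  simp only [Real.toNNReal_coe] at h
  refine le_of_sq_le_sq (h.trans_eq ?_) (by positivity)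
  rw [mul_pow, ← Real.exp_nat_mul, mul_comm]
  congr 2
  push_cast
  ring

lemma IsFlowPath.unique (hg : IsMonotoneDrift g L κ B)
    (hw : ∀ t, ContinuousWithinAt w (Ici t) t) (hθ : IsFlowPath g w m θ)
    (hθ' : IsFlowPath g w m θ') : θ = θ' := by
  funext t
  have h := hθ.norm_sub_le hg hw hθ' t
  rw [sub_self, norm_zero, mul_zero] at h
  exact sub_eq_zero.1 (norm_le_zero_iff.1 h)

lemma IsMonotoneDrift.isFlowPath_flow (hg : IsMonotoneDrift g L κ B)
    (hw : ∀ t, ContinuousWithinAt w (Ici t) t) (m : E) : IsFlowPath g w m (flow g w m) :=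
  Classical.epsilon_spec (hg.exists_isFlowPath hw m)

/-- Comparing the drift at `θ` with the drift at `0` gives `(‖θ‖²)' ≤ -2 κ ‖θ‖² + 2 B ‖θ‖ ≤ -κ ‖θ‖²
+ B² / κ`, and the level `(B / κ)²` is the equilibrium of the last bound. -/
lemma IsFlowPath.norm_le (hg : IsMonotoneDrift g L κ B)
    (hw : ∀ t, ContinuousWithinAt w (Ici t) t) (hθ : IsFlowPath g w m θ) (hm : ‖m‖ ≤ B / κ)
    (t : ℝ≥0) : ‖θ t‖ ≤ B / κ := by
  have hκ := hg.pos
  have hB : 0 ≤ B := (norm_nonneg _).trans (hg.bound (w 0))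
  have h := le_gronwallBound_of_liminf_deriv_right_le (a := 0) (b := t) (K := -κ) (ε := B ^ 2 / κ)
    (f := fun s : ℝ => ‖θ s.toNNReal‖ ^ 2) (δ := (B / κ) ^ 2)
    (f' := fun s : ℝ => 2 * inner ℝ (θ s.toNNReal) (-g (θ s.toNNReal) (w s.toNNReal)))
    (hθ.continuous_comp_toNNReal.norm.pow 2).continuousOn
    (fun s hs r hr => HasDerivWithinAt.liminf_right_slope_le
      (hθ.hasDerivWithinAt hg hw hs.1).norm_sq hr)
    (by simp only [Real.toNNReal_zero, hθ.zero]; gcongr)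
    (fun s _ => by
      set x := θ s.toNNReal
      set y := w s.toNNReal
      have h1 := hg.mono y x 0
      have h2 := (abs_le.1 (abs_real_inner_le_norm x (g 0 y))).1
      have h3 : ‖x‖ * ‖g 0 y‖ ≤ ‖x‖ * B := by gcongr; exact hg.bound y
      rw [sub_zero, inner_sub_right] at h1
      rw [inner_neg_right]
      have h4 : 0 ≤ κ * (‖x‖ - B / κ) ^ 2 := by positivity
      have h5 : κ * (‖x‖ - B / κ) ^ 2 = κ * ‖x‖ ^ 2 - 2 * (‖x‖ * B) + B ^ 2 / κ := by
        field_simp; ring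
      linarith) t ⟨t.coe_nonneg, le_rfl⟩
  rw [gronwallBound_of_K_ne_0 (neg_ne_zero.2 hκ.ne'), sub_zero] at h
  simp only [Real.toNNReal_coe] at h
  refine le_of_sq_le_sq (h.trans_eq ?_) (by positivity)
  field_simp
  ring

/-- Let `M` be the integral of the drift frozen at `m` and `z = θ - m + M`. Then `z' = -(g θ - g
m)`, so `(‖z‖²)' ≤ -2 κ ‖θ - m‖² + 2 L ‖M‖ ‖θ - m‖`, and completing the square leaves `L² / (2 κ)
‖M‖²`. Only the frozen noise `M` survives, which is what averages out when `m` is a zero of the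
averaged drift. -/
lemma IsMonotoneDrift.norm_flow_sub_sq_le (hg : IsMonotoneDrift g L κ B)
    (hw : ∀ t, ContinuousWithinAt w (Ici t) t) (hθ : IsFlowPath g w m θ) (t : ℝ≥0) :
    ‖θ t - m‖ ^ 2 ≤ 2 * ‖∫ r in (0 : ℝ)..t, g m (w r.toNNReal)‖ ^ 2 +
      (L : ℝ) ^ 2 / κ * ∫ s in (0 : ℝ)..t, ‖∫ r in (0 : ℝ)..s, g m (w r.toNNReal)‖ ^ 2 := by
  have hκ := hg.pos
  set M : ℝ → E := fun s => ∫ r in (0 : ℝ)..s, g m (w r.toNNReal) with hM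
  have hMc : Continuous M := intervalIntegral.continuous_primitive
    (hg.intervalIntegrable (u := fun _ => m) hw continuous_const) 0
  have hMc2 : Continuous fun s => (L : ℝ) ^ 2 / (2 * κ) * ‖M s‖ ^ 2 := by fun_prop
  have h := image_le_of_deriv_right_le_deriv_boundary (a := 0) (b := t)
    (f := fun s : ℝ => ‖θ s.toNNReal - m + M s‖ ^ 2)
    (f' := fun s : ℝ => 2 * inner ℝ (θ s.toNNReal - m + M s)
      (-g (θ s.toNNReal) (w s.toNNReal) + g m (w s.toNNReal)))
    (B := fun s => ∫ r in (0 : ℝ)..s, (L : ℝ) ^ 2 / (2 * κ) * ‖M r‖ ^ 2)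
    (B' := fun s => (L : ℝ) ^ 2 / (2 * κ) * ‖M s‖ ^ 2)
    (((hθ.continuous_comp_toNNReal.sub continuous_const).add hMc).norm.pow 2).continuousOn
    (fun s hs => (((hθ.hasDerivWithinAt hg hw hs.1).sub_const m).add
      (hg.hasDerivWithinAt_integral (u := fun _ => m) hw continuous_const s)).norm_sq)
    (by simp [hθ.zero, hM])
    (intervalIntegral.continuous_primitive (fun a b => hMc2.intervalIntegrable a b) 0).continuousOn
    (fun s _ => (hMc2.integral_hasStrictDerivAt 0 s).hasDerivAt.hasDerivWithinAt)
    (fun s _ => by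
      set x := θ s.toNNReal
      set y := w s.toNNReal
      have h1 := hg.mono y x m
      have h2 := (abs_le.1 (abs_real_inner_le_norm (M s) (g x y - g m y))).1
      have h3 : ‖M s‖ * ‖g x y - g m y‖ ≤ ‖M s‖ * (L * ‖x - m‖) := by
        gcongr; exact hg.norm_apply_sub_le _ _ _
      have h4 : 0 ≤ 1 / (2 * κ) * (2 * κ * ‖x - m‖ - L * ‖M s‖) ^ 2 := by positivity
      have h5 : 1 / (2 * κ) * (2 * κ * ‖x - m‖ - L * ‖M s‖) ^ 2 = 2 * (κ * ‖x - m‖ ^ 2) -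
          2 * (‖M s‖ * (L * ‖x - m‖)) + (L : ℝ) ^ 2 / (2 * κ) * ‖M s‖ ^ 2 := by
        field_simp; ring
      rw [neg_add_eq_sub, ← neg_sub (g x y), inner_neg_right, inner_add_left]
      linarith) (x := t) ⟨t.coe_nonneg, le_rfl⟩
  simp only [Real.toNNReal_coe, intervalIntegral.integral_const_mul] at h
  have h6 : ‖θ t - m‖ ^ 2 ≤ 2 * ‖M t‖ ^ 2 + 2 * ‖θ t - m + M t‖ ^ 2 := by
    have h7 := norm_sub_le (θ t - m + M t) (M t)
    rw [add_sub_cancel_right] at h7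
    nlinarith [sq_nonneg (‖θ t - m + M t‖ - ‖M t‖), norm_nonneg (θ t - m)]
  refine h6.trans ?_
  have h8 : (L : ℝ) ^ 2 / κ = 2 * ((L : ℝ) ^ 2 / (2 * κ)) := by field_simp
  rw [h8, mul_assoc 2]
  linarith

/-- The shifted flow solves the equation along the shifted index path, and solutions are unique. -/
lemma IsMonotoneDrift.flow_add (hg : IsMonotoneDrift g L κ B)
    (hw : ∀ t, ContinuousWithinAt w (Ici t) t) (m : E) (t s : ℝ≥0) :
    flow g w m (t + s) = flow g (fun r => w (t + r)) (flow g w m t) s := by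
  have hθ := hg.isFlowPath_flow hw m
  have hw' : ∀ s, ContinuousWithinAt (fun r => w (t + r)) (Ici s) s := fun s =>
    (hw (t + s)).comp (continuous_const.add continuous_id).continuousWithinAt
      fun r (hr : s ≤ r) => add_le_add_right hr t
  have hi := hg.intervalIntegrable hw hθ.continuous_comp_toNNReal
  have h1 : IsFlowPath g (fun r => w (t + r)) (flow g w m t) fun r => flow g w m (t + r) := by
    refine ⟨hθ.1.comp (by fun_prop), fun s => ?_⟩
    have h2 : ∫ r in (0 : ℝ)..s, g (flow g w m (t + r.toNNReal)) (w (t + r.toNNReal)) =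
        ∫ r in (t : ℝ)..(t + s : ℝ≥0), g (flow g w m r.toNNReal) (w r.toNNReal) := by
      have h3 := intervalIntegral.integral_comp_add_right (a := 0) (b := s)
        (fun r : ℝ => g (flow g w m r.toNNReal) (w r.toNNReal)) t
      rw [zero_add] at h3
      rw [NNReal.coe_add, add_comm (t : ℝ), ← h3]
      refine intervalIntegral.integral_congr fun r hr => ?_
      rw [uIcc_of_le s.coe_nonneg] at hr
      simp only [Real.toNNReal_add hr.1 t.coe_nonneg, Real.toNNReal_coe, add_comm t]
    beta_reduce
    rw [h2, hθ.2 (t + s), hθ.2 t, sub_sub, intervalIntegral.integral_add_adjacent_intervals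
      (hi _ _) (hi _ _)]
  exact congrFun (h1.unique hg hw' (hg.isFlowPath_flow hw' _)) s

/-! ### Pathwise convergence of the Euler scheme. -/

lemma le_pow_mul_sum_of_le_mul_add {a b : ℕ → ℝ} {q : ℝ} (hq : 1 ≤ q) (hb : ∀ k, 0 ≤ b k)
    (h0 : a 0 = 0) (h : ∀ k, a (k + 1) ≤ q * a k + b k) (k : ℕ) :
    a k ≤ q ^ k * ∑ i ∈ Finset.range k, b i := by
  induction k with
  | zero => simp [h0]
  | succ k ih =>
    rw [Finset.sum_range_succ, mul_add]
    have h1 : q * a k ≤ q * (q ^ k * ∑ i ∈ Finset.range k, b i) := by gcongr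
    have h2 : b k ≤ q ^ (k + 1) * b k := le_mul_of_one_le_left (hb k) (one_le_pow₀ hq)
    calc _ ≤ _ := h k
      _ ≤ _ := add_le_add h1 h2
      _ = _ := by ring

/-- The local error of the Euler scheme along a solution. -/
noncomputable def eulerDefect (g : E → S → E) (δ : ℝ≥0) (w : ℝ≥0 → S) (θ : ℝ≥0 → E) (s : ℝ) : ℝ :=
  ‖g (θ (⌊s.toNNReal / δ⌋₊ * δ)) (w (nextGrid δ s.toNNReal)) - g (θ s.toNNReal) (w s.toNNReal)‖

lemma eulerDefect_nonneg {δ : ℝ≥0} {s : ℝ} : 0 ≤ eulerDefect g δ w θ s := norm_nonneg _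

lemma IsMonotoneDrift.eulerDefect_le (hg : IsMonotoneDrift g L κ B) {δ t : ℝ≥0} {D : ℝ}
    (hD : ∀ s ≤ t, ‖θ s‖ ≤ D) {s : ℝ} (hs : s ≤ t) :
    eulerDefect g δ w θ s ≤ 2 * (B + L * D) := by
  have h1 : s.toNNReal ≤ t := Real.toNNReal_le_iff_le_coe.2 hs
  have h2 : ⌊s.toNNReal / δ⌋₊ * δ ≤ t := by
    rcases eq_or_ne δ 0 with rfl | hδ
    · simp
    · refine le_trans ?_ h1
      rw [← le_div_iff₀ (pos_iff_ne_zero.2 hδ)]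
      exact Nat.floor_le (zero_le)
  refine (_root_.norm_sub_le _ _).trans ?_
  have h3 := hg.norm_le (θ (⌊s.toNNReal / δ⌋₊ * δ)) (w (nextGrid δ s.toNNReal))
  have h4 := hg.norm_le (θ s.toNNReal) (w s.toNNReal)
  have h5 := mul_le_mul_of_nonneg_left (hD _ h2) L.coe_nonneg
  have h6 := mul_le_mul_of_nonneg_left (hD _ h1) L.coe_nonneg
  linarith

lemma IsMonotoneDrift.measurable_eulerDefect (hg : IsMonotoneDrift g L κ B)
    (hw : ∀ t, ContinuousWithinAt w (Ici t) t) (hθ : Continuous θ) (δ : ℝ≥0) :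
    Measurable (eulerDefect g δ w θ) := by
  have hwm := measurable_of_rightContinuous hw
  have h1 : Measurable fun s : ℝ => ⌊s.toNNReal / δ⌋₊ :=
    Nat.measurable_floor.comp (measurable_real_toNNReal.div_const _)
  have h2 : Measurable fun s : ℝ => θ (⌊s.toNNReal / δ⌋₊ * δ) :=
    (measurable_from_nat (f := fun k : ℕ => θ (k * δ))).comp h1
  have h3 : Measurable fun s : ℝ => w (nextGrid δ s.toNNReal) :=
    (measurable_from_nat (f := fun k : ℕ => w ((k + 1 : ℕ) * δ))).comp h1
  exact ((hg.measurable.comp (h2.prodMk h3)).sub (hg.measurable.comp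
    ((hθ.measurable.comp measurable_real_toNNReal).prodMk
      (hwm.comp measurable_real_toNNReal)))).norm

lemma IsMonotoneDrift.intervalIntegrable_eulerDefect (hg : IsMonotoneDrift g L κ B)
    (hw : ∀ t, ContinuousWithinAt w (Ici t) t) (hθ : Continuous θ) (δ : ℝ≥0) {a b : ℝ}
    (hab : a ≤ b) : IntervalIntegrable (eulerDefect g δ w θ) volume a b := by
  obtain ⟨D, hD⟩ := (isCompact_Icc (a := 0) (b := b.toNNReal)).exists_bound_of_continuousOn
    hθ.continuousOn
  rw [intervalIntegrable_iff_integrableOn_Ioc_of_le hab]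
  refine Measure.integrableOn_of_bounded (M := 2 * (B + L * D)) (by simp)
    (hg.measurable_eulerDefect hw hθ δ).aestronglyMeasurable ?_
  refine (ae_restrict_iff' measurableSet_Ioc).2 (ae_of_all _ fun s hs => ?_)
  rw [Real.norm_of_nonneg eulerDefect_nonneg]
  exact hg.eulerDefect_le (t := b.toNNReal) (fun s hs => hD s ⟨zero_le, hs⟩)
    (hs.2.trans (Real.le_coe_toNNReal b))

lemma IsMonotoneDrift.norm_euler_succ_sub_le (hg : IsMonotoneDrift g L κ B)
    (hw : ∀ t, ContinuousWithinAt w (Ici t) t) (hθ : IsFlowPath g w m θ) {δ : ℝ≥0} (hδ : 0 < δ)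
    (k : ℕ) : ‖euler g δ w m (k + 1) - θ ((k + 1 : ℕ) * δ)‖ ≤
      (1 + δ * L) * ‖euler g δ w m k - θ (k * δ)‖ +
        ∫ s in (k * δ : ℝ)..((k + 1 : ℕ) * δ : ℝ), eulerDefect g δ w θ s := by
  have hi := hg.intervalIntegrable hw hθ.continuous_comp_toNNReal
  set a : ℝ := k * δ with ha
  set b : ℝ := (k + 1 : ℕ) * δ with hb
  have hab : b - a = δ := by rw [ha, hb]; push_cast; ring
  have hab' : a ≤ b := by have := δ.coe_nonneg; linarith
  have hka : ((k * δ : ℝ≥0) : ℝ) = a := by simp [ha]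
  have hkb : (((k + 1 : ℕ) * δ : ℝ≥0) : ℝ) = b := by simp [hb]
  set e := euler g δ w m k with he
  set x := θ (k * δ) with hx
  set y := w ((k + 1 : ℕ) * δ) with hy
  have h1 : θ ((k + 1 : ℕ) * δ) = x - ∫ s in a..b, g (θ s.toNNReal) (w s.toNNReal) := by
    rw [hx, hθ.2, hθ.2 (k * δ), hka, hkb, sub_sub,
      intervalIntegral.integral_add_adjacent_intervals (hi _ _) (hi _ _)]
  have h2 : ‖(∫ s in a..b, (g x y - g (θ s.toNNReal) (w s.toNNReal)))‖ ≤
      ∫ s in a..b, eulerDefect g δ w θ s := by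
    refine intervalIntegral.norm_integral_le_of_norm_le hab' ?_
      (hg.intervalIntegrable_eulerDefect hw hθ.1 δ hab')
    -- At `s = b` the floor jumps to `k + 1`; elsewhere on the step it equals `k` and the integrand
    -- is exactly the defect.
    have h3 : ∀ᵐ s : ℝ, s ≠ b := by simp [ae_iff, measure_singleton]
    filter_upwards [h3] with s hs1 hs2
    have h4 : ⌊s.toNNReal / δ⌋₊ = k := by
      rw [Nat.floor_eq_iff zero_le, le_div_iff₀ hδ, div_lt_iff₀ hδ]
      constructor
      · rw [← NNReal.coe_le_coe, hka]; exact hs2.1.le.trans (Real.le_coe_toNNReal s)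
      · rw [← NNReal.coe_lt_coe, Real.coe_toNNReal s (by
          refine le_trans ?_ hs2.1.le; rw [ha]; positivity)]
        have := lt_of_le_of_ne hs2.2 hs1
        rw [hb] at this
        exact_mod_cast this
    rw [eulerDefect, nextGrid, h4]
  rw [intervalIntegral.integral_sub intervalIntegrable_const (hi _ _),
    intervalIntegral.integral_const, hab] at h2
  have h5 : euler g δ w m (k + 1) - θ ((k + 1 : ℕ) * δ) = ((e - x) - (δ : ℝ) • (g e y - g x y))
      - ((δ : ℝ) • g x y - ∫ s in a..b, g (θ s.toNNReal) (w s.toNNReal)) := by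
    rw [h1, euler, smul_sub]; abel
  rw [h5]
  refine (_root_.norm_sub_le _ _).trans (add_le_add ((_root_.norm_sub_le _ _).trans ?_) h2)
  rw [norm_smul, Real.norm_of_nonneg δ.coe_nonneg]
  have := mul_le_mul_of_nonneg_left (hg.norm_apply_sub_le e x y) δ.coe_nonneg
  linarith

lemma IsMonotoneDrift.norm_euler_sub_le (hg : IsMonotoneDrift g L κ B)
    (hw : ∀ t, ContinuousWithinAt w (Ici t) t) (hθ : IsFlowPath g w m θ) {δ : ℝ≥0} (hδ : 0 < δ)
    (k : ℕ) : ‖euler g δ w m k - θ (k * δ)‖ ≤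
      Real.exp (k * δ * L) * ∫ s in (0 : ℝ)..(k * δ : ℝ), eulerDefect g δ w θ s := by
  have hmono : ∀ k : ℕ, (k * δ : ℝ) ≤ (k + 1 : ℕ) * δ := fun k => by gcongr; simp
  have h := le_pow_mul_sum_of_le_mul_add (a := fun k => ‖euler g δ w m k - θ (k * δ)‖)
    (q := 1 + δ * L)
    (b := fun k => ∫ s in (k * δ : ℝ)..((k + 1 : ℕ) * δ : ℝ), eulerDefect g δ w θ s)
    (by have : 0 ≤ (δ : ℝ) * L := by positivity
        linarith)
    (fun k => intervalIntegral.integral_nonneg (hmono k) fun s _ => eulerDefect_nonneg)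
    (by simp [euler, hθ.zero]) (hg.norm_euler_succ_sub_le hw hθ hδ) k
  have h1 := intervalIntegral.sum_integral_adjacent_intervals (μ := volume)
    (f := eulerDefect g δ w θ) (a := fun k : ℕ => (k * δ : ℝ)) (n := k)
    (fun k _ => hg.intervalIntegrable_eulerDefect hw hθ.1 δ (hmono k))
  rw [h1, Nat.cast_zero, zero_mul] at h
  refine h.trans ?_
  gcongr
  · exact intervalIntegral.integral_nonneg (by positivity) fun s _ => eulerDefect_nonneg
  · rw [mul_assoc, Real.exp_nat_mul]
    gcongr
    rw [add_comm]
    exact Real.add_one_le_exp _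

/-- The index is read at a grid point to the right of `s`, where right continuity suffices; the
position is read to the left, which is harmless because `θ` is continuous. -/
lemma IsMonotoneDrift.tendsto_eulerDefect (hg : IsMonotoneDrift g L κ B)
    (hw : ∀ t, ContinuousWithinAt w (Ici t) t) (hθ : Continuous θ) {δ : ℕ → ℝ≥0}
    (hδ : ∀ n, 0 < δ n) (h0 : Tendsto δ atTop (𝓝 0)) (s : ℝ) :
    Tendsto (fun n => eulerDefect g (δ n) w θ s) atTop (𝓝 0) := by
  have h1 := tendsto_nextGrid hδ h0 s.toNNReal
  have h2 : Tendsto (fun n => ((⌊s.toNNReal / δ n⌋₊ : ℝ≥0) * δ n)) atTop (𝓝 s.toNNReal) := by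
    have h3 : ∀ n, (⌊s.toNNReal / δ n⌋₊ : ℝ≥0) * δ n = nextGrid (δ n) s.toNNReal - δ n := fun n => by
      rw [nextGrid, Nat.cast_add, Nat.cast_one, add_mul, one_mul, add_tsub_cancel_right]
    simp only [h3]
    simpa using (tendsto_nhds_of_tendsto_nhdsWithin h1).sub h0
  have h4 := (hg.cont.tendsto (θ s.toNNReal, w s.toNNReal)).comp
    (((hθ.tendsto _).comp h2).prodMk_nhds ((hw s.toNNReal).tendsto.comp h1))
  simpa [eulerDefect] using (h4.sub_const (g (θ s.toNNReal) (w s.toNNReal))).norm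

lemma IsMonotoneDrift.tendsto_euler (hg : IsMonotoneDrift g L κ B)
    (hw : ∀ t, ContinuousWithinAt w (Ici t) t) (hθ : IsFlowPath g w m θ) (t : ℝ≥0) :
    Tendsto (fun n : ℕ => euler g (t / (n + 1 : ℕ)) w m (n + 1)) atTop (𝓝 (θ t)) := by
  rcases eq_or_ne t 0 with rfl | ht
  · have h : ∀ k, euler g 0 w m k = m := fun k => by
      induction k with
      | zero => rfl
      | succ k ih => simp [euler, ih]
    simp [h, hθ.zero]
  set δ : ℕ → ℝ≥0 := fun n => t / (n + 1 : ℕ) with hδ_def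
  have hδ : ∀ n, 0 < δ n := fun n => div_pos (pos_iff_ne_zero.2 ht) (by positivity)
  have h0 : Tendsto δ atTop (𝓝 0) := by
    have := (tendsto_one_div_add_atTop_nhds_zero_nat (𝕜 := ℝ≥0)).const_mul t
    simpa [hδ_def, div_eq_mul_inv] using this
  have hk : ∀ n, (n + 1 : ℕ) * δ n = t := fun n => mul_div_cancel₀ _ (by positivity)
  have hk' : ∀ n, (n + 1 : ℕ) * (δ n : ℝ) = t := fun n => by
    exact_mod_cast congrArg NNReal.toReal (hk n)
  obtain ⟨D, hD⟩ := (isCompact_Icc (a := 0) (b := t)).exists_bound_of_continuousOn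
    hθ.1.continuousOn
  have h1 : Tendsto (fun n => ∫ s in (0 : ℝ)..t, eulerDefect g (δ n) w θ s) atTop (𝓝 0) := by
    have := intervalIntegral.tendsto_integral_filter_of_dominated_convergence (a := 0) (b := t)
      (μ := volume) (l := atTop) (f := fun _ => (0 : ℝ)) (F := fun n => eulerDefect g (δ n) w θ)
      (fun _ => 2 * (B + L * D))
      (Eventually.of_forall fun n => (hg.measurable_eulerDefect hw hθ.1 _).aestronglyMeasurable)
      (Eventually.of_forall fun n => ae_of_all _ fun s hs => by
        rw [uIoc_of_le t.coe_nonneg] at hs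
        rw [Real.norm_of_nonneg eulerDefect_nonneg]
        exact hg.eulerDefect_le (fun s hs => hD s ⟨zero_le, hs⟩) hs.2)
      intervalIntegrable_const
      (ae_of_all _ fun s _ => hg.tendsto_eulerDefect hw hθ.1 hδ h0 s)
    simpa using this
  refine tendsto_iff_norm_sub_tendsto_zero.2 (squeeze_zero (fun _ => norm_nonneg _) (fun n => ?_)
    (by simpa using h1.const_mul (Real.exp (t * L))))
  have h2 := hg.norm_euler_sub_le hw hθ (hδ n) (n + 1)
  rwa [hk, hk'] at h2

end Flow

/-! ### Integrals of bounded functions against kernels. -/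

section KernelIntegral

variable {X Y : Type*} [MeasurableSpace X] [MeasurableSpace Y]

lemma integrable_of_measurable_of_bound {μ : Measure X} [IsFiniteMeasure μ] {h : X → ℝ}
    (hm : Measurable h) {C : ℝ} (hC : ∀ x, |h x| ≤ C) : Integrable h μ :=
  Integrable.of_bound hm.aestronglyMeasurable C (ae_of_all _ fun x => hC x)

lemma abs_integral_le_of_bound {μ : Measure X} [IsProbabilityMeasure μ] {h : X → ℝ} {C : ℝ}
    (hC : ∀ x, |h x| ≤ C) : |∫ x, h x ∂μ| ≤ C := by
  have h1 : ‖∫ x, h x ∂μ‖ ≤ C * μ.real univ := norm_integral_le_of_norm_le_const (ae_of_all _ hC)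
  simpa using h1

lemma integral_comp_measure {μ : Measure X} [IsProbabilityMeasure μ] {η : Kernel X Y}
    [IsMarkovKernel η] {h : Y → ℝ} (hm : Measurable h) {C : ℝ} (hC : ∀ y, |h y| ≤ C) :
    ∫ y, h y ∂(η ∘ₘ μ) = ∫ x, ∫ y, h y ∂(η x) ∂μ := by
  rw [Measure.comp_eq_comp_const_apply, Kernel.integral_comp, Kernel.const_apply]
  rw [← Measure.comp_eq_comp_const_apply]
  exact integrable_of_measurable_of_bound hm hC

lemma measurable_integral_kernel {η : Kernel X Y} [IsMarkovKernel η] {h : Y → ℝ}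
    (hm : Measurable h) : Measurable fun x => ∫ y, h y ∂(η x) :=
  (hm.stronglyMeasurable.integral_kernel (κ := η)).measurable

end KernelIntegral

/-! ### The Markov property of the coupled process. -/

/-- A right continuous, time-homogeneous Markov process with the Feller property. -/
structure IsMarkovFamily {S Ω : Type*} [TopologicalSpace S] [MeasurableSpace S]
    {mΩ : MeasurableSpace Ω} (ℱ : Filtration ℝ≥0 mΩ) (P : Kernel S Ω) (U : ℝ≥0 → Ω → S) :
    Prop where
  adapted : Adapted ℱ U
  rightCont : ∀ ω t, ContinuousWithinAt (fun s => U s ω) (Ici t) t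
  start : ∀ x, ∀ᵐ ω ∂(P x), U 0 ω = x
  markov : ∀ (x : S) (s t : ℝ≥0) (h : C(S, ℝ)),
    (P x)[fun ω => h (U (t + s) ω) | ℱ t] =ᵐ[P x] fun ω => ∫ ω', h (U s ω') ∂(P (U t ω))
  feller : ∀ (t : ℝ≥0) (h : C(S, ℝ)), Continuous fun x => ∫ ω, h (U t ω) ∂(P x)

/-- The filtration run at speed `1 / ε`. -/
noncomputable def timeChange {Ω : Type*} {mΩ : MeasurableSpace Ω} (ℱ : Filtration ℝ≥0 mΩ) (ε : ℝ≥0) :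
    Filtration ℝ≥0 mΩ where
  seq t := ℱ (t / ε)
  mono' _ _ h := ℱ.mono (by gcongr)
  le' _ := ℱ.le _

lemma IsFellerProcess.isMarkovFamily_timeChange {S Ω : Type*} [TopologicalSpace S]
    [MeasurableSpace S] {mΩ : MeasurableSpace Ω} {ℱ : Filtration ℝ≥0 mΩ} {P : Kernel S Ω}
    {V : ℝ≥0 → Ω → S} (hV : IsFellerProcess ℱ P V) (ε : ℝ≥0) :
    IsMarkovFamily (timeChange ℱ ε) P fun t => V (t / ε) where
  adapted t := hV.adapted (t / ε)
  rightCont ω t := ((hV.cadlag ω (t / ε)).1).comp (f := fun s => s / ε)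
    (by fun_prop : Continuous fun s : ℝ≥0 => s / ε).continuousWithinAt
    fun s (hs : t ≤ s) => by simp only [mem_Ici]; gcongr
  start x := by simpa using hV.start x
  markov x s t h := by
    simp only [add_div]
    exact hV.markov x (s / ε) (t / ε) h
  feller t h := hV.feller (t / ε) h

section Markov

variable {E S Ω : Type*} [NormedAddCommGroup E] [InnerProductSpace ℝ E] [CompleteSpace E]
  [SecondCountableTopology E] [MeasurableSpace E] [BorelSpace E]
  [TopologicalSpace S] [PolishSpace S] [CompactSpace S] [MeasurableSpace S] [BorelSpace S]
  {mΩ : MeasurableSpace Ω} {ℱ : Filtration ℝ≥0 mΩ} {P : Kernel S Ω} [IsMarkovKernel P]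
  {U : ℝ≥0 → Ω → S} {g : E → S → E} {L : ℝ≥0} {κ B : ℝ}

lemma IsMarkovFamily.measurable (hU : IsMarkovFamily ℱ P U) (t : ℝ≥0) : Measurable (U t) :=
  (hU.adapted t).mono (ℱ.le t) le_rfl

lemma IsMarkovFamily.measurable_uncurry (hU : IsMarkovFamily ℱ P U) :
    Measurable (Function.uncurry U) :=
  measurable_uncurry_of_rightContinuous hU.measurable hU.rightCont

/-- The kernel sending `(m, y)` to the law of `F ((m, y), ·)` under `P y`. -/
noncomputable def pathKernel {E S Ω Y : Type*} [MeasurableSpace E] [MeasurableSpace S]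
    [MeasurableSpace Ω] [MeasurableSpace Y] (P : Kernel S Ω) (F : (E × S) × Ω → Y) :
    Kernel (E × S) Y :=
  (Kernel.id ×ₖ P.comap Prod.snd measurable_snd).map F

lemma pathKernel_apply {Y : Type*} [MeasurableSpace Y] {F : (E × S) × Ω → Y} (hF : Measurable F)
    (p : E × S) : pathKernel P F p = (P p.2).map fun ω => F (p, ω) := by
  rw [pathKernel, Kernel.map_apply _ hF, Kernel.prod_apply, Kernel.id_apply, Measure.dirac_prod,
    Kernel.comap_apply, Measure.map_map hF measurable_prodMk_left]
  rfl

lemma isMarkovKernel_pathKernel {Y : Type*} [MeasurableSpace Y] {F : (E × S) × Ω → Y}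
    (hF : Measurable F) : IsMarkovKernel (pathKernel P F) :=
  Kernel.IsMarkovKernel.map _ hF

/-- The kernel that keeps the first coordinate and runs the process for time `t`. -/
noncomputable def stepKernel (E : Type*) {S Ω : Type*} [MeasurableSpace E] [MeasurableSpace S]
    [MeasurableSpace Ω] (P : Kernel S Ω) (U : ℝ≥0 → Ω → S) (t : ℝ≥0) : Kernel (E × S) (E × S) :=
  pathKernel P fun q => (q.1.1, U t q.2)

lemma IsMarkovFamily.measurable_step (hU : IsMarkovFamily ℱ P U) (t : ℝ≥0) :
    Measurable fun q : (E × S) × Ω => (q.1.1, U t q.2) :=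
  measurable_fst.fst.prodMk ((hU.measurable t).comp measurable_snd)

/-- Finite measures on the product are determined by test functions `φ(ξ) ψ(U)`. For these, the `ℱ
t`-measurable factor is pulled out of the conditional expectation and the Markov hypothesis applies
to `ψ`. -/
lemma IsMarkovFamily.map_add (hU : IsMarkovFamily ℱ P U) (x : S) (s t : ℝ≥0) {ξ : Ω → E}
    (hξ : Measurable[ℱ t] ξ) :
    (P x).map (fun ω => (ξ ω, U (t + s) ω)) =
      stepKernel E P U s ∘ₘ (P x).map fun ω => (ξ ω, U t ω) := by
  have hξ' : Measurable ξ := hξ.mono (ℱ.le t) le_rfl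
  have h1 : Measurable fun ω => (ξ ω, U (t + s) ω) := hξ'.prodMk (hU.measurable _)
  have h2 : Measurable fun ω => (ξ ω, U t ω) := hξ'.prodMk (hU.measurable _)
  have := isMarkovKernel_pathKernel (P := P) (hU.measurable_step (E := E) s)
  have : IsMarkovKernel (stepKernel E P U s) := this
  have := Measure.isProbabilityMeasure_map (μ := P x) h1.aemeasurable
  have := Measure.isProbabilityMeasure_map (μ := P x) h2.aemeasurable
  refine Measure.ext_of_integral_mul_boundedContinuousFunction fun φ ψ => ?_
  have hm : Measurable fun p : E × S => φ p.1 * ψ p.2 :=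
    (φ.continuous.measurable.comp measurable_fst).mul (ψ.continuous.measurable.comp measurable_snd)
  have hb : ∀ p : E × S, |φ p.1 * ψ p.2| ≤ ‖φ‖ * ‖ψ‖ := fun p => by
    rw [abs_mul]
    exact mul_le_mul (φ.norm_coe_le_norm _) (ψ.norm_coe_le_norm _) (abs_nonneg _) (norm_nonneg _)
  rw [integral_comp_measure hm hb, integral_map h1.aemeasurable hm.aestronglyMeasurable,
    integral_map h2.aemeasurable (measurable_integral_kernel hm).aestronglyMeasurable]
  have h3 : ∀ ω, ∫ p, φ p.1 * ψ p.2 ∂(stepKernel E P U s (ξ ω, U t ω)) =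
      φ (ξ ω) * ∫ ω', ψ (U s ω') ∂(P (U t ω)) := fun ω => by
    rw [stepKernel, pathKernel_apply (hU.measurable_step s), integral_map _ hm.aestronglyMeasurable]
    · exact integral_const_mul (φ (ξ ω)) fun ω' => ψ (U s ω')
    · exact ((hU.measurable_step s).comp measurable_prodMk_left).aemeasurable
  simp only [h3]
  have h4 : StronglyMeasurable[ℱ t] fun ω => φ (ξ ω) :=
    (φ.continuous.measurable.comp hξ).stronglyMeasurable
  have h5 : Integrable (fun ω => ψ (U (t + s) ω)) (P x) :=
    integrable_of_measurable_of_bound (ψ.continuous.measurable.comp (hU.measurable _))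
      fun ω => ψ.norm_coe_le_norm _
  have h6 := condExp_stronglyMeasurable_mul_of_bound (ℱ.le t) h4 h5 ‖φ‖
    (ae_of_all _ fun ω => φ.norm_coe_le_norm _)
  have h7 := hU.markov x s t ψ.toContinuousMap
  rw [← integral_condExp (ℱ.le t)]
  refine integral_congr_ae ?_
  filter_upwards [h6, h7] with ω h6 h7
  exact h6.trans (congrArg (φ (ξ ω) * ·) h7)

/-- One step of the Euler scheme, once the new position of the index process is known. -/
noncomputable def eulerStep {E S : Type*} [NormedAddCommGroup E] [NormedSpace ℝ E]
    (g : E → S → E) (δ : ℝ≥0) (p : E × S) : E × S :=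
  (p.1 - (δ : ℝ) • g p.1 p.2, p.2)

lemma IsMonotoneDrift.continuous_eulerStep (hg : IsMonotoneDrift g L κ B) (δ : ℝ≥0) :
    Continuous (eulerStep g δ) :=
  (continuous_fst.sub (hg.cont.const_smul (δ : ℝ))).prodMk continuous_snd

/-- The transition kernel of the pair (Euler scheme of step `δ`, index process) over `k` steps. -/
noncomputable def eulerKernel {E S Ω : Type*} [NormedAddCommGroup E] [NormedSpace ℝ E]
    [MeasurableSpace E] [MeasurableSpace S] [MeasurableSpace Ω]
    (P : Kernel S Ω) (U : ℝ≥0 → Ω → S) (g : E → S → E) (δ : ℝ≥0) : ℕ → Kernel (E × S) (E × S)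
  | 0 => Kernel.id
  | k + 1 => (stepKernel E P U δ).map (eulerStep g δ) ∘ₖ eulerKernel P U g δ k

lemma IsMarkovFamily.isMarkovKernel_stepKernel (hU : IsMarkovFamily ℱ P U) (t : ℝ≥0) :
    IsMarkovKernel (stepKernel E P U t) :=
  isMarkovKernel_pathKernel (hU.measurable_step t)

lemma IsMarkovFamily.isMarkovKernel_eulerKernel (hU : IsMarkovFamily ℱ P U)
    (hg : IsMonotoneDrift g L κ B) (δ : ℝ≥0) (k : ℕ) : IsMarkovKernel (eulerKernel P U g δ k) := by
  induction k with
  | zero => rw [eulerKernel]; infer_instance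
  | succ k ih =>
    have := hU.isMarkovKernel_stepKernel (E := E) δ
    have := Kernel.IsMarkovKernel.map (stepKernel E P U δ) (hg.continuous_eulerStep δ).measurable
    rw [eulerKernel]
    infer_instance

/-- The σ-algebra on `X` is left free and only grid times up to `k` enter; taking a member of the
filtration for it yields adaptedness. The same holds for `measurable_flow`. -/
lemma IsMonotoneDrift.measurable_euler (hg : IsMonotoneDrift g L κ B) {X : Type*}
    {mX : MeasurableSpace X} {ξ : X → E} (hξ : Measurable ξ) {W : ℝ≥0 → X → S} (δ : ℝ≥0) (k : ℕ)
    (hW : ∀ j ≤ k, Measurable (W (j * δ))) :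
    Measurable fun x => euler g δ (fun r => W r x) (ξ x) k := by
  induction k with
  | zero => exact hξ
  | succ k ih =>
    have h := ih fun j hj => hW j (by omega)
    exact h.sub ((hg.measurable.comp (h.prodMk (hW (k + 1) le_rfl))).const_smul (δ : ℝ))

lemma IsMonotoneDrift.measurable_flow (hg : IsMonotoneDrift g L κ B) {X : Type*}
    {mX : MeasurableSpace X} {ξ : X → E} (hξ : Measurable ξ) {W : ℝ≥0 → X → S} (t : ℝ≥0)
    (hW : ∀ r ≤ t, Measurable (W r))
    (hc : ∀ x t, ContinuousWithinAt (fun s => W s x) (Ici t) t) :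
    Measurable fun x => flow g (fun r => W r x) (ξ x) t := by
  refine measurable_of_tendsto_metrizable
    (f := fun (n : ℕ) x => euler g (t / (n + 1 : ℕ)) (fun r => W r x) (ξ x) (n + 1))
    (fun n => hg.measurable_euler hξ _ _ fun j hj => hW _ ?_)
    (tendsto_pi_nhds.2 fun x => hg.tendsto_euler (hc x) (hg.isFlowPath_flow (hc x) _) t)
  rw [mul_div_left_comm]
  refine mul_le_of_le_one_right zero_le ?_
  rw [div_le_one (by positivity)]
  exact_mod_cast hj

/-- Since the scheme reads the index at the right endpoint, a step is a Markov move of the index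
with the position frozen, followed by a deterministic update. The position before the move is
measurable with respect to the past, as `map_add` requires. -/
lemma IsMarkovFamily.map_euler (hU : IsMarkovFamily ℱ P U) (hg : IsMonotoneDrift g L κ B) (x : S)
    (t δ : ℝ≥0) {ξ : Ω → E} (hξ : Measurable[ℱ t] ξ) (k : ℕ) :
    (P x).map (fun ω => (euler g δ (fun r => U (t + r) ω) (ξ ω) k, U (t + k * δ) ω)) =
      eulerKernel P U g δ k ∘ₘ (P x).map fun ω => (ξ ω, U t ω) := by
  induction k with
  | zero => simp [eulerKernel, euler]
  | succ k ih =>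
    have h1 : Measurable[ℱ (t + k * δ)]
        fun ω => euler g δ (fun r => U (t + r) ω) (ξ ω) k :=
      hg.measurable_euler (hξ.mono (ℱ.mono le_self_add) le_rfl) (W := fun r => U (t + r)) δ k
        fun j hj => (hU.adapted _).mono (ℱ.mono (by gcongr)) le_rfl
    have h2 := hU.map_add x δ (t + k * δ) h1
    have h3 : t + k * δ + δ = t + (k + 1 : ℕ) * δ := by push_cast; ring
    rw [h3, ih] at h2
    have h4 : Measurable fun ω => (euler g δ (fun r => U (t + r) ω) (ξ ω) k,
        U (t + (k + 1 : ℕ) * δ) ω) := (h1.mono (ℱ.le _) le_rfl).prodMk (hU.measurable _)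
    have h5 := congrArg (Measure.map (eulerStep g δ)) h2
    rw [Measure.map_map (hg.continuous_eulerStep δ).measurable h4,
      Measure.map_comp _ _ (hg.continuous_eulerStep δ).measurable, Measure.comp_assoc] at h5
    exact h5

lemma IsMarkovFamily.map_const_zero (hU : IsMarkovFamily ℱ P U) (m : E) (y : S) :
    (P y).map (fun ω => (m, U 0 ω)) = Measure.dirac (m, y) := by
  have h : (fun ω => (m, U 0 ω)) =ᵐ[P y] fun _ => (m, y) := by
    filter_upwards [hU.start y] with ω hω
    rw [hω]
  rw [Measure.map_congr h, Measure.map_const, measure_univ, one_smul]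

lemma IsMarkovFamily.eulerKernel_apply (hU : IsMarkovFamily ℱ P U) (hg : IsMonotoneDrift g L κ B)
    (δ : ℝ≥0) (k : ℕ) (p : E × S) : eulerKernel P U g δ k p =
      (P p.2).map fun ω => (euler g δ (fun r => U r ω) p.1 k, U (k * δ) ω) := by
  have h := hU.map_euler hg p.2 0 δ (ξ := fun _ => p.1) measurable_const k
  rw [hU.map_const_zero, Measure.dirac_bind (Kernel.measurable _)] at h
  rw [← h]
  simp only [zero_add]

/-- The transition kernel of the coupled process `(θ_t, U_t)`. -/
noncomputable def coupledKernel {E S Ω : Type*} [NormedAddCommGroup E] [NormedSpace ℝ E]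
    [MeasurableSpace E] [MeasurableSpace S] [MeasurableSpace Ω]
    (P : Kernel S Ω) (U : ℝ≥0 → Ω → S) (g : E → S → E) (t : ℝ≥0) : Kernel (E × S) (E × S) :=
  pathKernel P fun q => (flow g (fun r => U r q.2) q.1.1 t, U t q.2)

lemma IsMarkovFamily.measurable_coupled (hU : IsMarkovFamily ℱ P U)
    (hg : IsMonotoneDrift g L κ B) (t : ℝ≥0) :
    Measurable fun q : (E × S) × Ω => (flow g (fun r => U r q.2) q.1.1 t, U t q.2) :=
  (hg.measurable_flow (W := fun r (q : (E × S) × Ω) => U r q.2) measurable_fst.fst t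
    (fun r _ => (hU.measurable r).comp measurable_snd) fun q => hU.rightCont q.2).prodMk
    ((hU.measurable t).comp measurable_snd)

lemma IsMarkovFamily.measurable_coupled_path (hU : IsMarkovFamily ℱ P U)
    (hg : IsMonotoneDrift g L κ B) (t : ℝ≥0) (m : E) :
    Measurable fun ω => (flow g (fun r => U r ω) m t, U t ω) :=
  (hg.measurable_flow measurable_const t (fun r _ => hU.measurable r) hU.rightCont).prodMk
    (hU.measurable t)

lemma IsMarkovFamily.isMarkovKernel_coupledKernel (hU : IsMarkovFamily ℱ P U)
    (hg : IsMonotoneDrift g L κ B) (t : ℝ≥0) : IsMarkovKernel (coupledKernel P U g t) :=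
  isMarkovKernel_pathKernel (hU.measurable_coupled hg t)

lemma IsMarkovFamily.coupledKernel_apply (hU : IsMarkovFamily ℱ P U)
    (hg : IsMonotoneDrift g L κ B) (t : ℝ≥0) (p : E × S) : coupledKernel P U g t p =
      (P p.2).map fun ω => (flow g (fun r => U r ω) p.1 t, U t ω) :=
  pathKernel_apply (hU.measurable_coupled hg t) p

lemma IsMarkovFamily.integral_coupledKernel (hU : IsMarkovFamily ℱ P U)
    (hg : IsMonotoneDrift g L κ B) (t : ℝ≥0) (p : E × S) {h : E × S → ℝ} (hm : Measurable h) :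
    ∫ q, h q ∂(coupledKernel P U g t p) =
      ∫ ω, h (flow g (fun r => U r ω) p.1 t, U t ω) ∂(P p.2) := by
  rw [hU.coupledKernel_apply hg, integral_map _ hm.aestronglyMeasurable]
  exact ((hU.measurable_coupled hg t).comp measurable_prodMk_left).aemeasurable

lemma IsMarkovFamily.tendsto_integral_euler (hU : IsMarkovFamily ℱ P U)
    (hg : IsMonotoneDrift g L κ B) (x : S) (t s : ℝ≥0) {ξ : Ω → E} (hξ : Measurable ξ)
    {h : E × S → ℝ} (hh : Continuous h) {C : ℝ} (hC : ∀ p, |h p| ≤ C) :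
    Tendsto (fun n : ℕ => ∫ ω, h (euler g (s / (n + 1 : ℕ)) (fun r => U (t + r) ω) (ξ ω) (n + 1),
      U (t + s) ω) ∂(P x)) atTop
      (𝓝 (∫ ω, h (flow g (fun r => U (t + r) ω) (ξ ω) s, U (t + s) ω) ∂(P x))) := by
  refine tendsto_integral_of_dominated_convergence (fun _ => C) (fun n => ?_)
    (integrable_const C) (fun n => ae_of_all _ fun ω => hC _) (ae_of_all _ fun ω => ?_)
  · exact (hh.measurable.comp ((hg.measurable_euler hξ (W := fun r => U (t + r)) _ _ fun j _ => hU.measurable _).prodMk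
      (hU.measurable _))).aestronglyMeasurable
  · have hc : ∀ r, ContinuousWithinAt (fun r => U (t + r) ω) (Ici r) r := fun r =>
      (hU.rightCont ω (t + r)).comp (continuous_const.add continuous_id).continuousWithinAt
        fun r' (hr : r ≤ r') => add_le_add_right hr t
    exact (hh.tendsto _).comp
      ((hg.tendsto_euler hc (hg.isFlowPath_flow hc _) s).prodMk_nhds tendsto_const_nhds)

lemma IsMarkovFamily.tendsto_integral_eulerKernel (hU : IsMarkovFamily ℱ P U)
    (hg : IsMonotoneDrift g L κ B) (s : ℝ≥0) (p : E × S) {h : E × S → ℝ} (hh : Continuous h)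
    {C : ℝ} (hC : ∀ p, |h p| ≤ C) :
    Tendsto (fun n : ℕ => ∫ q, h q ∂(eulerKernel P U g (s / (n + 1 : ℕ)) (n + 1) p)) atTop
      (𝓝 (∫ q, h q ∂(coupledKernel P U g s p))) := by
  have h1 := hU.tendsto_integral_euler hg p.2 0 s (ξ := fun _ => p.1) measurable_const hh hC
  simp only [zero_add] at h1
  rw [hU.integral_coupledKernel hg s p hh.measurable]
  refine h1.congr fun n => ?_
  have h2 : ((n + 1 : ℕ) : ℝ≥0) * (s / (n + 1 : ℕ)) = s := mul_div_cancel₀ _ (by positivity)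
  rw [hU.eulerKernel_apply hg, h2, integral_map _ hh.measurable.aestronglyMeasurable]
  exact ((hg.measurable_euler measurable_const _ _ fun j _ => hU.measurable _).prodMk
      (hU.measurable _)).aemeasurable

/-- Both sides, integrated against a bounded continuous function, are limits of the corresponding
Euler quantities, which agree by `map_euler`. -/
lemma IsMarkovFamily.map_flow (hU : IsMarkovFamily ℱ P U) (hg : IsMonotoneDrift g L κ B) (x : S)
    (t s : ℝ≥0) {ξ : Ω → E} (hξ : Measurable[ℱ t] ξ) :
    (P x).map (fun ω => (flow g (fun r => U (t + r) ω) (ξ ω) s, U (t + s) ω)) =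
      coupledKernel P U g s ∘ₘ (P x).map fun ω => (ξ ω, U t ω) := by
  have hξ' : Measurable ξ := hξ.mono (ℱ.le t) le_rfl
  have h2 : Measurable fun ω => (ξ ω, U t ω) := hξ'.prodMk (hU.measurable _)
  have hc : ∀ ω r, ContinuousWithinAt (fun r => U (t + r) ω) (Ici r) r := fun ω r =>
    (hU.rightCont ω (t + r)).comp (continuous_const.add continuous_id).continuousWithinAt
      fun r' (hr : r ≤ r') => add_le_add_right hr t
  have h1 : Measurable fun ω => (flow g (fun r => U (t + r) ω) (ξ ω) s, U (t + s) ω) :=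
    (hg.measurable_flow hξ' s (W := fun r => U (t + r)) (fun _ _ => hU.measurable _) hc).prodMk
      (hU.measurable _)
  have := hU.isMarkovKernel_coupledKernel hg s
  have := Measure.isProbabilityMeasure_map (μ := P x) h1.aemeasurable
  have := Measure.isProbabilityMeasure_map (μ := P x) h2.aemeasurable
  refine ext_of_forall_integral_eq_of_IsFiniteMeasure fun h => ?_
  have hm : Measurable h := h.continuous.measurable
  have hC : ∀ p, |h p| ≤ ‖h‖ := h.norm_coe_le_norm
  rw [integral_comp_measure hm hC, integral_map h1.aemeasurable hm.aestronglyMeasurable]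
  refine tendsto_nhds_unique (hU.tendsto_integral_euler hg x t s hξ' h.continuous hC) ?_
  have h3 : ∀ n : ℕ, ∫ ω, h (euler g (s / (n + 1 : ℕ)) (fun r => U (t + r) ω) (ξ ω) (n + 1),
      U (t + s) ω) ∂(P x) = ∫ p, ∫ q, h q ∂(eulerKernel P U g (s / (n + 1 : ℕ)) (n + 1) p)
        ∂((P x).map fun ω => (ξ ω, U t ω)) := fun n => by
    have h4 : ((n + 1 : ℕ) : ℝ≥0) * (s / (n + 1 : ℕ)) = s := mul_div_cancel₀ _ (by positivity)
    have h5 := hU.map_euler hg x t (s / (n + 1 : ℕ)) hξ (n + 1)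
    rw [h4] at h5
    have := hU.isMarkovKernel_eulerKernel hg (s / (n + 1 : ℕ)) (n + 1)
    rw [← integral_comp_measure hm hC, ← h5, integral_map _ hm.aestronglyMeasurable]
    exact ((hg.measurable_euler hξ' (W := fun r => U (t + r)) _ _ fun j _ => hU.measurable _).prodMk
      (hU.measurable _)).aemeasurable
  simp only [h3]
  refine tendsto_integral_of_dominated_convergence (fun _ => ‖h‖) (fun n => ?_)
    (integrable_const _) (fun n => ae_of_all _ fun p => ?_) (ae_of_all _ fun p => ?_)
  · have := hU.isMarkovKernel_eulerKernel hg (s / (n + 1 : ℕ)) (n + 1)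
    exact (measurable_integral_kernel hm).aestronglyMeasurable
  · have := hU.isMarkovKernel_eulerKernel hg (s / (n + 1 : ℕ)) (n + 1)
    exact abs_integral_le_of_bound hC
  · exact hU.tendsto_integral_eulerKernel hg s p h.continuous hC

/-- Chapman–Kolmogorov: the Markov property at time `t` with `ξ` the flow at time `t`, combined with
the pathwise flow property. -/
lemma IsMarkovFamily.coupledKernel_add (hU : IsMarkovFamily ℱ P U) (hg : IsMonotoneDrift g L κ B)
    (t s : ℝ≥0) :
    coupledKernel P U g (t + s) = coupledKernel P U g s ∘ₖ coupledKernel P U g t := by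
  ext1 p
  have h1 : Measurable[ℱ t] fun ω => flow g (fun r => U r ω) p.1 t :=
    hg.measurable_flow measurable_const t (fun r hr => (hU.adapted r).mono (ℱ.mono hr) le_rfl) hU.rightCont
  have h2 := hU.map_flow hg p.2 t s h1
  rw [Kernel.comp_apply, hU.coupledKernel_apply hg t, ← h2, hU.coupledKernel_apply hg]
  congr 1
  funext ω
  rw [hg.flow_add (hU.rightCont ω)]

end Markov

/-! ### Stationary laws of the coupled process: uniqueness and existence. -/

/-- A bounded measurable function on `E × S` that is Lipschitz in the first variable, uniformly in
the second. -/
structure IsFiberLipschitz {E S : Type*} [NormedAddCommGroup E] [MeasurableSpace E]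
    [MeasurableSpace S] (C Λ : ℝ) (h : E × S → ℝ) : Prop where
  measurable : Measurable h
  bound : ∀ p, |h p| ≤ C
  lip : ∀ m m' y, |h (m, y) - h (m', y)| ≤ Λ * ‖m - m'‖

section Stationary

variable {E S Ω : Type*} [NormedAddCommGroup E] [InnerProductSpace ℝ E] [CompleteSpace E]
  [SecondCountableTopology E] [MeasurableSpace E] [BorelSpace E]
  [TopologicalSpace S] [PolishSpace S] [CompactSpace S] [MeasurableSpace S] [BorelSpace S]
  {mΩ : MeasurableSpace Ω} {ℱ : Filtration ℝ≥0 mΩ} {P : Kernel S Ω} [IsMarkovKernel P]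
  {U : ℝ≥0 → Ω → S} {g : E → S → E} {L : ℝ≥0} {κ B : ℝ} {C Λ : ℝ} {h : E × S → ℝ}

/-- Thickened indicators of closed sets are Lipschitz for a product metric, hence Lipschitz in the
first variable, and decrease to the indicators. -/
lemma ext_of_forall_isFiberLipschitz {μ ν : Measure (E × S)} [IsFiniteMeasure μ]
    [IsFiniteMeasure ν]
    (H : ∀ C Λ h, 0 ≤ Λ → IsFiberLipschitz C Λ h → Continuous h → ∫ p, h p ∂μ = ∫ p, h p ∂ν) :
    μ = ν := by
  let _ := TopologicalSpace.pseudoMetrizableSpacePseudoMetric S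
  have hδ : ∀ n : ℕ, 0 < 1 / ((n : ℝ) + 1) := fun n => by positivity
  have hI : ∀ (F : Set (E × S)) (n : ℕ), ∫⁻ p, thickenedIndicator (hδ n) F p ∂μ =
      ∫⁻ p, thickenedIndicator (hδ n) F p ∂ν := fun F n => by
    have hc : Continuous fun p => ((thickenedIndicator (hδ n) F p : ℝ≥0) : ℝ) :=
      NNReal.continuous_coe.comp (thickenedIndicator (hδ n) F).continuous
    have hb : ∀ p, |((thickenedIndicator (hδ n) F p : ℝ≥0) : ℝ)| ≤ 1 := fun p => by
      rw [NNReal.abs_eq]; exact_mod_cast thickenedIndicator_le_one (hδ n) F p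
    have h1 := H 1 (1 / ((n : ℝ) + 1)).toNNReal⁻¹ _ (by positivity)
      ⟨hc.measurable, hb, fun m m' y => by
        have h2 := (lipschitzWith_thickenedIndicator (hδ n) F).dist_le_mul (m, y) (m', y)
        rwa [NNReal.dist_eq, dist_prod_same_right, dist_eq_norm] at h2⟩ hc
    rw [lintegral_coe_eq_integral _ (integrable_of_measurable_of_bound hc.measurable hb),
      lintegral_coe_eq_integral _ (integrable_of_measurable_of_bound hc.measurable hb), h1]
  have hF : ∀ F : Set (E × S), IsClosed F → μ F = ν F := fun F hF => by
    have h1 := tendsto_lintegral_thickenedIndicator_of_isClosed μ hF hδ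
      tendsto_one_div_add_atTop_nhds_zero_nat
    have h2 := tendsto_lintegral_thickenedIndicator_of_isClosed ν hF hδ
      tendsto_one_div_add_atTop_nhds_zero_nat
    simp only [hI] at h1
    exact tendsto_nhds_unique h1 h2
  exact ext_of_generate_finite _ (BorelSpace.measurable_eq.trans borel_eq_generateFrom_isClosed)
    isPiSystem_isClosed (fun F h => hF F h) (hF univ isClosed_univ)

/-- Two positions with the same index start are driven by the same random path, so the pathwise
contraction passes to the semigroup. -/
lemma IsMarkovFamily.isFiberLipschitz_coupledKernel (hU : IsMarkovFamily ℱ P U)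
    (hg : IsMonotoneDrift g L κ B) (t : ℝ≥0) (hΛ : 0 ≤ Λ) (hh : IsFiberLipschitz C Λ h) :
    IsFiberLipschitz C (Real.exp (-κ * t) * Λ) fun p => ∫ q, h q ∂(coupledKernel P U g t p) := by
  have := hU.isMarkovKernel_coupledKernel hg t
  refine ⟨measurable_integral_kernel hh.measurable, fun p => abs_integral_le_of_bound hh.bound,
    fun m m' y => ?_⟩
  have hi : ∀ m, Integrable (fun ω => h (flow g (fun r => U r ω) m t, U t ω)) (P y) := fun m =>
    integrable_of_measurable_of_bound (hh.measurable.comp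
      ((hU.measurable_coupled hg t).comp (f := fun ω => ((m, y), ω)) measurable_prodMk_left))
      fun ω => hh.bound _
  rw [hU.integral_coupledKernel hg t _ hh.measurable, hU.integral_coupledKernel hg t _ hh.measurable,
    ← integral_sub (hi m) (hi m')]
  refine abs_integral_le_of_bound fun ω => (hh.lip _ _ _).trans ?_
  have h1 := (hg.isFlowPath_flow (hU.rightCont ω) m).norm_sub_le hg (hU.rightCont ω)
    (hg.isFlowPath_flow (hU.rightCont ω) m') t
  calc _ ≤ Λ * (Real.exp (-κ * t) * ‖m - m'‖) := by gcongr
    _ = _ := by ring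

lemma IsMarkovFamily.map_snd_coupledKernel (hU : IsMarkovFamily ℱ P U)
    (hg : IsMonotoneDrift g L κ B) (t : ℝ≥0) (μ : Measure (E × S)) :
    (coupledKernel P U g t ∘ₘ μ).map Prod.snd = P.map (U t) ∘ₘ μ.map Prod.snd := by
  rw [Measure.map_comp _ _ measurable_snd, ← Measure.deterministic_comp_eq_map measurable_snd,
    Measure.comp_assoc]
  congr 1
  ext1 p
  rw [Kernel.map_apply _ measurable_snd, hU.coupledKernel_apply hg, Measure.map_map measurable_snd
    (hU.measurable_coupled_path hg t p.1), Kernel.comp_deterministic_eq_comap,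
    Kernel.comap_apply, Kernel.map_apply _ (hU.measurable t)]
  rfl

/-- Start the coupled process at `(0, y)` with `y` of law `π`. -/
noncomputable def atZero (E : Type*) {S : Type*} [NormedAddCommGroup E] [MeasurableSpace E]
    [MeasurableSpace S] (π : Measure S) : Measure (E × S) :=
  π.map fun y => ((0 : E), y)

lemma map_snd_atZero (π : Measure S) : (atZero E π).map Prod.snd = π := by
  rw [atZero, Measure.map_map measurable_snd measurable_prodMk_left]
  exact Measure.map_id

/-- Replacing `(m, y)` by `(0, y)` changes the semigroup at time `n` by at most `exp (-κ n) Λ ‖m‖`.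
The integrand is also bounded by `2 C`, so dominated convergence needs no moment of the first
marginal. -/
lemma IsMarkovFamily.tendsto_integral_coupledKernel_sub (hU : IsMarkovFamily ℱ P U)
    (hg : IsMonotoneDrift g L κ B) {π : Measure S} [IsProbabilityMeasure π] {Q : Measure (E × S)}
    [IsProbabilityMeasure Q] (hQ : Q.map Prod.snd = π) (hΛ : 0 ≤ Λ)
    (hh : IsFiberLipschitz C Λ h) :
    Tendsto (fun n : ℕ => ∫ p, h p ∂(coupledKernel P U g n ∘ₘ Q) -
      ∫ p, h p ∂(coupledKernel P U g n ∘ₘ atZero E π)) atTop (𝓝 0) := by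
  have : IsProbabilityMeasure (atZero E π) :=
    Measure.isProbabilityMeasure_map measurable_prodMk_left.aemeasurable
  have hL := fun n : ℕ => hU.isFiberLipschitz_coupledKernel hg n hΛ hh
  have hi := fun n : ℕ => integrable_of_measurable_of_bound (μ := Q) (hL n).measurable (hL n).bound
  have hm' : ∀ n : ℕ, Measurable fun p : E × S => ∫ q, h q ∂(coupledKernel P U g n (0, p.2)) :=
    fun n => (hL n).measurable.comp (measurable_const.prodMk measurable_snd)
  have hi' := fun n : ℕ => integrable_of_measurable_of_bound (μ := Q) (hm' n)
    fun p => (hL n).bound _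
  have h1 : ∀ n : ℕ, ∫ p, h p ∂(coupledKernel P U g n ∘ₘ Q) -
      ∫ p, h p ∂(coupledKernel P U g n ∘ₘ atZero E π) =
      ∫ p, (∫ q, h q ∂(coupledKernel P U g n p) - ∫ q, h q ∂(coupledKernel P U g n (0, p.2))) ∂Q :=
    fun n => by
      have := hU.isMarkovKernel_coupledKernel hg n
      rw [integral_comp_measure hh.measurable hh.bound,
        integral_comp_measure hh.measurable hh.bound, integral_sub (hi n) (hi' n), atZero,
        integral_map measurable_prodMk_left.aemeasurable (hL n).measurable.aestronglyMeasurable,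
        ← hQ, integral_map measurable_snd.aemeasurable]
      exact ((hL n).measurable.comp measurable_prodMk_left).aestronglyMeasurable
  simp only [h1]
  rw [← integral_zero (E × S) ℝ (μ := Q)]
  refine tendsto_integral_of_dominated_convergence (fun _ => C + C)
    (fun n => ((hL n).measurable.sub (hm' n)).aestronglyMeasurable) (integrable_const _)
    (fun n => ae_of_all _ fun p =>
      (norm_sub_le _ _).trans (add_le_add ((hL n).bound _) ((hL n).bound _)))
    (ae_of_all _ fun p => ?_)
  refine squeeze_zero_norm (fun n => (hL n).lip p.1 0 p.2) ?_
  have h2 : Tendsto (fun n : ℕ => Real.exp (-κ * (n : ℝ≥0))) atTop (𝓝 0) := by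
    refine Real.tendsto_exp_atBot.comp ?_
    simp only [NNReal.coe_natCast]
    exact tendsto_natCast_atTop_atTop.const_mul_atTop_of_neg (neg_neg_of_pos hg.pos)
  simpa using (h2.mul_const Λ).mul_const ‖p.1 - 0‖

/-- Two stationary measures of the coupled process with the same second marginal agree. -/
lemma IsMarkovFamily.stationary_unique (hU : IsMarkovFamily ℱ P U) (hg : IsMonotoneDrift g L κ B)
    {π : Measure S} [IsProbabilityMeasure π] {Q Q' : Measure (E × S)} [IsProbabilityMeasure Q]
    [IsProbabilityMeasure Q'] (hQ : Q.map Prod.snd = π) (hQ' : Q'.map Prod.snd = π)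
    (hs : ∀ t, coupledKernel P U g t ∘ₘ Q = Q) (hs' : ∀ t, coupledKernel P U g t ∘ₘ Q' = Q') :
    Q = Q' := by
  refine ext_of_forall_isFiberLipschitz fun C Λ h hΛ hh _ => ?_
  have h1 := (hU.tendsto_integral_coupledKernel_sub hg hQ hΛ hh).sub
    (hU.tendsto_integral_coupledKernel_sub hg hQ' hΛ hh)
  simp only [hs, hs', sub_sub_sub_cancel_right, sub_zero] at h1
  exact sub_eq_zero.1 (tendsto_nhds_unique tendsto_const_nhds h1)

lemma IsFiberLipschitz.comp_eulerStep (hg : IsMonotoneDrift g L κ B) (hΛ : 0 ≤ Λ)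
    (hh : IsFiberLipschitz C Λ h) (δ : ℝ≥0) :
    IsFiberLipschitz C ((1 + δ * L) * Λ) fun p => h (eulerStep g δ p) := by
  refine ⟨hh.measurable.comp (hg.continuous_eulerStep δ).measurable, fun p => hh.bound _,
    fun m m' y => (hh.lip _ _ _).trans ?_⟩
  have h1 : ‖m - (δ : ℝ) • g m y - (m' - (δ : ℝ) • g m' y)‖ ≤ ‖m - m'‖ + δ * (L * ‖m - m'‖) := by
    rw [sub_sub_sub_comm, ← smul_sub]
    refine (norm_sub_le _ _).trans ?_
    rw [norm_smul, Real.norm_of_nonneg δ.coe_nonneg]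
    gcongr
    exact hg.norm_apply_sub_le _ _ _
  calc _ ≤ Λ * (‖m - m'‖ + δ * (L * ‖m - m'‖)) := by gcongr
    _ = _ := by ring

/-- Joint continuity comes from the Feller property in `y` for fixed position and the Lipschitz
bound in the position uniformly in `y`. -/
lemma IsMarkovFamily.isFiberLipschitz_stepKernel (hU : IsMarkovFamily ℱ P U) (t : ℝ≥0)
    (hΛ : 0 ≤ Λ) (hh : IsFiberLipschitz C Λ h) (hc : Continuous h) :
    IsFiberLipschitz C Λ (fun p => ∫ q, h q ∂(stepKernel E P U t p)) ∧
      Continuous fun p => ∫ q, h q ∂(stepKernel E P U t p) := by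
  have := hU.isMarkovKernel_stepKernel (E := E) t
  have h1 : ∀ p, ∫ q, h q ∂(stepKernel E P U t p) = ∫ ω, h (p.1, U t ω) ∂(P p.2) := fun p => by
    rw [stepKernel, pathKernel_apply (hU.measurable_step t),
      integral_map _ hh.measurable.aestronglyMeasurable]
    exact ((hU.measurable_step t).comp measurable_prodMk_left).aemeasurable
  have h2 : IsFiberLipschitz C Λ (fun p => ∫ q, h q ∂(stepKernel E P U t p)) := by
    refine ⟨measurable_integral_kernel hh.measurable, fun p => abs_integral_le_of_bound hh.bound,
      fun m m' y => ?_⟩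
    have hi : ∀ m, Integrable (fun ω => h (m, U t ω)) (P y) := fun m =>
      integrable_of_measurable_of_bound (hh.measurable.comp
        (measurable_const.prodMk (hU.measurable t))) fun ω => hh.bound _
    rw [h1, h1, ← integral_sub (hi m) (hi m')]
    exact abs_integral_le_of_bound fun ω => hh.lip _ _ _
  refine ⟨h2, continuous_prod_of_continuous_lipschitzWith _ Λ.toNNReal (fun m => ?_) fun y => ?_⟩
  · simp only [h1]
    exact hU.feller t ⟨fun y => h (m, y), by fun_prop⟩
  · refine LipschitzWith.of_dist_le_mul fun m m' => ?_
    rw [Real.dist_eq, dist_eq_norm, Real.coe_toNNReal _ hΛ]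
    exact h2.lip m m' y

/-- Supplies continuous approximations to the coupled semigroup, with Lipschitz constants that stay
bounded when `k δ` is fixed. -/
lemma IsMarkovFamily.isFiberLipschitz_eulerKernel (hU : IsMarkovFamily ℱ P U)
    (hg : IsMonotoneDrift g L κ B) (δ : ℝ≥0) (k : ℕ) (hΛ : 0 ≤ Λ) (hh : IsFiberLipschitz C Λ h)
    (hc : Continuous h) :
    IsFiberLipschitz C ((1 + δ * L) ^ k * Λ) (fun p => ∫ q, h q ∂(eulerKernel P U g δ k p)) ∧
      Continuous fun p => ∫ q, h q ∂(eulerKernel P U g δ k p) := by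
  induction k generalizing h Λ with
  | zero => simpa [eulerKernel, Kernel.id_apply] using ⟨hh, hc⟩
  | succ k ih =>
    have hΛ' : 0 ≤ (1 + δ * L) * Λ := by positivity
    have hst := hU.isMarkovKernel_stepKernel (E := E) δ
    have hmk := Kernel.IsMarkovKernel.map (stepKernel E P U δ) (hg.continuous_eulerStep δ).measurable
    have hmk' := hU.isMarkovKernel_eulerKernel hg δ k
    have h1 := hU.isFiberLipschitz_stepKernel δ hΛ' (hh.comp_eulerStep hg hΛ δ)
      (hc.comp (hg.continuous_eulerStep δ))
    have h2 := ih hΛ' h1.1 h1.2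
    have h3 : ∀ p, ∫ q, h q ∂(eulerKernel P U g δ (k + 1) p) = ∫ q, ∫ q', h (eulerStep g δ q')
        ∂(stepKernel E P U δ q) ∂(eulerKernel P U g δ k p) := fun p => by
      rw [eulerKernel, Kernel.comp_apply, integral_comp_measure hh.measurable hh.bound]
      refine integral_congr_ae (ae_of_all _ fun q => ?_)
      beta_reduce
      rw [Kernel.map_apply _ (hg.continuous_eulerStep δ).measurable,
        integral_map (hg.continuous_eulerStep δ).measurable.aemeasurable
        hh.measurable.aestronglyMeasurable]
    simp only [h3]
    rw [pow_succ, mul_assoc]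
    exact h2

/-- Pointwise convergence of uniformly fibrewise Lipschitz functions is uniform in mean over all
probability measures carried by a given compact set of positions with a given second marginal. -/
lemma tendsto_integral_fiberLipschitz {π : Measure S} [IsProbabilityMeasure π] {K : Set E}
    (hK : IsCompact K) (hΛ : 0 ≤ Λ) {H : ℕ → E × S → ℝ} (hH : ∀ n, IsFiberLipschitz C Λ (H n))
    (hh : IsFiberLipschitz C Λ h) (hlim : ∀ p, Tendsto (fun n => H n p) atTop (𝓝 (h p)))
    {η : ℝ} (hη : 0 < η) :
    ∀ᶠ n in atTop, ∀ Q : Measure (E × S), IsProbabilityMeasure Q → Q.map Prod.snd = π →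
      (∀ᵐ p ∂Q, p.1 ∈ K) → |∫ p, H n p ∂Q - ∫ p, h p ∂Q| ≤ η := by
  -- Moving to a nearest centre costs `Λ r` for each of the two functions, so at most `η / 2` in
  -- all; adding `1` to `Λ` avoids division by zero.
  set r : ℝ := η / (4 * (Λ + 1)) with hr_def
  have hr : 0 < r := by positivity
  have hΛr : 2 * Λ * r ≤ η / 2 := by
    rw [hr_def, mul_div_assoc', div_le_div_iff₀ (by positivity) (by positivity)]
    nlinarith
  obtain ⟨F, -, hF, hcov⟩ := hK.finite_cover_balls hr
  lift F to Finset E using hF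
  have hD : Tendsto (fun n => ∑ x ∈ F, ∫ y, |H n (x, y) - h (x, y)| ∂π) atTop (𝓝 0) := by
    rw [← Finset.sum_const_zero (s := F)]
    refine tendsto_finsetSum _ fun x _ => ?_
    rw [← integral_zero S ℝ (μ := π)]
    refine tendsto_integral_of_dominated_convergence (fun _ => C + C) (fun n => ?_)
      (integrable_const _) (fun n => ae_of_all _ fun y => ?_) (ae_of_all _ fun y => ?_)
    · exact (((hH n).measurable.comp measurable_prodMk_left).sub
        (hh.measurable.comp measurable_prodMk_left)).abs.aestronglyMeasurable
    · rw [Real.norm_eq_abs, abs_abs]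
      exact (abs_sub _ _).trans (add_le_add ((hH n).bound _) (hh.bound _))
    · simpa using ((hlim (x, y)).sub_const (h (x, y))).abs
  filter_upwards [hD.eventually (gt_mem_nhds (half_pos hη))] with n hn Q hQ hQπ hQK
  have hm : ∀ x, Measurable fun y => |H n (x, y) - h (x, y)| := fun x =>
    (((hH n).measurable.comp measurable_prodMk_left).sub
        (hh.measurable.comp measurable_prodMk_left)).abs
  have hb : ∀ p, |(|H n p - h p|)| ≤ C + C := fun p => by
    rw [abs_abs]
    exact (abs_sub _ _).trans (add_le_add ((hH n).bound _) (hh.bound _))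
  have hi : ∀ x, Integrable (fun p : E × S => |H n (x, p.2) - h (x, p.2)|) Q := fun x =>
    integrable_of_measurable_of_bound ((hm x).comp measurable_snd) fun p => hb (x, p.2)
  have hi1 := integrable_of_measurable_of_bound (μ := Q) (hH n).measurable (hH n).bound
  have hi2 := integrable_of_measurable_of_bound (μ := Q) hh.measurable hh.bound
  have h1 : ∀ᵐ p ∂Q, |H n p - h p| ≤ η / 2 + ∑ x ∈ F, |H n (x, p.2) - h (x, p.2)| := by
    filter_upwards [hQK] with p hp
    obtain ⟨x, hx, hpx⟩ := mem_iUnion₂.1 (hcov hp)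
    rw [mem_ball_iff_norm] at hpx
    have e1 := (hH n).lip p.1 x p.2
    have e2 := hh.lip x p.1 p.2
    rw [norm_sub_rev] at e2
    have e3 : Λ * ‖p.1 - x‖ ≤ Λ * r := by gcongr
    have e4 : |H n (x, p.2) - h (x, p.2)| ≤ ∑ x ∈ F, |H n (x, p.2) - h (x, p.2)| :=
      Finset.single_le_sum (f := fun x => |H n (x, p.2) - h (x, p.2)|)
        (fun _ _ => abs_nonneg _) hx
    have e5 : |H n p - h p| ≤ |H n p - H n (x, p.2)| + |H n (x, p.2) - h (x, p.2)| +
        |h (x, p.2) - h p| := by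
      refine le_trans (le_of_eq ?_) (abs_add_three _ _ _)
      congr 1; ring
    have e1' : |H n p - H n (x, p.2)| ≤ Λ * ‖p.1 - x‖ := e1
    have e2' : |h (x, p.2) - h p| ≤ Λ * ‖p.1 - x‖ := e2
    linarith
  rw [← integral_sub hi1 hi2]
  calc |∫ p, (H n p - h p) ∂Q| ≤ ∫ p, |H n p - h p| ∂Q := abs_integral_le_integral_abs
    _ ≤ ∫ p, (η / 2 + ∑ x ∈ F, |H n (x, p.2) - h (x, p.2)|) ∂Q :=
        integral_mono_ae (hi1.sub hi2).abs
          ((integrable_const _).add (integrable_finsetSum _ fun x _ => hi x)) h1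
    _ = η / 2 + ∑ x ∈ F, ∫ y, |H n (x, y) - h (x, y)| ∂π := by
        rw [integral_add (integrable_const _) (integrable_finsetSum _ fun x _ => hi x),
          integral_finsetSum _ fun x _ => hi x, integral_const, probReal_univ, one_smul]
        congr 1
        refine Finset.sum_congr rfl fun x _ => ?_
        rw [← hQπ, integral_map measurable_snd.aemeasurable (hm x).aestronglyMeasurable]
    _ ≤ η := by linarith

/-- Existence of a stationary measure of the coupled process, carried by the absorbing ball. -/
lemma IsMarkovFamily.exists_stationary [ProperSpace E] (hU : IsMarkovFamily ℱ P U)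
    (hg : IsMonotoneDrift g L κ B) {π : Measure S} [IsProbabilityMeasure π]
    (hπ : ∀ t, P.map (U t) ∘ₘ π = π) :
    ∃ Q : Measure (E × S), IsProbabilityMeasure Q ∧ (∀ t, coupledKernel P U g t ∘ₘ Q = Q) ∧
      Q.map Prod.snd = π ∧ ∀ᵐ p ∂Q, ‖p.1‖ ≤ B / κ := by
  have hmk := fun t => hU.isMarkovKernel_coupledKernel (P := P) hg t
  have h0 : IsProbabilityMeasure (atZero E π) :=
    Measure.isProbabilityMeasure_map measurable_prodMk_left.aemeasurable
  have hBκ : 0 ≤ B / κ := by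
    obtain ⟨y⟩ : Nonempty S := π.nonempty_of_neZero
    exact div_nonneg ((norm_nonneg _).trans (hg.bound y)) hg.pos.le
  set A : Set (E × S) := Metric.closedBall 0 (B / κ) ×ˢ univ with hA
  have hAc : IsCompact A := (isCompact_closedBall _ _).prod isCompact_univ
  let R : ℕ → ProbabilityMeasure (E × S) := fun n => ⟨coupledKernel P U g n ∘ₘ atZero E π,
    inferInstance⟩
  have hsupp : ∀ n : ℕ, (coupledKernel P U g n ∘ₘ atZero E π) Aᶜ = 0 := fun n => by
    rw [Measure.bind_apply hAc.measurableSet.compl (Kernel.aemeasurable _), atZero,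
      lintegral_map (Kernel.measurable_coe _ hAc.measurableSet.compl) measurable_prodMk_left]
    refine lintegral_eq_zero_of_ae_eq_zero (ae_of_all _ fun y => ?_)
    beta_reduce
    rw [hU.coupledKernel_apply hg, Measure.map_apply
      (hU.measurable_coupled_path hg _ _) hAc.measurableSet.compl]
    have : ((fun ω => (flow g (fun r => U r ω) (0 : E) n, U n ω)) ⁻¹' Aᶜ) = ∅ := by
      refine eq_empty_of_forall_notMem fun ω hω => hω ?_
      refine ⟨?_, mem_univ _⟩
      rw [mem_closedBall_zero_iff]
      exact (hg.isFlowPath_flow (hU.rightCont ω) 0).norm_le hg (hU.rightCont ω) (by simpa) n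
    rw [this, measure_empty, Pi.zero_apply]
  -- All the laws are carried by the compact set `A`, so Prokhorov compactness gives a limit; an
  -- ultrafilter replaces a subsequence.
  obtain ⟨Q, hQA, hQlim⟩ : ∃ Q ∈ {μ : ProbabilityMeasure (E × S) | ∀ _ : ℕ, μ Aᶜ ≤ 0},
      Tendsto R (hyperfilter ℕ) (𝓝 Q) := by
    refine (isCompact_setOfPred_probabilityMeasure_mass_eq_compl_isCompact_le
      (u := fun _ => 0) (K := fun _ => A) tendsto_const_nhds (fun _ => hAc)
      (Or.inr monotone_const)).ultrafilter_le_nhds' ((hyperfilter ℕ).map R) ?_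
    refine Ultrafilter.mem_map.2 (Filter.univ_mem' fun n => ?_)
    intro _
    have := hsupp n
    simp [R, this]
  have hR : ∀ (f : BoundedContinuousFunction (E × S) ℝ),
      Tendsto (fun n : ℕ => ∫ p, f p ∂(coupledKernel P U g n ∘ₘ atZero E π)) (hyperfilter ℕ)
        (𝓝 (∫ p, f p ∂(Q : Measure (E × S)))) :=
    fun f => ProbabilityMeasure.tendsto_iff_forall_integral_tendsto.1 hQlim f
  have hsnd : ∀ μ : Measure (E × S), μ.map Prod.snd = π → ∀ t,
      (coupledKernel P U g t ∘ₘ μ).map Prod.snd = π := fun μ hμ t => by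
    rw [hU.map_snd_coupledKernel hg, hμ, hπ]
  have hQπ : (Q : Measure (E × S)).map Prod.snd = π := by
    have := Measure.isProbabilityMeasure_map (μ := (Q : Measure (E × S)))
      measurable_snd.aemeasurable
    refine ext_of_forall_integral_eq_of_IsFiniteMeasure fun ψ => ?_
    rw [integral_map measurable_snd.aemeasurable ψ.continuous.measurable.aestronglyMeasurable]
    refine tendsto_nhds_unique (hR (ψ.compContinuous ⟨Prod.snd, continuous_snd⟩)) ?_
    refine tendsto_const_nhds.congr fun n => ?_
    have h1 : ∫ y, ψ y ∂((coupledKernel P U g n ∘ₘ atZero E π).map Prod.snd) = ∫ y, ψ y ∂π := by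
      rw [hsnd _ (map_snd_atZero π) n]
    rw [← h1, integral_map measurable_snd.aemeasurable
      ψ.continuous.measurable.aestronglyMeasurable]
    rfl
  have hae : ∀ μ : Measure (E × S), μ Aᶜ = 0 → ∀ᵐ p ∂μ, p.1 ∈ Metric.closedBall 0 (B / κ) :=
    fun μ hμ => by
      filter_upwards [compl_mem_ae_iff.2 hμ] with p hp
      exact (not_not.1 hp).1
  have hQA' : (Q : Measure (E × S)) Aᶜ = 0 := by
    have := hQA 0
    rw [nonpos_iff_eq_zero, ProbabilityMeasure.null_iff_toMeasure_null] at this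
    exact this
  refine ⟨Q, inferInstance, fun s => ?_, hQπ, (hae _ hQA').mono fun p hp => by simpa using hp⟩
  refine ext_of_forall_isFiberLipschitz fun C Λ h hΛ hh hc => ?_
  rw [integral_comp_measure hh.measurable hh.bound]
  have hexp : ∀ n : ℕ, (1 + ((s / (n + 1 : ℕ) : ℝ≥0) : ℝ) * L) ^ (n + 1) ≤ Real.exp (s * L) :=
    fun n => by
      have h1 : (1 + ((s / (n + 1 : ℕ) : ℝ≥0) : ℝ) * L) ≤ Real.exp ((s / (n + 1 : ℕ) : ℝ≥0) * L) := by
        rw [add_comm]; exact Real.add_one_le_exp _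
      calc _ ≤ Real.exp ((s / (n + 1 : ℕ) : ℝ≥0) * L) ^ (n + 1) := by gcongr
        _ = _ := by
          rw [← Real.exp_nat_mul]
          congr 1
          push_cast
          field_simp
  have hH : ∀ n : ℕ, IsFiberLipschitz C (Real.exp (s * L) * Λ)
      (fun p => ∫ q, h q ∂(eulerKernel P U g (s / (n + 1 : ℕ)) (n + 1) p)) := fun n => by
    have h1 := (hU.isFiberLipschitz_eulerKernel hg (s / (n + 1 : ℕ)) (n + 1) hΛ hh hc).1
    refine ⟨h1.measurable, h1.bound, fun m m' y => (h1.lip m m' y).trans ?_⟩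
    gcongr
    exact hexp n
  have hHc := fun n : ℕ =>
    (hU.isFiberLipschitz_eulerKernel hg (s / (n + 1 : ℕ)) (n + 1) hΛ hh hc).2
  have hK : IsFiberLipschitz C (Real.exp (s * L) * Λ)
      fun p => ∫ q, h q ∂(coupledKernel P U g s p) := by
    have h1 := hU.isFiberLipschitz_coupledKernel hg s hΛ hh
    have h2 : (0 : ℝ) ≤ s * L := by positivity
    have h3 : (0 : ℝ) ≤ κ * s := mul_nonneg hg.pos.le s.coe_nonneg
    exact ⟨h1.measurable, h1.bound, fun m m' y => (h1.lip m m' y).trans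
      (mul_le_mul_of_nonneg_right (mul_le_mul_of_nonneg_right
        (Real.exp_le_exp.2 (by linarith)) hΛ) (norm_nonneg _))⟩
  -- Weak convergence is applied to one Euler kernel, whose action on `h` is continuous. It differs
  -- from the coupled semigroup by at most `η / 4` in mean, uniformly over the laws involved, since
  -- all are carried by the ball and have marginal `π`.
  have hlim : Tendsto (fun n : ℕ => ∫ p, ∫ q, h q ∂(coupledKernel P U g s p)
      ∂(coupledKernel P U g n ∘ₘ atZero E π)) (hyperfilter ℕ)
      (𝓝 (∫ p, ∫ q, h q ∂(coupledKernel P U g s p) ∂(Q : Measure (E × S)))) := by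
    refine Metric.tendsto_nhds.2 fun η hη => ?_
    obtain ⟨N, hN⟩ := (tendsto_integral_fiberLipschitz (π := π) (isCompact_closedBall 0 (B / κ))
      (by positivity) hH hK (fun p => hU.tendsto_integral_eulerKernel hg s p hc hh.bound)
      (by positivity : 0 < η / 4)).exists
    have hN' := hR (BoundedContinuousFunction.ofNormedAddCommGroup _ (hHc N) C (hH N).bound)
    filter_upwards [Metric.tendsto_nhds.1 hN' (η / 4) (by positivity)] with n hn
    have e1 := hN _ inferInstance (hsnd _ (map_snd_atZero π) n) (hae _ (hsupp n))
    have e2 := hN Q inferInstance hQπ (hae _ hQA')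
    simp only [BoundedContinuousFunction.coe_ofNormedAddCommGroup] at hn
    rw [Real.dist_eq] at hn ⊢
    rw [abs_le] at e1 e2
    rw [abs_lt] at hn ⊢
    constructor <;> linarith
  -- The kernels commute, so running for an extra time `s` can be moved to the start. The new
  -- initial law still has marginal `π`, hence leads to the same limit.
  have h5 : ∀ n : ℕ, ∫ p, ∫ q, h q ∂(coupledKernel P U g s p)
      ∂(coupledKernel P U g n ∘ₘ atZero E π) =
      ∫ p, h p ∂(coupledKernel P U g n ∘ₘ (coupledKernel P U g s ∘ₘ atZero E π)) := fun n => by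
    rw [← integral_comp_measure hh.measurable hh.bound, Measure.comp_assoc, Measure.comp_assoc,
      ← hU.coupledKernel_add hg, ← hU.coupledKernel_add hg, add_comm]
  simp only [h5] at hlim
  have h6 := (hU.tendsto_integral_coupledKernel_sub hg
    (hsnd _ (map_snd_atZero π) s) hΛ hh).mono_left Nat.hyperfilter_le_atTop
  have h7 := hR (BoundedContinuousFunction.ofNormedAddCommGroup _ hc C hh.bound)
  have h8 := h6.add h7
  simp only [BoundedContinuousFunction.coe_ofNormedAddCommGroup, sub_add_cancel, zero_add] at h8
  exact tendsto_nhds_unique hlim h8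

end Stationary

lemma IsFellerProcess.isMarkovFamily {S Ω : Type*} [TopologicalSpace S]
    [MeasurableSpace S] {mΩ : MeasurableSpace Ω} {ℱ : Filtration ℝ≥0 mΩ} {P : Kernel S Ω}
    {V : ℝ≥0 → Ω → S} (hV : IsFellerProcess ℱ P V) : IsMarkovFamily ℱ P V :=
  ⟨hV.adapted, fun ω t => (hV.cadlag ω t).1, hV.start, hV.markov, hV.feller⟩

/-! ### Ergodicity of the index process and second moments of time integrals. -/

section Ergodic

variable {S Ω : Type*}
  [TopologicalSpace S] [PolishSpace S] [CompactSpace S] [MeasurableSpace S] [BorelSpace S]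
  {mΩ : MeasurableSpace Ω} {ℱ : Filtration ℝ≥0 mΩ} {P : Kernel S Ω} [IsMarkovKernel P]
  {U : ℝ≥0 → Ω → S} {π : Measure S}

/-- The transition semigroup `T_t h(y) = E_y[h(U_t)]`. -/
noncomputable def semigroup {S Ω : Type*} [MeasurableSpace S] [MeasurableSpace Ω]
    (P : Kernel S Ω) (U : ℝ≥0 → Ω → S) (h : S → ℝ) (t : ℝ≥0) (y : S) : ℝ :=
  ∫ ω, h (U t ω) ∂(P y)

lemma abs_semigroup_le (h : C(S, ℝ)) (t : ℝ≥0) (y : S) : |semigroup P U h t y| ≤ ‖h‖ :=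
  abs_integral_le_of_bound fun _ => h.norm_coe_le_norm _

lemma abs_integral_semigroup_le (h : C(S, ℝ)) (y : S) (a b : ℝ) :
    |∫ s in a..b, semigroup P U h s.toNNReal y| ≤ ‖h‖ * |b - a| :=
  intervalIntegral.norm_integral_le_of_norm_le_const (f := fun s : ℝ => semigroup P U h s.toNNReal y)
    fun _ _ => abs_semigroup_le h _ y

lemma IsMarkovFamily.continuous_semigroup (hU : IsMarkovFamily ℱ P U) (h : C(S, ℝ)) (t : ℝ≥0) :
    Continuous (semigroup P U h t) := hU.feller t h

lemma IsMarkovFamily.integral_map (hU : IsMarkovFamily ℱ P U) (h : C(S, ℝ)) (t : ℝ≥0) (y : S) :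
    ∫ z, h z ∂(P.map (U t) y) = semigroup P U h t y := by
  rw [Kernel.map_apply _ (hU.measurable t), MeasureTheory.integral_map (hU.measurable t).aemeasurable
    h.continuous.measurable.aestronglyMeasurable]
  rfl

lemma IsMarkovFamily.integral_mul_add (hU : IsMarkovFamily ℱ P U) (φ h : C(S, ℝ)) (t s : ℝ≥0)
    (x : S) : ∫ ω, φ (U t ω) * h (U (t + s) ω) ∂(P x) =
      ∫ ω, φ (U t ω) * semigroup P U h s (U t ω) ∂(P x) := by
  have h4 : StronglyMeasurable[ℱ t] fun ω => φ (U t ω) :=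
    (φ.continuous.measurable.comp (hU.adapted t)).stronglyMeasurable
  have h5 : Integrable (fun ω => h (U (t + s) ω)) (P x) :=
    integrable_of_measurable_of_bound (h.continuous.measurable.comp (hU.measurable _))
      fun ω => h.norm_coe_le_norm _
  have h6 := condExp_stronglyMeasurable_mul_of_bound (ℱ.le t) h4 h5 ‖φ‖
    (ae_of_all _ fun ω => φ.norm_coe_le_norm _)
  rw [← integral_condExp (ℱ.le t)]
  refine integral_congr_ae ?_
  filter_upwards [h6, hU.markov x s t h] with ω h6 h7
  exact h6.trans (congrArg (φ (U t ω) * ·) h7)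

lemma IsMarkovFamily.semigroup_add (hU : IsMarkovFamily ℱ P U) (h : C(S, ℝ)) (t s : ℝ≥0) (x : S) :
    semigroup P U h (t + s) x = semigroup P U (semigroup P U h s) t x := by
  simpa using! hU.integral_mul_add 1 h t s x

lemma IsMarkovFamily.measurable_uncurry_comp (hU : IsMarkovFamily ℱ P U) :
    Measurable fun q : ℝ × Ω => U q.1.toNNReal q.2 :=
  hU.measurable_uncurry.comp ((measurable_real_toNNReal.comp measurable_fst).prodMk measurable_snd)

lemma IsMarkovFamily.measurable_semigroup (hU : IsMarkovFamily ℱ P U) (h : C(S, ℝ)) (y : S) :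
    Measurable fun t : ℝ => semigroup P U h t.toNNReal y :=
  (StronglyMeasurable.integral_prod_right (ν := P y)
    (f := fun (t : ℝ) ω => h (U t.toNNReal ω))
    (h.continuous.measurable.comp hU.measurable_uncurry_comp).stronglyMeasurable).measurable

lemma IsMarkovFamily.intervalIntegrable_semigroup (hU : IsMarkovFamily ℱ P U) (h : C(S, ℝ)) (y : S)
    (a b : ℝ) : IntervalIntegrable (fun t : ℝ => semigroup P U h t.toNNReal y) volume a b :=
  (intervalIntegrable_const (c := ‖h‖)).mono_fun (hU.measurable_semigroup h y).aestronglyMeasurable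
    (ae_of_all _ fun t => by simpa using abs_semigroup_le h _ y)

/-- Shifting the time window by `t` changes only two end pieces of length `t`. Divided by a large
`a`, this makes limits of occupation laws invariant. -/
lemma IsMarkovFamily.abs_integral_semigroup_shift_sub_le (hU : IsMarkovFamily ℱ P U) (h : C(S, ℝ))
    (y : S) (t : ℝ≥0) {a : ℝ} (ha : 0 ≤ a) :
    |(∫ s in (0 : ℝ)..a, semigroup P U (semigroup P U h t) s.toNNReal y) -
      ∫ s in (0 : ℝ)..a, semigroup P U h s.toNNReal y| ≤ 2 * (‖h‖ * t) := by
  have hi := hU.intervalIntegrable_semigroup h y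
  have h1 : ∫ s in (0 : ℝ)..a, semigroup P U (semigroup P U h t) s.toNNReal y =
      ∫ s in (t : ℝ)..(a + t), semigroup P U h s.toNNReal y := by
    have h2 := intervalIntegral.integral_comp_add_right (a := 0) (b := a)
        (fun s : ℝ => semigroup P U h s.toNNReal y) t
    rw [zero_add] at h2
    rw [← h2]
    refine intervalIntegral.integral_congr fun s hs => ?_
    rw [uIcc_of_le ha] at hs
    simp only [Real.toNNReal_add hs.1 t.coe_nonneg, Real.toNNReal_coe, hU.semigroup_add]
  have h3 := abs_integral_semigroup_le (P := P) (U := U) h y a (a + t)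
  have h4 := abs_integral_semigroup_le (P := P) (U := U) h y 0 t
  rw [add_sub_cancel_left, NNReal.abs_eq] at h3
  rw [sub_zero, NNReal.abs_eq] at h4
  have h5 := intervalIntegral.integral_add_adjacent_intervals (hi 0 a) (hi a (a + t))
  have h6 := intervalIntegral.integral_add_adjacent_intervals (hi 0 t) (hi t (a + t))
  rw [h1]
  rw [abs_le] at h3 h4 ⊢
  constructor <;> linarith

/-- The law of the process at a uniformly distributed time in `[0, a]`. -/
noncomputable def occupation {S Ω : Type*} [MeasurableSpace S] [MeasurableSpace Ω]
    (P : Kernel S Ω) (U : ℝ≥0 → Ω → S) (a : ℝ) (y : S) : Measure S :=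
  ((volume.restrict (Ioc (0 : ℝ) 1)).prod (P y)).map fun q => U (a * q.1).toNNReal q.2

lemma IsMarkovFamily.measurable_occupation (hU : IsMarkovFamily ℱ P U) (a : ℝ) :
    Measurable fun q : ℝ × Ω => U (a * q.1).toNNReal q.2 :=
  hU.measurable_uncurry_comp.comp (f := fun q : ℝ × Ω => (a * q.1, q.2))
    ((measurable_fst.const_mul a).prodMk measurable_snd)

lemma isProbabilityMeasure_unitInterval :
    IsProbabilityMeasure (volume.restrict (Ioc (0 : ℝ) 1)) := ⟨by simp⟩

lemma IsMarkovFamily.isProbabilityMeasure_occupation (hU : IsMarkovFamily ℱ P U) (a : ℝ) (y : S) :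
    IsProbabilityMeasure (occupation P U a y) := by
  have := isProbabilityMeasure_unitInterval
  exact Measure.isProbabilityMeasure_map (hU.measurable_occupation a).aemeasurable

lemma IsMarkovFamily.mul_integral_occupation (hU : IsMarkovFamily ℱ P U) (a : ℝ) (y : S)
    (h : C(S, ℝ)) : a * ∫ z, h z ∂(occupation P U a y) =
      ∫ s in (0 : ℝ)..a, semigroup P U h s.toNNReal y := by
  have := isProbabilityMeasure_unitInterval
  rw [occupation, MeasureTheory.integral_map (hU.measurable_occupation a).aemeasurable
    h.continuous.measurable.aestronglyMeasurable, integral_prod]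
  · have h1 := intervalIntegral.mul_integral_comp_mul_left (a := 0) (b := 1)
      (f := fun s : ℝ => semigroup P U h s.toNNReal y) a
    rw [mul_zero, mul_one] at h1
    rw [← h1, intervalIntegral.integral_of_le zero_le_one]
    rfl
  · exact integrable_of_measurable_of_bound
      (h.continuous.measurable.comp (hU.measurable_occupation a)) fun q => h.norm_coe_le_norm _

/-- If `π` is the unique invariant law, the time integrals of the semigroup applied to a function
of `π`-mean zero grow sublinearly, uniformly in the starting point. -/
lemma IsMarkovFamily.exists_abs_integral_semigroup_le (hU : IsMarkovFamily ℱ P U)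
    (huniq : ∀ μ : Measure S, IsProbabilityMeasure μ → (∀ t, P.map (U t) ∘ₘ μ = μ) → μ = π)
    (h : C(S, ℝ)) (hπ : ∫ y, h y ∂π = 0) {η : ℝ} (hη : 0 < η) :
    ∃ C, 0 ≤ C ∧ ∀ (a : ℝ≥0) (y : S),
      |∫ s in (0 : ℝ)..a, semigroup P U h s.toNNReal y| ≤ C + η * a := by
  by_contra! H
  choose a y H using fun n : ℕ => H n n.cast_nonneg
  have ha : ∀ n, 0 < (a n : ℝ) := fun n => by
    refine lt_of_le_of_ne (a n).coe_nonneg fun h0 => ?_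
    have h1 := H n
    rw [← h0] at h1
    simp only [intervalIntegral.integral_same, abs_zero, mul_zero, add_zero] at h1
    linarith [(n.cast_nonneg : (0 : ℝ) ≤ n)]
  -- The time integral is at most `‖h‖ a n` but exceeds `n`, so the horizons are forced to infinity.
  have han : ∀ n : ℕ, (n : ℝ) / (‖h‖ + 1) ≤ a n := fun n => by
    have h1 := abs_integral_semigroup_le (P := P) (U := U) h (y n) 0 (a n)
    rw [sub_zero, NNReal.abs_eq] at h1
    rw [div_le_iff₀ (by positivity)]
    have := H n
    have := ha n
    nlinarith
  have hainf : Tendsto (fun n => (a n : ℝ)) atTop atTop :=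
    tendsto_atTop_mono han (tendsto_natCast_atTop_atTop.atTop_div_const (by positivity))
  let R : ℕ → ProbabilityMeasure S := fun n =>
    ⟨occupation P U (a n) (y n), hU.isProbabilityMeasure_occupation _ _⟩
  obtain ⟨μ, -, hμ⟩ : ∃ μ ∈ univ, Tendsto R (hyperfilter ℕ) (𝓝 μ) :=
    isCompact_univ.ultrafilter_le_nhds' ((hyperfilter ℕ).map R) univ_mem
  have hlim : ∀ ψ : C(S, ℝ), Tendsto (fun n => ∫ z, ψ z ∂(occupation P U (a n) (y n)))
      (hyperfilter ℕ) (𝓝 (∫ z, ψ z ∂(μ : Measure S))) := fun ψ =>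
    ProbabilityMeasure.tendsto_iff_forall_integral_tendsto.1 hμ (BoundedContinuousFunction.mkOfCompact ψ)
  -- Krylov–Bogoliubov: the occupation laws are almost invariant, with error `2 ‖h‖ t / a n` on a
  -- test function `h`, and the Feller property lets this pass to the limit.
  have hinv : ∀ t, P.map (U t) ∘ₘ (μ : Measure S) = μ := fun t => by
    have := Kernel.IsMarkovKernel.map P (hU.measurable t)
    refine ext_of_forall_integral_eq_of_IsFiniteMeasure fun ψ => ?_
    rw [integral_comp_measure ψ.continuous.measurable ψ.norm_coe_le_norm]
    have h1 : ∀ z, ∫ y, ψ y ∂(P.map (U t) z) = semigroup P U ψ t z := fun z =>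
      hU.integral_map ψ.toContinuousMap t z
    simp only [h1]
    have h2 := hlim ψ.toContinuousMap
    have h3 := hlim ⟨_, hU.continuous_semigroup ψ.toContinuousMap t⟩
    have h4 : Tendsto (fun n => 2 * (‖ψ.toContinuousMap‖ * t) / a n) (hyperfilter ℕ) (𝓝 0) :=
      (tendsto_const_nhds.div_atTop hainf).mono_left Nat.hyperfilter_le_atTop
    refine sub_eq_zero.1 (tendsto_nhds_unique (h3.sub h2) (squeeze_zero_norm (fun n => ?_) h4))
    have h5 : ∀ x : ℝ, ‖x‖ * a n = |a n * x| := fun x => by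
      rw [abs_mul, NNReal.abs_eq, mul_comm, Real.norm_eq_abs]
    rw [le_div_iff₀ (ha n), h5, mul_sub, hU.mul_integral_occupation, hU.mul_integral_occupation]
    exact hU.abs_integral_semigroup_shift_sub_le ψ.toContinuousMap (y n) t (ha n).le
  have h1 := hlim h
  rw [huniq μ inferInstance hinv, hπ] at h1
  have h2 : ∀ n, η ≤ |∫ z, h z ∂(occupation P U (a n) (y n))| := fun n => by
    have h3 := (H n).le
    rw [← hU.mul_integral_occupation, abs_mul, NNReal.abs_eq] at h3
    refine le_of_mul_le_mul_left ?_ (ha n)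
    have : (0 : ℝ) ≤ n := n.cast_nonneg
    linarith
  have h3 := ge_of_tendsto' h1.abs h2
  rw [abs_zero] at h3
  linarith

lemma IsMarkovFamily.integral_law (hU : IsMarkovFamily ℱ P U) [IsProbabilityMeasure π]
    (hπ : ∀ t, P.map (U t) ∘ₘ π = π) (t : ℝ≥0) {h : S → ℝ} (hm : Measurable h) :
    ∫ ω, h (U t ω) ∂(P ∘ₘ π) = ∫ y, h y ∂π := by
  have h1 : (P ∘ₘ π).map (U t) = π := by rw [Measure.map_comp _ _ (hU.measurable t), hπ]
  rw [← MeasureTheory.integral_map (hU.measurable t).aemeasurable hm.aestronglyMeasurable, h1]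

lemma IsMarkovFamily.integral_mul_stationary (hU : IsMarkovFamily ℱ P U) [IsProbabilityMeasure π]
    (hπ : ∀ t, P.map (U t) ∘ₘ π = π) (h : C(S, ℝ)) (t s : ℝ≥0) :
    ∫ ω, h (U t ω) * h (U (t + s) ω) ∂(P ∘ₘ π) = ∫ y, h y * semigroup P U h s y ∂π := by
  have hc := hU.continuous_semigroup h s
  have hm : Measurable fun y => h y * semigroup P U h s y := (h.continuous.mul hc).measurable
  have hb1 : ∀ ω, |h (U t ω) * h (U (t + s) ω)| ≤ ‖h‖ * ‖h‖ := fun ω => by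
    rw [abs_mul]
    exact mul_le_mul (h.norm_coe_le_norm _) (h.norm_coe_le_norm _) (abs_nonneg _) (norm_nonneg _)
  have hb2 : ∀ ω, |h (U t ω) * semigroup P U h s (U t ω)| ≤ ‖h‖ * ‖h‖ := fun ω => by
    rw [abs_mul]
    exact mul_le_mul (h.norm_coe_le_norm _) (abs_semigroup_le h _ _) (abs_nonneg _) (norm_nonneg _)
  rw [← hU.integral_law hπ t hm, integral_comp_measure _ hb1,
    integral_comp_measure (h := fun ω => h (U t ω) * semigroup P U h s (U t ω))
      (hm.comp (hU.measurable t)) hb2]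
  · simp only [hU.integral_mul_add]
  · exact (h.continuous.measurable.comp (hU.measurable t)).mul
      (h.continuous.measurable.comp (hU.measurable (t + s)))

lemma integral_intervalIntegral_swap {X : Type*} [MeasurableSpace X] {μ : Measure X}
    [IsProbabilityMeasure μ] {F : ℝ → X → ℝ} (hF : Measurable (Function.uncurry F)) {D : ℝ}
    (hD : ∀ s x, |F s x| ≤ D) {a : ℝ} (ha : 0 ≤ a) :
    ∫ x, (∫ s in (0 : ℝ)..a, F s x) ∂μ = ∫ s in (0 : ℝ)..a, ∫ x, F s x ∂μ := by
  simp only [intervalIntegral.integral_of_le ha]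
  exact integral_integral_swap (integrable_of_measurable_of_bound (C := D)
    (h := fun q : X × ℝ => F q.2 q.1) (hF.comp measurable_swap) fun q => hD q.2 q.1)

lemma intervalIntegrable_integral {X : Type*} [MeasurableSpace X] {μ : Measure X}
    [IsProbabilityMeasure μ] {F : ℝ → X → ℝ} (hF : Measurable (Function.uncurry F)) {D : ℝ}
    (hD : ∀ s x, |F s x| ≤ D) (a b : ℝ) :
    IntervalIntegrable (fun s => ∫ x, F s x ∂μ) volume a b :=
  (intervalIntegrable_const (c := D)).mono_fun (StronglyMeasurable.integral_prod_right (ν := μ)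
    (f := F) hF.stronglyMeasurable).aestronglyMeasurable (ae_of_all _ fun s =>
      (abs_integral_le_of_bound (hD s)).trans (le_abs_self _))

lemma measurable_intervalIntegral {X : Type*} [MeasurableSpace X] {F : ℝ → X → ℝ}
    (hF : Measurable (Function.uncurry F)) {a : ℝ} (ha : 0 ≤ a) :
    Measurable fun x => ∫ s in (0 : ℝ)..a, F s x := by
  simp only [intervalIntegral.integral_of_le ha]
  exact (StronglyMeasurable.integral_prod_left (f := F) hF.stronglyMeasurable).measurable

lemma abs_intervalIntegral_le {F : ℝ → ℝ} {D : ℝ} (hD : ∀ s, |F s| ≤ D) {a : ℝ} (ha : 0 ≤ a) :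
    |∫ s in (0 : ℝ)..a, F s| ≤ a * D := by
  have h1 : |∫ s in (0 : ℝ)..a, F s| ≤ D * |a - 0| :=
    intervalIntegral.norm_integral_le_of_norm_le_const (f := F) fun s _ => hD s
  rwa [sub_zero, abs_of_nonneg ha, mul_comm] at h1

lemma IsMarkovFamily.measurable_uncurry_semigroup (hU : IsMarkovFamily ℱ P U) (h : C(S, ℝ)) :
    Measurable fun q : ℝ × S => semigroup P U h q.1.toNNReal q.2 :=
  (StronglyMeasurable.integral_kernel_prod_right (κ := P.comap Prod.snd measurable_snd)
    (f := fun (q : ℝ × S) ω => h (U q.1.toNNReal ω))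
    (h.continuous.measurable.comp (hU.measurable_uncurry_comp.comp
      (measurable_fst.fst.prodMk measurable_snd))).stronglyMeasurable).measurable

/-- The autocovariance of the stationary process. -/
noncomputable def autocov {S Ω : Type*} [MeasurableSpace S] [MeasurableSpace Ω]
    (P : Kernel S Ω) (U : ℝ≥0 → Ω → S) (π : Measure S) (h : S → ℝ) (s : ℝ) : ℝ :=
  ∫ y, h y * semigroup P U h s.toNNReal y ∂π

lemma abs_mul_semigroup_le (h : C(S, ℝ)) (t : ℝ≥0) (y : S) :
    |h y * semigroup P U h t y| ≤ ‖h‖ * ‖h‖ := by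
  rw [abs_mul]
  exact mul_le_mul (h.norm_coe_le_norm _) (abs_semigroup_le h _ _) (abs_nonneg _) (norm_nonneg _)

lemma IsMarkovFamily.measurable_mul_semigroup (hU : IsMarkovFamily ℱ P U) (h : C(S, ℝ)) :
    Measurable (Function.uncurry fun (s : ℝ) y => h y * semigroup P U h s.toNNReal y) :=
  (h.continuous.measurable.comp measurable_snd).mul (hU.measurable_uncurry_semigroup h)

lemma IsMarkovFamily.intervalIntegrable_autocov (hU : IsMarkovFamily ℱ P U)
    [IsProbabilityMeasure π] (h : C(S, ℝ)) (a b : ℝ) :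
    IntervalIntegrable (autocov P U π h) volume a b := by
  refine (intervalIntegrable_const (c := ‖h‖ * ‖h‖)).mono_fun
    (StronglyMeasurable.integral_prod_right (ν := π)
      (f := fun (s : ℝ) y => h y * semigroup P U h s.toNNReal y)
      (hU.measurable_mul_semigroup h).stronglyMeasurable).aestronglyMeasurable
    (ae_of_all _ fun t => ?_)
  rw [Real.norm_of_nonneg (by positivity : 0 ≤ ‖h‖ * ‖h‖)]
  exact abs_integral_le_of_bound fun y => abs_mul_semigroup_le h _ y

lemma IsMarkovFamily.integral_autocov_le (hU : IsMarkovFamily ℱ P U) [IsProbabilityMeasure π]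
    (h : C(S, ℝ)) {C η : ℝ}
    (hC : ∀ (a : ℝ≥0) (y : S), |∫ s in (0 : ℝ)..a, semigroup P U h s.toNNReal y| ≤ C + η * a)
    (a : ℝ≥0) : ∫ s in (0 : ℝ)..a, autocov P U π h s ≤ ‖h‖ * (C + η * a) := by
  unfold autocov
  rw [← integral_intervalIntegral_swap (hU.measurable_mul_semigroup h)
    (fun _ _ => abs_mul_semigroup_le h _ _) a.coe_nonneg]
  refine (le_abs_self _).trans (abs_integral_le_of_bound fun y => ?_)
  rw [intervalIntegral.integral_const_mul, abs_mul]
  exact mul_le_mul (h.norm_coe_le_norm _) (hC a y) (abs_nonneg _) (norm_nonneg _)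

lemma IsMarkovFamily.integral_mul_eq_autocov (hU : IsMarkovFamily ℱ P U) [IsProbabilityMeasure π]
    (hπ : ∀ t, P.map (U t) ∘ₘ π = π) (h : C(S, ℝ)) {s r : ℝ} (hs : 0 ≤ s) (hsr : s ≤ r) :
    ∫ ω, h (U s.toNNReal ω) * h (U r.toNNReal ω) ∂(P ∘ₘ π) = autocov P U π h (r - s) := by
  have h1 : r.toNNReal = s.toNNReal + (r - s).toNNReal := by
    rw [← Real.toNNReal_add hs (sub_nonneg.2 hsr), add_sub_cancel]
  rw [h1, hU.integral_mul_stationary hπ, autocov]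

/-- Expand the square and, for fixed `s`, split the inner integral at `s`. By stationarity the
pieces are autocovariances integrated over `[0, s]` and `[0, a - s]`, whose bounds add up to the
claimed one independently of `s`. -/
lemma IsMarkovFamily.integral_sq_le (hU : IsMarkovFamily ℱ P U) [IsProbabilityMeasure π]
    (hπ : ∀ t, P.map (U t) ∘ₘ π = π) (h : C(S, ℝ)) {C η : ℝ}
    (hC : ∀ (a : ℝ≥0) (y : S), |∫ s in (0 : ℝ)..a, semigroup P U h s.toNNReal y| ≤ C + η * a)
    (a : ℝ≥0) : ∫ ω, (∫ s in (0 : ℝ)..a, h (U s.toNNReal ω)) ^ 2 ∂(P ∘ₘ π) ≤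
      a * (‖h‖ * (2 * C + η * a)) := by
  have hm : Measurable (Function.uncurry fun (s : ℝ) ω => h (U s.toNNReal ω)) :=
    h.continuous.measurable.comp hU.measurable_uncurry_comp
  have hb : ∀ (s : ℝ) ω, |h (U s.toNNReal ω)| ≤ ‖h‖ := fun s ω => h.norm_coe_le_norm _
  have hX := measurable_intervalIntegral hm a.coe_nonneg
  have hXb : ∀ ω, |∫ s in (0 : ℝ)..a, h (U s.toNNReal ω)| ≤ a * ‖h‖ := fun ω =>
    abs_intervalIntegral_le (fun s => hb s ω) a.coe_nonneg
  have h1 : ∀ ω, (∫ s in (0 : ℝ)..a, h (U s.toNNReal ω)) ^ 2 =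
      ∫ s in (0 : ℝ)..a, h (U s.toNNReal ω) * ∫ r in (0 : ℝ)..a, h (U r.toNNReal ω) := fun ω => by
    rw [intervalIntegral.integral_mul_const, sq]
  have h2 : ∀ s ∈ Icc (0 : ℝ) a,
      ∫ ω, h (U s.toNNReal ω) * (∫ r in (0 : ℝ)..a, h (U r.toNNReal ω)) ∂(P ∘ₘ π) ≤
        ‖h‖ * (2 * C + η * a) := fun s hs => by
    have hi := hU.intervalIntegrable_autocov (π := π) h
    simp only [← intervalIntegral.integral_const_mul]
    have hm' : Measurable (Function.uncurry
        fun (r : ℝ) ω => h (U s.toNNReal ω) * h (U r.toNNReal ω)) :=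
      (h.continuous.measurable.comp ((hU.measurable _).comp measurable_snd)).mul hm
    have hb' : ∀ (r : ℝ) ω, |h (U s.toNNReal ω) * h (U r.toNNReal ω)| ≤ ‖h‖ * ‖h‖ := fun r ω => by
      rw [abs_mul]
      exact mul_le_mul (hb _ _) (hb _ _) (abs_nonneg _) (norm_nonneg _)
    rw [integral_intervalIntegral_swap hm' hb' a.coe_nonneg]
    have hint : ∀ b c : ℝ, IntervalIntegrable
        (fun r : ℝ => ∫ ω, h (U s.toNNReal ω) * h (U r.toNNReal ω) ∂(P ∘ₘ π)) volume b c :=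
      intervalIntegrable_integral hm' hb'
    rw [← intervalIntegral.integral_add_adjacent_intervals (hint 0 s) (hint s a)]
    have e1 : ∫ r in (0 : ℝ)..s, ∫ ω, h (U s.toNNReal ω) * h (U r.toNNReal ω) ∂(P ∘ₘ π) =
        ∫ r in (0 : ℝ)..s, autocov P U π h r := by
      have e := intervalIntegral.integral_comp_sub_left (a := 0) (b := s) (autocov P U π h) s
      rw [sub_self, sub_zero] at e
      rw [← e]
      refine intervalIntegral.integral_congr fun r hr => ?_
      rw [uIcc_of_le hs.1] at hr
      rw [← hU.integral_mul_eq_autocov hπ h hr.1 hr.2]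
      simp only [mul_comm]
    have e2 : ∫ r in s..a, ∫ ω, h (U s.toNNReal ω) * h (U r.toNNReal ω) ∂(P ∘ₘ π) =
        ∫ r in (0 : ℝ)..(a - s), autocov P U π h r := by
      have e := intervalIntegral.integral_comp_sub_right (a := s) (b := a) (autocov P U π h) s
      rw [sub_self] at e
      rw [← e]
      refine intervalIntegral.integral_congr fun r hr => ?_
      rw [uIcc_of_le hs.2] at hr
      exact hU.integral_mul_eq_autocov hπ h hs.1 hr.1
    have e3 := hU.integral_autocov_le (π := π) h hC s.toNNReal
    have e4 := hU.integral_autocov_le (π := π) h hC (a - s).toNNReal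
    rw [Real.coe_toNNReal _ hs.1] at e3
    rw [Real.coe_toNNReal _ (sub_nonneg.2 hs.2)] at e4
    rw [e1, e2]
    calc _ ≤ _ := add_le_add e3 e4
      _ = _ := by ring
  have hm2 : Measurable (Function.uncurry fun (s : ℝ) ω =>
      h (U s.toNNReal ω) * ∫ r in (0 : ℝ)..a, h (U r.toNNReal ω)) :=
    hm.mul (hX.comp measurable_snd)
  have hb2 : ∀ (s : ℝ) ω, |h (U s.toNNReal ω) * ∫ r in (0 : ℝ)..a, h (U r.toNNReal ω)| ≤
      ‖h‖ * (a * ‖h‖) := fun s ω => by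
    rw [abs_mul]
    exact mul_le_mul (hb _ _) (hXb ω) (abs_nonneg _) (norm_nonneg _)
  simp only [h1]
  rw [integral_intervalIntegral_swap hm2 hb2 a.coe_nonneg]
  refine (intervalIntegral.integral_mono_on a.coe_nonneg (intervalIntegrable_integral hm2 hb2 _ _)
    intervalIntegrable_const h2).trans_eq ?_
  rw [intervalIntegral.integral_const, sub_zero, smul_eq_mul]

end Ergodic

/-! ### Averaging: the flow started at a point of zero mean drift. -/

section Averaging

variable {E S Ω : Type*} [NormedAddCommGroup E] [InnerProductSpace ℝ E] [CompleteSpace E]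
  [SecondCountableTopology E] [MeasurableSpace E] [BorelSpace E]
  [TopologicalSpace S] [PolishSpace S] [CompactSpace S] [MeasurableSpace S] [BorelSpace S]
  {mΩ : MeasurableSpace Ω} {ℱ : Filtration ℝ≥0 mΩ} {P : Kernel S Ω} [IsMarkovKernel P]
  {U : ℝ≥0 → Ω → S} {π : Measure S} {g : E → S → E} {L : ℝ≥0} {κ B : ℝ}

lemma intervalIntegrable_comp_of_rightContinuous {w : ℝ≥0 → S}
    (hw : ∀ t, ContinuousWithinAt w (Ici t) t) (G : C(S, E)) (a b : ℝ) :
    IntervalIntegrable (fun s : ℝ => G (w s.toNNReal)) volume a b :=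
  (intervalIntegrable_const (c := ‖G‖)).mono_fun (G.continuous.measurable.comp
    ((measurable_of_rightContinuous hw).comp measurable_real_toNNReal)).aestronglyMeasurable
    (ae_of_all _ fun s => by simpa using G.norm_coe_le_norm _)

/-- Mean square law of large numbers, with a rate that is uniform up to a small slope. -/
lemma IsMarkovFamily.exists_integral_norm_sq_le [FiniteDimensional ℝ E]
    (hU : IsMarkovFamily ℱ P U) [IsProbabilityMeasure π] (hπ : ∀ t, P.map (U t) ∘ₘ π = π)
    (huniq : ∀ μ : Measure S, IsProbabilityMeasure μ → (∀ t, P.map (U t) ∘ₘ μ = μ) → μ = π)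
    (G : C(S, E)) (hG : ∫ y, G y ∂π = 0) {η : ℝ} (hη : 0 < η) :
    ∃ C, 0 ≤ C ∧ ∀ a : ℝ≥0,
      ∫ ω, ‖∫ s in (0 : ℝ)..a, G (U s.toNNReal ω)‖ ^ 2 ∂(P ∘ₘ π) ≤ a * (C + η * a) := by
  set b := stdOrthonormalBasis ℝ E
  set n := Module.finrank ℝ E
  let h : Fin n → C(S, ℝ) := fun i => ⟨fun y => inner ℝ (b i) (G y), by fun_prop⟩
  have hh : ∀ i, ∫ y, h i y ∂π = 0 := fun i => by
    have hGi : Integrable G π := Integrable.of_bound G.continuous.measurable.aestronglyMeasurable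
      ‖G‖ (ae_of_all _ G.norm_coe_le_norm)
    have := integral_inner (𝕜 := ℝ) hGi (b i)
    rw [hG, inner_zero_right] at this
    exact this
  -- The slope is shared among the coordinates and divided by the factor `‖h i‖` that the second
  -- moment bound brings in; the `+ 1`s cover dimension zero and vanishing coordinates.
  have hη' : ∀ i, 0 < η / ((n + 1) * (‖h i‖ + 1)) := fun i => by positivity
  choose C hC0 hC using fun i => hU.exists_abs_integral_semigroup_le huniq (h i) (hh i) (hη' i)
  refine ⟨∑ i, ‖h i‖ * (2 * C i), Finset.sum_nonneg fun i _ => by have := hC0 i; positivity,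
    fun a => ?_⟩
  have h1 : ∀ ω, ‖∫ s in (0 : ℝ)..a, G (U s.toNNReal ω)‖ ^ 2 =
      ∑ i, (∫ s in (0 : ℝ)..a, h i (U s.toNNReal ω)) ^ 2 := fun ω => by
    rw [← b.sum_sq_norm_inner_right]
    refine Finset.sum_congr rfl fun i _ => ?_
    have := (innerSL ℝ (b i)).intervalIntegral_comp_comm
      (intervalIntegrable_comp_of_rightContinuous (hU.rightCont ω) G 0 a)
    simp only [innerSL_apply_apply] at this
    rw [← this, Real.norm_eq_abs, sq_abs]
    rfl
  have hm : ∀ i, Measurable (Function.uncurry fun (s : ℝ) ω => h i (U s.toNNReal ω)) := fun i =>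
    (h i).continuous.measurable.comp hU.measurable_uncurry_comp
  have hint : ∀ i, Integrable (fun ω => (∫ s in (0 : ℝ)..a, h i (U s.toNNReal ω)) ^ 2) (P ∘ₘ π) :=
    fun i => integrable_of_measurable_of_bound (C := (a * ‖h i‖) ^ 2)
      ((measurable_intervalIntegral (hm i) a.coe_nonneg).pow_const 2) fun ω => by
        rw [abs_pow]
        gcongr
        exact abs_intervalIntegral_le (F := fun s : ℝ => h i (U s.toNNReal ω))
          (fun s => (h i).norm_coe_le_norm _) a.coe_nonneg
  simp only [h1]
  rw [integral_finsetSum _ fun i _ => hint i]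
  have h2 : ∀ i, ∫ ω, (∫ s in (0 : ℝ)..a, h i (U s.toNNReal ω)) ^ 2 ∂(P ∘ₘ π) ≤
      a * (‖h i‖ * (2 * C i) + η / (n + 1) * a) := fun i => by
    refine (hU.integral_sq_le hπ (h i) (hC i) a).trans ?_
    have h3 : ‖h i‖ * (η / ((n + 1) * (‖h i‖ + 1))) ≤ η / (n + 1) := by
      rw [mul_div_assoc', div_le_div_iff₀ (by positivity) (by positivity)]
      have : 0 ≤ η * (n + 1) := by positivity
      nlinarith
    have h4 : ‖h i‖ * (η / ((n + 1) * (‖h i‖ + 1))) * a ≤ η / (n + 1) * a := by gcongr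
    gcongr
    linarith
  refine (Finset.sum_le_sum fun i _ => h2 i).trans ?_
  rw [← Finset.mul_sum, Finset.sum_add_distrib, Finset.sum_const, Finset.card_univ, Fintype.card_fin,
    nsmul_eq_mul, ← mul_assoc]
  gcongr
  rw [mul_div_assoc', div_le_iff₀ (by positivity)]
  nlinarith

lemma min_one_le_add_sq_div {x γ : ℝ} (hγ : 0 < γ) : min 1 x ≤ γ + x ^ 2 / γ := by
  refine (min_le_right _ _).trans ?_
  have h1 : γ + x ^ 2 / γ - x = ((x - γ / 2) ^ 2 + 3 / 4 * γ ^ 2) / γ := by field_simp; ring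
  have h2 : 0 ≤ ((x - γ / 2) ^ 2 + 3 / 4 * γ ^ 2) / γ := by positivity
  linarith

/-- The squared norm of the accumulated noise up to time `t`. -/
noncomputable def noise {E S Ω : Type*} [NormedAddCommGroup E] [NormedSpace ℝ E]
    [TopologicalSpace S] (G : C(S, E)) (U : ℝ≥0 → Ω → S) (t : ℝ≥0) (ω : Ω) : ℝ :=
  ‖∫ s in (0 : ℝ)..t, G (U s.toNNReal ω)‖ ^ 2

lemma IsMarkovFamily.measurable_noise (hU : IsMarkovFamily ℱ P U) (G : C(S, E)) :
    Measurable (Function.uncurry (noise G U)) := by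
  refine measurable_uncurry_of_rightContinuous (fun t => ?_) fun ω t => ?_
  · have hm : Measurable (Function.uncurry fun (s : ℝ) ω => G (U s.toNNReal ω)) :=
      G.continuous.measurable.comp hU.measurable_uncurry_comp
    unfold noise
    simp only [intervalIntegral.integral_of_le t.coe_nonneg]
    exact (StronglyMeasurable.integral_prod_left (f := fun (s : ℝ) ω => G (U s.toNNReal ω))
      hm.stronglyMeasurable).measurable.norm.pow_const 2
  · have hi := intervalIntegrable_comp_of_rightContinuous (hU.rightCont ω) G
    exact (((intervalIntegral.continuous_primitive hi 0).comp NNReal.continuous_coe).norm.pow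
      2).continuousWithinAt

lemma abs_noise_le (G : C(S, E)) (t : ℝ≥0) (ω : Ω) : |noise G U t ω| ≤ (‖G‖ * t) ^ 2 := by
  rw [noise, abs_pow, abs_norm]
  have h1 := intervalIntegral.norm_integral_le_of_norm_le_const (a := (0 : ℝ)) (b := t)
    (f := fun s : ℝ => G (U s.toNNReal ω)) fun s _ => G.norm_coe_le_norm _
  rw [sub_zero, NNReal.abs_eq] at h1
  gcongr

lemma noise_timeChange (G : C(S, E)) {ε : ℝ≥0} (hε : 0 < ε) (t : ℝ≥0) (ω : Ω) :
    noise G (fun r => U (r / ε)) t ω = ε ^ 2 * noise G U (t / ε) ω := by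
  have hε' : (ε : ℝ) ≠ 0 := by positivity
  have h1 := intervalIntegral.integral_comp_div (a := 0) (b := t)
    (fun s : ℝ => G (U s.toNNReal ω)) hε'
  rw [zero_div] at h1
  have h2 : ∫ s in (0 : ℝ)..t, G (U (s.toNNReal / ε) ω) =
      ∫ s in (0 : ℝ)..t, G (U (s / ε).toNNReal ω) := by
    refine intervalIntegral.integral_congr fun s hs => ?_
    rw [uIcc_of_le t.coe_nonneg] at hs
    simp only [Real.toNNReal_div hs.1, Real.toNNReal_coe]
  rw [noise, noise, h2, h1, norm_smul, mul_pow, NNReal.norm_eq, NNReal.coe_div]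

/-- Speeding up by `1 / ε` turns the horizon `t` into `t / ε` and multiplies the squared integral by
`ε²`, so the constant term carries a factor `ε` and only the slope `η` remains as `ε → 0`. -/
lemma integral_noise_timeChange_le
    {G : C(S, E)} {C η : ℝ} (hC0 : 0 ≤ C) (hη : 0 ≤ η)
    (hC : ∀ a : ℝ≥0, ∫ ω, noise G U a ω ∂(P ∘ₘ π) ≤ a * (C + η * a)) {ε : ℝ≥0} (hε : 0 < ε)
    {t T : ℝ≥0} (ht : t ≤ T) :
    ∫ ω, noise G (fun r => U (r / ε)) t ω ∂(P ∘ₘ π) ≤ T * (ε * C + η * T) := by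
  simp only [noise_timeChange G hε]
  rw [integral_const_mul]
  have ht' : (t : ℝ) ≤ T := ht
  calc (ε : ℝ) ^ 2 * ∫ ω, noise G U (t / ε) ω ∂(P ∘ₘ π)
      ≤ ε ^ 2 * ((t / ε : ℝ≥0) * (C + η * (t / ε : ℝ≥0))) := by gcongr; exact hC _
    _ = t * (ε * C + η * t) := by push_cast; field_simp
    _ ≤ _ := by gcongr

lemma IsMarkovFamily.integral_min_flow_le (hU : IsMarkovFamily ℱ P U)
    [IsProbabilityMeasure π] (hg : IsMonotoneDrift g L κ B) {m : E} {G : C(S, E)}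
    (hG : ∀ y, G y = g m y) {T : ℝ≥0} {D : ℝ}
    (hD : ∀ t ≤ T, ∫ ω, noise G U t ω ∂(P ∘ₘ π) ≤ D) {γ : ℝ} (hγ : 0 < γ) :
    ∫ ω, min 1 ‖flow g (fun r => U r ω) m T - m‖ ∂(P ∘ₘ π) ≤
      γ + (2 + (L : ℝ) ^ 2 / κ * T) * D / γ := by
  have hκ := hg.pos
  -- Truncating time at `T` gives a bound valid for all `s`, as the integral swap lemmas require,
  -- without changing the values on `[0, T]`.
  let N : ℝ → Ω → ℝ := fun s ω => noise G U (min s.toNNReal T) ω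
  have hN : Measurable (Function.uncurry N) := (hU.measurable_noise G).comp
    (f := fun q : ℝ × Ω => (min q.1.toNNReal T, q.2))
    (((measurable_real_toNNReal.comp measurable_fst).min measurable_const).prodMk measurable_snd)
  have hNb : ∀ s ω, |N s ω| ≤ (‖G‖ * T) ^ 2 := fun s ω => by
    refine (abs_noise_le G _ ω).trans ?_
    gcongr
    exact min_le_right _ _
  have hNi := measurable_intervalIntegral hN T.coe_nonneg
  have hNib : ∀ ω, |∫ s in (0 : ℝ)..T, N s ω| ≤ T * (‖G‖ * T) ^ 2 := fun ω =>
    abs_intervalIntegral_le (fun s => hNb s ω) T.coe_nonneg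
  have hi1 : Integrable (fun ω => noise G U T ω) (P ∘ₘ π) := integrable_of_measurable_of_bound
    ((hU.measurable_noise G).comp measurable_prodMk_left) fun ω => abs_noise_le G T ω
  have hi2 := integrable_of_measurable_of_bound (μ := P ∘ₘ π) hNi hNib
  have hi3 : Integrable (fun ω => 2 * noise G U T ω +
      (L : ℝ) ^ 2 / κ * ∫ s in (0 : ℝ)..T, N s ω) (P ∘ₘ π) :=
    (hi1.const_mul 2).add (hi2.const_mul _)
  have hpt : ∀ ω, min 1 ‖flow g (fun r => U r ω) m T - m‖ ≤ γ + (2 * noise G U T ω +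
      (L : ℝ) ^ 2 / κ * ∫ s in (0 : ℝ)..T, N s ω) / γ := fun ω => by
    have h1 := hg.norm_flow_sub_sq_le (hU.rightCont ω) (hg.isFlowPath_flow (hU.rightCont ω) m) T
    have h2 : ∫ s in (0 : ℝ)..T, N s ω =
        ∫ s in (0 : ℝ)..T, ‖∫ r in (0 : ℝ)..s, g m (U r.toNNReal ω)‖ ^ 2 := by
      refine intervalIntegral.integral_congr fun s hs => ?_
      rw [uIcc_of_le T.coe_nonneg] at hs
      have h3 : s.toNNReal ≤ T := Real.toNNReal_le_iff_le_coe.2 hs.2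
      simp only [N, min_eq_left h3, noise, Real.coe_toNNReal s hs.1, hG]
    rw [h2]
    simp only [noise, hG]
    refine (min_one_le_add_sq_div hγ).trans ?_
    gcongr
  have hm : Measurable fun ω => min 1 ‖flow g (fun r => U r ω) m T - m‖ :=
    measurable_const.min (((hU.measurable_coupled_path hg T m).fst.sub measurable_const).norm)
  have hi0 : Integrable (fun ω => min 1 ‖flow g (fun r => U r ω) m T - m‖) (P ∘ₘ π) :=
    integrable_of_measurable_of_bound hm (C := 1) fun ω => by
      rw [abs_of_nonneg (le_min zero_le_one (norm_nonneg _))]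
      exact min_le_left _ _
  refine (integral_mono hi0 ((integrable_const γ).add (hi3.div_const γ)) hpt).trans ?_
  simp only [Pi.add_apply]
  rw [integral_add (integrable_const γ) (hi3.div_const γ), integral_const, probReal_univ, one_smul,
    integral_div, integral_add (hi1.const_mul 2) (hi2.const_mul _), integral_const_mul,
    integral_const_mul, integral_intervalIntegral_swap hN hNb T.coe_nonneg]
  have h4 : ∫ s in (0 : ℝ)..T, ∫ ω, N s ω ∂(P ∘ₘ π) ≤ T * D := by
    refine (intervalIntegral.integral_mono_on T.coe_nonneg (intervalIntegrable_integral hN hNb _ _)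
      intervalIntegrable_const (fun s _ => hD _ (min_le_right _ _))).trans_eq ?_
    rw [intervalIntegral.integral_const, sub_zero, smul_eq_mul]
  have h5 := hD T le_rfl
  have h6 : (2 + (L : ℝ) ^ 2 / κ * T) * D = 2 * D + (L : ℝ) ^ 2 / κ * (T * D) := by ring
  rw [h6]
  gcongr

end Averaging

/-! ### The minimizer of the full target and the distance to a Dirac mass. -/

section Target

variable {K : ℕ} {S : Type*} [TopologicalSpace S] [PolishSpace S] [CompactSpace S]
  [MeasurableSpace S] [BorelSpace S] {π : Measure S} {f : EuclideanSpace ℝ (Fin K) → S → ℝ}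

lemma TargetAssumption.exists_isMonotoneDrift (hf : TargetAssumption π f)
    (hconv : StrongConvexity f) : ∃ L κ B, IsMonotoneDrift (gradθ f) L κ B := by
  obtain ⟨L, hL⟩ := hf.lipschitz
  obtain ⟨κ, hκ, hmono⟩ := hconv
  have hc : Continuous fun y => gradθ f 0 y := 
    hf.continuous_grad.comp (f := fun y => ((0 : EuclideanSpace ℝ (Fin K)), y))
      (continuous_const.prodMk continuous_id)
  obtain ⟨B, hB⟩ := isCompact_univ.exists_bound_of_continuousOn hc.continuousOn
  exact ⟨L, κ, B, hf.continuous_grad, hL, fun y => hB y (mem_univ y), hκ, hmono⟩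

lemma TargetAssumption.hasDerivAt_line (hf : TargetAssumption π f)
    (x d : EuclideanSpace ℝ (Fin K)) (y : S) (t : ℝ) :
    HasDerivAt (fun t : ℝ => f (x + t • d) y) (inner ℝ (gradθ f (x + t • d) y) d) t := by
  have h1 : HasGradientAt (fun x => f x y) (gradθ f (x + t • d) y) (x + t • d) :=
    ((hf.contDiff y).differentiable (by norm_num) _).hasGradientAt
  have h2 : HasDerivAt (fun t : ℝ => x + t • d) d t := by
    simpa using ((hasDerivAt_id t).smul_const d).const_add x
  exact h1.hasFDerivAt.comp_hasDerivAt t h2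

/-- Along the segment from `x` to `x + d`, monotonicity says that `f` grows at least as fast as the
quadratic with the same value and slope at `x`. -/
lemma TargetAssumption.le_apply_add (hf : TargetAssumption π f) {L : ℝ≥0} {κ B : ℝ}
    (hg : IsMonotoneDrift (gradθ f) L κ B) (x d : EuclideanSpace ℝ (Fin K)) (y : S) :
    f x y + inner ℝ (gradθ f x y) d + κ / 2 * ‖d‖ ^ 2 ≤ f (x + d) y := by
  have h := image_le_of_deriv_right_le_deriv_boundary (a := 0) (b := 1)
    (f := fun t : ℝ => f x y + t * inner ℝ (gradθ f x y) d + κ / 2 * ‖d‖ ^ 2 * t ^ 2)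
    (f' := fun t : ℝ => inner ℝ (gradθ f x y) d + κ * ‖d‖ ^ 2 * t)
    (B := fun t : ℝ => f (x + t • d) y)
    (B' := fun t : ℝ => inner ℝ (gradθ f (x + t • d) y) d)
    (by fun_prop)
    (fun t _ => by
      have h1 := (((hasDerivAt_id t).mul_const (inner ℝ (gradθ f x y) d)).const_add (f x y)).add
        (((hasDerivAt_id t).pow 2).const_mul (κ / 2 * ‖d‖ ^ 2))
      refine (h1.congr_deriv ?_).hasDerivWithinAt
      simp
      ring)
    (by simp)
    (fun t _ => (hf.hasDerivAt_line x d y t).continuousAt.continuousWithinAt)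
    (fun t _ => (hf.hasDerivAt_line x d y t).hasDerivWithinAt)
    (fun t ht => by
      rcases ht.1.eq_or_lt with rfl | ht0
      · simp
      · have h1 := hg.mono y (x + t • d) x
        rw [add_sub_cancel_left, norm_smul, Real.norm_of_nonneg ht0.le, real_inner_smul_left,
          inner_sub_right, real_inner_comm (gradθ f (x + t • d) y), real_inner_comm (gradθ f x y)]
          at h1
        refine le_of_mul_le_mul_left ?_ ht0
        nlinarith) (x := 1) ⟨zero_le_one, le_rfl⟩
  simpa using h

lemma TargetAssumption.integral_add_le (hf : TargetAssumption π f) [IsProbabilityMeasure π]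
    {L : ℝ≥0} {κ B : ℝ} (hg : IsMonotoneDrift (gradθ f) L κ B) {x : EuclideanSpace ℝ (Fin K)}
    (hx : ∫ y, gradθ f x y ∂π = 0) (x' : EuclideanSpace ℝ (Fin K)) :
    fullTarget π f x + κ / 2 * ‖x' - x‖ ^ 2 ≤ fullTarget π f x' := by
  have hi : Integrable (fun y => inner ℝ (gradθ f x y) (x' - x)) π :=
    (hf.integrable_grad x).inner_const _
  have h1 : ∫ y, inner ℝ (gradθ f x y) (x' - x) ∂π = 0 := by
    have := integral_inner (𝕜 := ℝ) (hf.integrable_grad x) (x' - x)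
    rw [hx, inner_zero_right] at this
    rw [← this]
    exact integral_congr_ae (ae_of_all _ fun y => real_inner_comm _ _)
  have h2 : ∫ y, (f x y + inner ℝ (gradθ f x y) (x' - x) + κ / 2 * ‖x' - x‖ ^ 2) ∂π ≤
      ∫ y, f x' y ∂π :=
    integral_mono (((hf.integrable x).add hi).add (integrable_const _)) (hf.integrable x') fun y => by
      simpa using hf.le_apply_add hg x (x' - x) y
  have hi2 : Integrable (fun y => f x y + inner ℝ (gradθ f x y) (x' - x)) π :=
    (hf.integrable x).add hi
  rw [integral_add hi2 (integrable_const _),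
    integral_add (hf.integrable x) hi, h1, integral_const, probReal_univ, one_smul, add_zero] at h2
  exact h2

/-- The averaged gradient `G` inherits the Lipschitz and monotonicity bounds, so gradient descent
with a small step is a contraction and its fixed point is a zero of `G`. -/
lemma TargetAssumption.exists_integral_grad_eq_zero (hf : TargetAssumption π f)
    [IsProbabilityMeasure π] {L : ℝ≥0} {κ B : ℝ} (hg : IsMonotoneDrift (gradθ f) L κ B) :
    ∃ x, ∫ y, gradθ f x y ∂π = 0 := by
  have hκ := hg.pos
  set G : EuclideanSpace ℝ (Fin K) → EuclideanSpace ℝ (Fin K) := fun x => ∫ y, gradθ f x y ∂π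
    with hG
  have hsub : ∀ x x', G x - G x' = ∫ y, (gradθ f x y - gradθ f x' y) ∂π := fun x x' =>
    (integral_sub (hf.integrable_grad x) (hf.integrable_grad x')).symm
  have hlip : ∀ x x', ‖G x - G x'‖ ≤ (L + κ) * ‖x - x'‖ := fun x x' => by
    rw [hsub]
    have h1 := norm_integral_le_of_norm_le_const (μ := π) (ae_of_all _ fun y =>
      hg.norm_apply_sub_le x x' y)
    rw [probReal_univ, mul_one] at h1
    refine h1.trans ?_
    gcongr
    linarith
  have hmono : ∀ x x', κ * ‖x - x'‖ ^ 2 ≤ inner ℝ (x - x') (G x - G x') := fun x x' => by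
    have hi : Integrable (fun y => gradθ f x y - gradθ f x' y) π :=
      (hf.integrable_grad x).sub (hf.integrable_grad x')
    rw [hsub, ← integral_inner (𝕜 := ℝ) hi]
    have h1 := integral_mono (μ := π) (integrable_const (κ * ‖x - x'‖ ^ 2)) (hi.const_inner (x - x'))
      fun y => hg.mono y x x'
    simpa using h1
  -- A Lipschitz constant of `G` that is positive and at least `κ`. The step `κ / A²` minimizes `1 -
  -- 2 τ κ + τ² A²` over `τ`, with minimum `q`, and `κ ≤ A` keeps `q` nonnegative.
  set A : ℝ := L + κ with hA
  have hA0 : 0 < A := by positivity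
  have hκA : κ ≤ A := by rw [hA]; exact le_add_of_nonneg_left L.coe_nonneg
  set q : ℝ := 1 - κ ^ 2 / A ^ 2 with hq
  have hq0 : 0 ≤ q := by
    rw [hq, sub_nonneg, div_le_one (by positivity)]
    gcongr
  have hq1 : q < 1 := by rw [hq]; exact sub_lt_self _ (by positivity)
  let T : EuclideanSpace ℝ (Fin K) → EuclideanSpace ℝ (Fin K) := fun x => x - (κ / A ^ 2) • G x
  have hT : ContractingWith (Real.sqrt q).toNNReal T := by
    refine ⟨?_, LipschitzWith.of_dist_le_mul fun x x' => ?_⟩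
    · rw [Real.toNNReal_lt_one, Real.sqrt_lt' one_pos]
      simpa using hq1
    · rw [dist_eq_norm, dist_eq_norm, Real.coe_toNNReal _ (Real.sqrt_nonneg _)]
      refine le_of_sq_le_sq ?_ (by positivity)
      have h1 : T x - T x' = (x - x') - (κ / A ^ 2) • (G x - G x') := by
        simp only [T, smul_sub]; abel
      have h2 := hlip x x'
      have h3 : ‖G x - G x'‖ ^ 2 ≤ (A * ‖x - x'‖) ^ 2 := by gcongr
      have h4 : (κ / A ^ 2) ^ 2 * ‖G x - G x'‖ ^ 2 ≤ (κ / A ^ 2) ^ 2 * (A * ‖x - x'‖) ^ 2 := by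
        gcongr
      have h5 : 2 * (κ / A ^ 2) * (κ * ‖x - x'‖ ^ 2) ≤
          2 * (κ / A ^ 2) * inner ℝ (x - x') (G x - G x') := by
        gcongr
        exact hmono x x'
      rw [h1, norm_sub_sq_real, mul_pow, Real.sq_sqrt hq0, norm_smul, mul_pow,
        real_inner_smul_right, Real.norm_of_nonneg (by positivity : 0 ≤ κ / A ^ 2)]
      have h6 : q * ‖x - x'‖ ^ 2 = ‖x - x'‖ ^ 2 - 2 * (κ / A ^ 2) * (κ * ‖x - x'‖ ^ 2) +
          (κ / A ^ 2) ^ 2 * (A * ‖x - x'‖) ^ 2 := by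
        rw [hq]; field_simp; ring
      linarith
  refine ⟨hT.fixedPoint, ?_⟩
  have h1 : T hT.fixedPoint = hT.fixedPoint := hT.fixedPoint_isFixedPt
  have h2 : (κ / A ^ 2) • G hT.fixedPoint = 0 := sub_eq_self.1 h1
  exact (smul_eq_zero.1 h2).resolve_left (by positivity)

lemma TargetAssumption.isUniqueMinimizer (hf : TargetAssumption π f) [IsProbabilityMeasure π]
    {L : ℝ≥0} {κ B : ℝ} (hg : IsMonotoneDrift (gradθ f) L κ B) {x : EuclideanSpace ℝ (Fin K)}
    (hx : ∫ y, gradθ f x y ∂π = 0) : IsUniqueMinimizer (fullTarget π f) x := by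
  have hκ := hg.pos
  refine ⟨fun x' => ?_, fun x' hx' => ?_⟩
  · have h1 := hf.integral_add_le hg hx x'
    have : 0 ≤ κ / 2 * ‖x' - x‖ ^ 2 := by positivity
    linarith
  · have h1 := hf.integral_add_le hg hx x'
    have h2 := hx' x
    by_contra h
    have : 0 < ‖x' - x‖ := norm_pos_iff.2 (sub_ne_zero.2 h)
    have : 0 < κ / 2 * ‖x' - x‖ ^ 2 := by positivity
    linarith

/-- Pairing every point with `x` is a coupling. -/
lemma wassersteinD_dirac_le (ν : Measure (EuclideanSpace ℝ (Fin K))) [IsProbabilityMeasure ν]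
    (x : EuclideanSpace ℝ (Fin K)) :
    wassersteinD ν (Measure.dirac x) ≤ ENNReal.ofReal (∫ z, min 1 ‖z - x‖ ∂ν) := by
  have hm : Measurable fun z : EuclideanSpace ℝ (Fin K) => (z, x) :=
    measurable_id.prodMk measurable_const
  have hmin : Measurable fun z : EuclideanSpace ℝ (Fin K) => min 1 ‖z - x‖ :=
    measurable_const.min (measurable_id.sub measurable_const).norm
  have hp : Measurable fun p : EuclideanSpace ℝ (Fin K) × EuclideanSpace ℝ (Fin K) =>
      ENNReal.ofReal (min 1 ‖p.1 - p.2‖) :=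
    (measurable_const.min (measurable_fst.sub measurable_snd).norm).ennreal_ofReal
  refine (iInf₂_le (ν.map fun z => (z, x)) ⟨?_, ?_⟩).trans_eq ?_
  · rw [lintegral_map hp hm, ofReal_integral_eq_lintegral_ofReal]
    · exact integrable_of_measurable_of_bound hmin (C := 1) fun z => by
        rw [abs_of_nonneg (le_min zero_le_one (norm_nonneg _))]
        exact min_le_left _ _
    · exact ae_of_all _ fun z => le_min zero_le_one (norm_nonneg _)
  · rw [Measure.map_map measurable_fst hm]
    exact Measure.map_id
  · rw [Measure.map_map measurable_snd hm]
    have : (Prod.snd ∘ fun z : EuclideanSpace ℝ (Fin K) => (z, x)) = fun _ => x := rfl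
    rw [this, Measure.map_const, measure_univ, one_smul]

end Target

/-! ### Concentration of the stationary law as `ε → 0`. -/

section Coupled

variable {K : ℕ} {S Ω : Type*} [TopologicalSpace S] [PolishSpace S] [CompactSpace S]
  [MeasurableSpace S] [BorelSpace S] {mΩ : MeasurableSpace Ω} {ℱ : Filtration ℝ≥0 mΩ}
  {P : Kernel S Ω} [IsMarkovKernel P] {V : ℝ≥0 → Ω → S}
  {π : Measure S} {f : EuclideanSpace ℝ (Fin K) → S → ℝ} {L : ℝ≥0} {κ B : ℝ}

/-- `sgpcPath` along `v` unfolds to `flow` along `v (· / ε)`: both choose from the same predicate.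
-/
lemma IsFellerProcess.coupledLaw_eq (hV : IsFellerProcess ℱ P V)
    (hg : IsMonotoneDrift (gradθ f) L κ B) (ε t : ℝ≥0) (p : EuclideanSpace ℝ (Fin K) × S) :
    coupledLaw P V f ε t p.1 p.2 = coupledKernel P (fun r => V (r / ε)) (gradθ f) t p :=
  ((hV.isMarkovFamily_timeChange ε).coupledKernel_apply hg t p).symm

lemma IsFellerProcess.isStationary_iff (hV : IsFellerProcess ℱ P V)
    (hg : IsMonotoneDrift (gradθ f) L κ B) (ε : ℝ≥0)
    (Q : Measure (EuclideanSpace ℝ (Fin K) × S)) :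
    IsStationary P V f ε Q ↔ IsProbabilityMeasure Q ∧
      ∀ t, coupledKernel P (fun r => V (r / ε)) (gradθ f) t ∘ₘ Q = Q := by
  refine and_congr_right fun _ => forall_congr' fun t => ?_
  simp only [hV.coupledLaw_eq hg]
  refine ⟨fun h => Measure.ext fun B hB => ?_, fun h B hB => ?_⟩
  · rw [Measure.bind_apply hB (Kernel.aemeasurable _), h B hB]
  · rw [← Measure.bind_apply hB (Kernel.aemeasurable _), h]

lemma IsFellerProcess.map_snd_of_stationary (hV : IsFellerProcess ℱ P V)
    (huniq : ∀ μ, IsInvariantLaw P V μ → μ = π)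
    (hg : IsMonotoneDrift (gradθ f) L κ B) {ε : ℝ≥0} (hε : 0 < ε)
    {Q : Measure (EuclideanSpace ℝ (Fin K) × S)} [IsProbabilityMeasure Q]
    (hQ : ∀ t, coupledKernel P (fun r => V (r / ε)) (gradθ f) t ∘ₘ Q = Q) :
    Q.map Prod.snd = π := by
  refine huniq _ ⟨Measure.isProbabilityMeasure_map measurable_snd.aemeasurable, fun t => ?_⟩
  -- The index runs at speed `1 / ε`, so slow time `t ε` corresponds to index time `t`.
  have h1 := (hV.isMarkovFamily_timeChange ε).map_snd_coupledKernel hg (t * ε) Q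
  rw [hQ, mul_div_cancel_right₀ _ hε.ne'] at h1
  exact h1.symm

lemma isFiberLipschitz_min_norm_sub (x : EuclideanSpace ℝ (Fin K)) : IsFiberLipschitz (S := S) 1 1
      fun p : EuclideanSpace ℝ (Fin K) × S => min 1 ‖p.1 - x‖ := by
  refine ⟨measurable_const.min (measurable_fst.sub measurable_const).norm, fun p => ?_,
    fun m m' y => ?_⟩
  · rw [abs_of_nonneg (le_min zero_le_one (norm_nonneg _))]
    exact min_le_left _ _
  · have h1 := abs_norm_sub_norm_le (m - x) (m' - x)
    rw [sub_sub_sub_cancel_right] at h1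
    rw [one_mul]
    refine le_trans ?_ h1
    exact (abs_min_sub_min_le_max _ _ _ _).trans_eq (by simp)

/-- Run the stationary law for time `T`, then replace the initial position by `x` while keeping the
index. Contraction and the absorbing ball bound the cost. What remains is the displacement of the
flow from `x` under the stationary index law, controlled by the noise. -/
lemma IsFellerProcess.integral_stationary_le (hV : IsFellerProcess ℱ P V)
    (huniq : ∀ μ, IsInvariantLaw P V μ → μ = π) [IsProbabilityMeasure π]
    (hg : IsMonotoneDrift (gradθ f) L κ B) {x : EuclideanSpace ℝ (Fin K)}
    {G : C(S, EuclideanSpace ℝ (Fin K))} (hG : ∀ y, G y = gradθ f x y) {ε : ℝ≥0} (hε : 0 < ε)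
    {Q : Measure (EuclideanSpace ℝ (Fin K) × S)} [IsProbabilityMeasure Q]
    (hQs : ∀ t, coupledKernel P (fun r => V (r / ε)) (gradθ f) t ∘ₘ Q = Q)
    (hQb : ∀ᵐ p ∂Q, ‖p.1‖ ≤ B / κ) (T : ℝ≥0) {C η γ : ℝ} (hC0 : 0 ≤ C) (hη : 0 ≤ η) (hγ : 0 < γ)
    (hC : ∀ a : ℝ≥0, ∫ ω, noise G V a ω ∂(P ∘ₘ π) ≤ a * (C + η * a)) :
    ∫ p, min 1 ‖p.1 - x‖ ∂Q ≤ Real.exp (-κ * T) * (B / κ + ‖x‖) +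
      (γ + (2 + (L : ℝ) ^ 2 / κ * T) * (T * (ε * C + η * T)) / γ) := by
  have hh := isFiberLipschitz_min_norm_sub (S := S) x
  have hUε := hV.isMarkovFamily_timeChange ε
  have hmk := hUε.isMarkovKernel_coupledKernel hg T
  have hK := hUε.isFiberLipschitz_coupledKernel hg T zero_le_one hh
  have hsnd := hV.map_snd_of_stationary huniq hg hε hQs
  set k : EuclideanSpace ℝ (Fin K) × S → ℝ := fun p => ∫ q, min 1 ‖q.1 - x‖
      ∂(coupledKernel P (fun r => V (r / ε)) (gradθ f) T p) with hk
  have hmx : Measurable fun y => k (x, y) := hK.measurable.comp measurable_prodMk_left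
  have hix : Integrable (fun p : EuclideanSpace ℝ (Fin K) × S => k (x, p.2)) Q :=
    integrable_of_measurable_of_bound (hmx.comp measurable_snd) fun p => hK.bound (x, p.2)
  have h1 : ∀ᵐ p ∂Q, k p ≤ Real.exp (-κ * T) * (B / κ + ‖x‖) + k (x, p.2) := by
    filter_upwards [hQb] with p hp
    have h2 : k p - k (x, p.2) ≤ Real.exp (-κ * T) * 1 * ‖p.1 - x‖ :=
      (abs_le.1 (hK.lip p.1 x p.2)).2
    have h3 : ‖p.1 - x‖ ≤ B / κ + ‖x‖ := (norm_sub_le _ _).trans (by gcongr)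
    have h4 : Real.exp (-κ * T) * 1 * ‖p.1 - x‖ ≤ Real.exp (-κ * T) * (B / κ + ‖x‖) := by
      rw [mul_one]; gcongr
    linarith
  have h2 : ∫ p, min 1 ‖p.1 - x‖ ∂Q = ∫ p, k p ∂Q := by
    conv_lhs => rw [← hQs T]
    exact integral_comp_measure hh.measurable hh.bound
  have h3 : ∫ p, k p ∂Q ≤ ∫ p, (Real.exp (-κ * T) * (B / κ + ‖x‖) + k (x, p.2)) ∂Q :=
    integral_mono_ae (integrable_of_measurable_of_bound hK.measurable hK.bound)
      ((integrable_const _).add hix) h1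
  rw [integral_add (integrable_const _) hix, integral_const, probReal_univ, one_smul] at h3
  have hD : ∀ t ≤ T, ∫ ω, noise G (fun r => V (r / ε)) t ω ∂(P ∘ₘ π) ≤ T * (ε * C + η * T) :=
    fun t ht => integral_noise_timeChange_le (U := V) hC0 hη hC hε ht
  have h4 := hUε.integral_min_flow_le (π := π) hg (m := x) (G := G) hG (T := T) hD hγ
  have h5 : ∫ p, k (x, p.2) ∂Q = ∫ y, k (x, y) ∂π := by
    rw [← hsnd, integral_map measurable_snd.aemeasurable hmx.aestronglyMeasurable]
  have hm : Measurable fun ω => min 1 ‖flow (gradθ f) (fun r => V (r / ε) ω) x T - x‖ :=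
    measurable_const.min ((measurable_fst.comp (hUε.measurable_coupled_path hg T x)).sub
      measurable_const).norm
  have h6 : ∫ ω, min 1 ‖flow (gradθ f) (fun r => V (r / ε) ω) x T - x‖ ∂(P ∘ₘ π) =
      ∫ y, k (x, y) ∂π := by
    rw [integral_comp_measure (C := 1) hm fun ω => by
      rw [abs_of_nonneg (le_min zero_le_one (norm_nonneg _))]
      exact min_le_left _ _]
    exact integral_congr_ae (ae_of_all _ fun y =>
      (hUε.integral_coupledKernel hg T (x, y) hh.measurable).symm)
  rw [h6] at h4
  rw [h5] at h3
  rw [h2]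
  exact h3.trans (add_le_add le_rfl h4)

/-- The stationary coupled process concentrates at a zero of the averaged gradient. -/
lemma IsFellerProcess.tendsto_integral_stationary (hV : IsFellerProcess ℱ P V)
    (hinv : IsInvariantLaw P V π) (huniq : ∀ μ, IsInvariantLaw P V μ → μ = π)
    (hg : IsMonotoneDrift (gradθ f) L κ B) {x : EuclideanSpace ℝ (Fin K)}
    (hx : ∫ y, gradθ f x y ∂π = 0) {Q : ℝ≥0 → Measure (EuclideanSpace ℝ (Fin K) × S)}
    (hQ : ∀ ε ∈ Ioo (0 : ℝ≥0) 1, IsProbabilityMeasure (Q ε) ∧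
      (∀ t, coupledKernel P (fun r => V (r / ε)) (gradθ f) t ∘ₘ Q ε = Q ε) ∧
      ∀ᵐ p ∂(Q ε), ‖p.1‖ ≤ B / κ) :
    Tendsto (fun ε => ∫ p, min 1 ‖p.1 - x‖ ∂(Q ε)) (𝓝[>] 0) (𝓝 0) := by
  have hκ := hg.pos
  have hπ : IsProbabilityMeasure π := hinv.1
  have hU := hV.isMarkovFamily
  set R : ℝ := B / κ + ‖x‖ with hR
  let G : C(S, EuclideanSpace ℝ (Fin K)) := ⟨gradθ f x,
    hg.cont.comp (f := fun y => (x, y)) (continuous_const.prodMk continuous_id)⟩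
  rw [Metric.tendsto_nhds]
  intro α hα
  -- The tolerance `α` is split in four: `T` is fixed by the contraction term, `γ` is `α / 4`, `η`
  -- is then chosen from `T`, which determines `C`, and finally `ε` is taken small.
  have hexp : Tendsto (fun T : ℝ≥0 => Real.exp (-κ * T) * R) atTop (𝓝 0) := by
    have h1 : Tendsto (fun T : ℝ≥0 => Real.exp (-κ * T)) atTop (𝓝 0) :=
      Real.tendsto_exp_atBot.comp
        (NNReal.tendsto_coe_atTop.2 tendsto_id |>.const_mul_atTop_of_neg (neg_neg_of_pos hκ))
    simpa using h1.mul_const R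
  obtain ⟨T, hT⟩ := (hexp.eventually (gt_mem_nhds (by positivity : (0 : ℝ) < α / 4))).exists
  set c : ℝ := (2 + (L : ℝ) ^ 2 / κ * T) * T / (α / 4) with hc
  have hc0 : 0 ≤ c := by positivity
  set η : ℝ := α / 4 / (c * T + 1) with hη_def
  have hη : 0 < η := by positivity
  have hcη : c * (η * T) ≤ α / 4 := by
    have h1 : c * (η * T) = c * T / (c * T + 1) * (α / 4) := by rw [hη_def]; ring
    rw [h1]
    refine mul_le_of_le_one_left (by positivity) ?_
    rw [div_le_one (by positivity)]
    linarith
  obtain ⟨C, hC0, hC⟩ := hU.exists_integral_norm_sq_le hinv.2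
    (fun μ hμ h => huniq μ ⟨hμ, h⟩) G hx hη
  have hlim : Tendsto (fun ε : ℝ≥0 => c * (ε * C)) (𝓝[>] 0) (𝓝 0) := by
    have h1 : Continuous fun ε : ℝ≥0 => c * ((ε : ℝ) * C) := by fun_prop
    simpa using (h1.tendsto 0).mono_left nhdsWithin_le_nhds
  filter_upwards [hlim.eventually (gt_mem_nhds (by positivity : (0 : ℝ) < α / 4)),
    Ioo_mem_nhdsGT (zero_lt_one (α := ℝ≥0))] with ε hε1 hε
  obtain ⟨hQp, hQs, hQb⟩ := hQ ε hε
  have h1 := hV.integral_stationary_le huniq hg (G := G) (fun y => rfl) hε.1 hQs hQb T hC0 hη.le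
    (by positivity : 0 < α / 4) hC
  rw [← hR] at h1
  have h2 : (2 + (L : ℝ) ^ 2 / κ * T) * (T * (ε * C + η * T)) / (α / 4) =
      c * (ε * C) + c * (η * T) := by rw [hc]; ring
  have h3 : 0 ≤ ∫ p, min 1 ‖p.1 - x‖ ∂(Q ε) :=
    integral_nonneg fun p => le_min zero_le_one (norm_nonneg _)
  rw [Real.dist_eq, sub_zero, abs_of_nonneg h3]
  linarith

end Coupled

end SGP

/-! ### The main theorem. -/

theorem mainTheorem4 {K : ℕ} {S : Type u} [TopologicalSpace S] [PolishSpace S]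
    [CompactSpace S] [MeasurableSpace S] [BorelSpace S]
    {Ω : Type v} {mΩ : MeasurableSpace Ω} (ℱ : Filtration ℝ≥0 mΩ)
    (P : Kernel S Ω) [IsMarkovKernel P] (V : ℝ≥0 → Ω → S) (π : Measure S)
    (f : EuclideanSpace ℝ (Fin K) → S → ℝ)
    (hV : SGP.IsFellerProcess ℱ P V)
    (hπ : SGP.IndexAssumption.{u, v, w} P V π)
    (hf : SGP.TargetAssumption π f)
    (hconv : SGP.StrongConvexity f) :
    ∃ θstar : EuclideanSpace ℝ (Fin K),
      SGP.IsUniqueMinimizer (SGP.fullTarget π f) θstar ∧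
      ∃ Q : ℝ≥0 → Measure (EuclideanSpace ℝ (Fin K) × S),
        (∀ ε ∈ Ioo (0 : ℝ≥0) 1, SGP.IsStationary P V f ε (Q ε) ∧
          ∀ Q', SGP.IsStationary P V f ε Q' → Q' = Q ε) ∧
        ∃ ρ : ℝ≥0 → ℝ≥0,
          (∀ ε ∈ Ioo (0 : ℝ≥0) 1, ρ ε ≤ 1) ∧
          Tendsto ρ (𝓝[>] 0) (𝓝 0) ∧
          ∀ ε ∈ Ioo (0 : ℝ≥0) 1,
            SGP.wassersteinD ((Q ε).map Prod.fst) (Measure.dirac θstar) ≤ (ρ ε : ℝ≥0∞) := by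
  obtain ⟨L, κ, B, hg⟩ := hf.exists_isMonotoneDrift hconv
  have hπp : IsProbabilityMeasure π := hπ.invariant.1
  obtain ⟨x, hx⟩ := hf.exists_integral_grad_eq_zero hg
  refine ⟨x, hf.isUniqueMinimizer hg hx, ?_⟩
  -- Existence needs no positivity of `ε`: for `ε = 0` division returns `0` and the index is frozen
  -- at its initial value.
  choose Q hQp hQs hQsnd hQb using fun ε : ℝ≥0 =>
    (hV.isMarkovFamily_timeChange ε).exists_stationary hg fun t => hπ.invariant.2 (t / ε)
  refine ⟨Q, fun ε hε => ⟨(hV.isStationary_iff hg ε (Q ε)).2 ⟨hQp ε, hQs ε⟩, fun Q' hQ' => ?_⟩, ?_⟩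
  · obtain ⟨hQ'p, hQ's⟩ := (hV.isStationary_iff hg ε Q').1 hQ'
    exact (hV.isMarkovFamily_timeChange ε).stationary_unique hg
      (hV.map_snd_of_stationary hπ.unique hg hε.1 hQ's) (hQsnd ε) hQ's (hQs ε)
  -- The rate is the transport cost of the coupling with the Dirac mass itself.
  · refine ⟨fun ε => (∫ p, min 1 ‖p.1 - x‖ ∂(Q ε)).toNNReal, fun ε _ => ?_, ?_, fun ε _ => ?_⟩
    · rw [Real.toNNReal_le_one]
      refine (le_abs_self _).trans (SGP.abs_integral_le_of_bound fun p => ?_)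
      rw [abs_of_nonneg (le_min zero_le_one (norm_nonneg _))]
      exact min_le_left _ _
    · have h1 := hV.tendsto_integral_stationary hπ.invariant hπ.unique hg hx
        (Q := Q) fun ε _ => ⟨hQp ε, hQs ε, hQb ε⟩
      have h2 := (continuous_real_toNNReal.tendsto 0).comp h1
      rw [Real.toNNReal_zero] at h2
      exact h2
    · have := Measure.isProbabilityMeasure_map (μ := Q ε) measurable_fst.aemeasurable
      refine (SGP.wassersteinD_dirac_le _ x).trans_eq ?_
      rw [integral_map measurable_fst.aemeasurable]
      · rfl
      · exact (measurable_const.min (measurable_id.sub measurable_const).norm).aestronglyMeasurable
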